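/- **Theorem (Locality for vertex operators).** Let $b,\mu>0$, let $M=\mathbb R\times[-1,1]$ be the cylinder (with $(t,-1)\equiv(t,1)$), let $k\ge 2$, and let $v_j=(t_j,x_j)\in M$ and $\alpha_j\in\mathbb C$ for $1\le j\le k$. Assume that $\Re(\alpha_j)>-\frac1{2b}$ for every $j$, that $w:=-\frac1b\sum_{j=1}^k\alpha_j$ is an integer, and that $(t_j-t_{j'})\pm(x_j-x_{j'})\notin 2\mathbb Z$ for all $j<j'$ and both signs. For $\Re\tau\ge 0$ and $x\in\mathbb R$ put, with principal logarithms, $$g(\tau,x)=-\frac{\pi\tau}{2}-\frac12\log\bigl(1-e^{-\pi\tau+\pi i x}\bigr)-\frac12\log\bigl(1-e^{-\pi\tau-\pi i x}\bigr).$$ Let $\gamma$ be the contour in $\mathbb C$ that comes in horizontally from $it_1-\infty$ to $it_1$, then moves vertically to $it_2$, then to $it_3$, and so on to $it_k$ (the $t_j$ need not be monotone), and leaves horizontally to $it_k+\infty$, with a piecewise $C^1$ parametrization $s\mapsto\gamma(s)$. The insertion $(it_j,x_j)$ is visited by $\gamma$ as the $j$-th marked point. For two points $u,u'$ of $\gamma\times[-1,1]$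 with given contour parameters (respectively labels), let $\mathcal T(u-u')$ be the difference of the one that comes later along $\gamma$ minus the one that comes earlier; insertions are ordered by their labels, and ties that involve screening points, which form a null set, do not matter. If $w\ge 0$, the ordered Lorentzian correlator is $$\begin{aligned}C^{\mathrm L}_{\alpha_1,\dots,\alpha_k}(v_1,\dots,v_k)={}&\frac{(-\mu)^w}{w!}\exp\Bigl(-4\sum_{j<j'}\alpha_j\alpha_{j'}\,g(\mathcal T(v_j-v_{j'}))\Bigr)\\&\cdot\int_{(\gamma\times[-1,1])^w}\exp\Bigl(-4b\sum_{j=1}^k\sum_{l=1}^w\alpha_j\,g(\mathcal T(v_j-u_l))-4b^2\sum_{l<l'}g(\mathcal T(u_l-u_{l'}))\Bigr)\,du_1\cdots du_w,\end{aligned}$$ where in $g$ and $\mathcal T$ the symbol $v_j$ stands for $(it_j,x_j)$, where $u_l=(\gamma(s_l),b_l)$ and $du_l=\gamma'(s_l)\,ds_l\,db_l$ with $s_l\in\mathbb R$, $b_l\in[-1,1]$, and where the $0$-fold integral is $1$. If $w<0$, the correlator is $0$. Suppose that for some $1\le p\le k-1$ the points $v_p$ and $v_{p+1}$ are spacelike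 separated on the cylinder, i.e. $|t_p-t_{p+1}|<d_1(x_p-x_{p+1})$, where $d_1(\xi)=\min_{m\in\mathbb Z}|\xi+2m|$. Then $$C^{\mathrm L}_{\alpha_1,\dots,\alpha_p,\alpha_{p+1},\dots,\alpha_k}(v_1,\dots,v_p,v_{p+1},\dots,v_k)=C^{\mathrm L}_{\alpha_1,\dots,\alpha_{p+1},\alpha_p,\dots,\alpha_k}(v_1,\dots,v_{p+1},v_p,\dots,v_k),$$ and, when $w\ge0$, the integrals that define the two sides are absolutely convergent. -/

import Mathlib

open MeasureTheory

namespace TimelikeLiouville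

/-- The fundamental domain `ℝ × [-1,1]` of the cylinder; a point is `(t, x)`, time first. The space
coordinate matters only modulo `2`. -/
def cylinder : Set (ℝ × ℝ) := Set.univ ×ˢ Set.Icc (-1) 1

/-- `d₁(ξ) = min_{m ∈ ℤ} |ξ + 2m|`. -/
noncomputable def d1 (ξ : ℝ) : ℝ := ⨅ m : ℤ, |ξ + 2 * (m : ℝ)|

/-- Spacelike separation of two points on the Lorentzian cylinder. -/
def SpacelikeSeparated (u v : ℝ × ℝ) : Prop := |u.1 - v.1| < d1 (u.2 - v.2)

/-- No difference `v_j - v_{j'}`, `j < j'`, lies on the boundary of the light cone. -/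
def NonLightCone {k : ℕ} (v : Fin k → ℝ × ℝ) : Prop :=
  ∀ j j' : Fin k, j < j' → ∀ m : ℤ,
    ((v j).1 - (v j').1) + ((v j).2 - (v j').2) ≠ 2 * (m : ℝ) ∧
    ((v j).1 - (v j').1) - ((v j).2 - (v j').2) ≠ 2 * (m : ℝ)

/-- The Green's function continued to complex time `τ`, `Re τ ≥ 0`, with principal logarithms. -/
noncomputable def green (τ : ℂ) (x : ℝ) : ℂ :=
  -(Real.pi * τ / 2)
    - 1 / 2 * Complex.log (1 - Complex.exp (-Real.pi * τ + Real.pi * Complex.I * x))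
    - 1 / 2 * Complex.log (1 - Complex.exp (-Real.pi * τ - Real.pi * Complex.I * x))

/-- The contour `γ` of an ordered list of `n + 1` insertions, labelled `0, …, n`, with times
`t_0, …, t_n`. It is parametrized so that the insertion `j` is visited at parameter `s = j`:
`γ(s) = i t_0 + s` for `s ≤ 0`, `γ(s) = i ((1 - c) t_j + c t_{j+1})` for `s = j + c` with
`0 ≤ c ≤ 1` and `j < n`, and `γ(s) = i t_n + (s - n)` for `s ≥ n`. -/
noncomputable def contour {n : ℕ} (v : Fin (n + 1) → ℝ × ℝ) (s : ℝ) : ℂ :=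
  ((min s 0 + max (s - n) 0 : ℝ) : ℂ) + Complex.I *
    (((v 0).1 + ∑ j : Fin n,
      ((v j.succ).1 - (v j.castSucc).1) * max 0 (min 1 (s - (j : ℕ))) : ℝ) : ℂ)

/-- A point of `γ × [-1,1]` together with the contour parameter at which it is visited. -/
structure Visit where
  param : ℝ
  time : ℂ
  space : ℝ

/-- The marked visit of the insertion `j`. Distinct labels have distinct parameters, also when the
times agree, so that insertions are ordered by their labels. -/
noncomputable def externalVisit {n : ℕ} (v : Fin (n + 1) → ℝ × ℝ) (j : Fin (n + 1)) : Visit :=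
  ⟨(j : ℕ), Complex.I * (v j).1, (v j).2⟩

/-- The screening point with contour parameter `z.1` and space coordinate `z.2`. -/
noncomputable def screeningVisit {n : ℕ} (v : Fin (n + 1) → ℝ × ℝ) (z : ℝ × ℝ) : Visit :=
  ⟨z.1, contour v z.1, z.2⟩

open Classical in
/-- `g` evaluated at the time-ordered difference `𝒯(u - u')`. -/
noncomputable def orderedGreen (u u' : Visit) : ℂ :=
  if u'.param ≤ u.param then green (u.time - u'.time) (u.space - u'.space)
  else green (u'.time - u.time) (u'.space - u.space)

/-- The integrand of the `w`-fold contour integral over `γ × [-1,1]`, including the factors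
`γ'(s_l)`. -/
noncomputable def screeningIntegrand {n : ℕ} (b : ℝ) (α : Fin (n + 1) → ℂ)
    (v : Fin (n + 1) → ℝ × ℝ) (w : ℕ) (z : Fin w → ℝ × ℝ) : ℂ :=
  Complex.exp
      (-4 * b * ∑ j, ∑ l, α j * orderedGreen (externalVisit v j) (screeningVisit v (z l))
        - 4 * (b : ℂ) ^ 2 * ∑ l, ∑ l' ∈ Finset.Ioi l,
            orderedGreen (screeningVisit v (z l)) (screeningVisit v (z l')))
    * ∏ l, deriv (contour v) (z l).1

/-- Lebesgue measure `∏_l ds_l db_l` on `(ℝ × [-1,1])^w`. -/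
noncomputable def screeningMeasure (w : ℕ) : Measure (Fin w → ℝ × ℝ) :=
  Measure.pi fun _ => (volume : Measure ℝ).prod (volume.restrict (Set.Icc (-1) 1))

/-- The Lorentzian correlator of the ordered insertions `(α_0, v_0), …, (α_n, v_n)`, where
`w = -b⁻¹ ∑ α_j` is the screening number. -/
noncomputable def lorentzianCorrelator {n : ℕ} (b μ : ℝ) (w : ℤ) (α : Fin (n + 1) → ℂ)
    (v : Fin (n + 1) → ℝ × ℝ) : ℂ :=
  if w < 0 then 0
  else (-(μ : ℂ)) ^ w.toNat / (w.toNat.factorial : ℂ)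
    * Complex.exp (-4 * ∑ j, ∑ j' ∈ Finset.Ioi j,
        α j * α j' * orderedGreen (externalVisit v j) (externalVisit v j'))
    * ∫ z, screeningIntegrand b α v w.toNat z ∂screeningMeasure w.toNat

end TimelikeLiouville

namespace TimelikeLiouville

/-! Everything rests on one symmetry: g(-τ, x) = g(τ, x) when (Im τ, x) is spacelike on the cylinder
(`green_neg_left`). Passing from log(1 - e^w) to log(1 - e^(-w)) costs w plus an odd multiple of πi
fixed by the cell of Im w; for spacelike arguments the two multiples cancel, and the linear terms
are absorbed by -πτ/2. So the order of two points along the contour is immaterial if they are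
spacelike or have the same complex time (`orderedGreen_congr`). For the factor of the insertions
among themselves this already suffices (`sum_external_swap`). The screening integral needs more,
because the exchange also changes the contour.

Both contours are compared with one zigzag through the heights t_1, …, t_p, t_{p+1}, t_p, t_{p+2},
…, with v_{p+1} at the tip of the fold and v_p at either the first or the second passage through
t_p. Deleting the unoccupied passage gives one ordering or the other (`pathIntegral_swap`). For this
purpose heights of vertices and marks of insertions are independent data in `pathIntegral`; the
marks only fix the order.

Moving v_p across the fold (`pathIntegral_move_across`) uses cancellation. If some screening points
on the fold are spacelike to v_{p+1}, reflect the one nearest to the tip onto the other branch. The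
weight is unchanged and the speed changes sign, so such configurations contribute zero
(`integral_eq_setIntegral_of_fold`). In the remaining configurations every point of the fold is
causally related to v_{p+1}, hence spacelike to v_p, and does not notice on which side v_p sits.

Deleting an unoccupied vertex (`pathIntegral_delete`) uses the same cancellation with the whole
fold, together with invariance under reparametrization, if the vertex is interior
(`pathIntegral_insertVertex`). At the left end it is Cauchy's theorem for the half strip swept by
the leg (`integral_leg_sub_eq`, `integral_leg`). The leg slides for one screening point at a time,
on configurations with spatial distances at least δ and in steps of height less than δ, so that the
order among points in the swept band is immaterial; then δ tends to 0. The right end follows by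
reversing the contour.

All of this requires absolute convergence (`integrable_pathIntegrand`). Neutrality gives the decay
exp(-2πb²|Re|) for each screening point, pairs of screening points are not singular, and an
insertion gives powers β > -1 of the two light-cone distances. Insertions off each other's light
cones cannot make two factors in the same light-cone coordinate singular together. -/

/-! ### Reflection symmetry of the Green's function at spacelike separation -/

lemma one_sub_exp_mem_slitPlane_of_im {w : ℂ} (h : ∀ m : ℤ, w.im ≠ 2 * Real.pi * m) :
    1 - Complex.exp w ∈ Complex.slitPlane := by
  rw [Complex.mem_slitPlane_iff]
  by_cases hs : Real.sin w.im = 0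
  · left
    obtain ⟨k, hk⟩ := Real.sin_eq_zero_iff.1 hs
    rcases Int.even_or_odd' k with ⟨c, hc | hc⟩
    · exact absurd (by rw [← hk, hc]; push_cast; ring) (h c)
    · have : Real.cos w.im = -1 := by
        rw [← hk, hc]; push_cast
        rw [show (2 * (c : ℝ) + 1) * Real.pi = Real.pi + c * (2 * Real.pi) by ring,
          Real.cos_add_int_mul_two_pi, Real.cos_pi]
      simp only [Complex.sub_re, Complex.one_re, Complex.exp_re, this]
      have := Real.exp_pos w.re
      linarith
  · right
    simp only [Complex.sub_im, Complex.one_im, Complex.exp_im]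
    have := (Real.exp_pos w.re).ne'
    simp [this, hs]

lemma one_sub_exp_mem_slitPlane_of_re {w : ℂ} (h : w.re < 0) :
    1 - Complex.exp w ∈ Complex.slitPlane := by
  rw [Complex.mem_slitPlane_iff]
  left
  have h1 : ‖Complex.exp w‖ < 1 := by rw [Complex.norm_exp]; exact Real.exp_lt_one_iff.mpr h
  have h2 := (Complex.re_le_norm (Complex.exp w))
  simp only [Complex.sub_re, Complex.one_re]
  linarith

/-- Since 1 - e^w = -e^w (1 - e^(-w)), the two sides agree modulo 2πi. The sign of Im(1 - e^(-w)),
which is that of sin(Im w), puts the imaginary part of the right side in (-π, π], so it is the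
principal value. -/
lemma log_one_sub_exp_of_im_mem {w : ℂ} (h0 : 0 < w.im) (h1 : w.im < 2 * Real.pi) :
    Complex.log (1 - Complex.exp w)
      = Complex.log (1 - Complex.exp (-w)) + w - Real.pi * Complex.I := by
  have hmem : 1 - Complex.exp (-w) ∈ Complex.slitPlane := by
    refine one_sub_exp_mem_slitPlane_of_im fun m hm => ?_
    rw [Complex.neg_im] at hm
    have hpi := Real.pi_pos
    have a1 : (m : ℝ) < 0 := by nlinarith
    have a2 : (-1 : ℝ) < m := by nlinarith
    have b1 : m < 0 := by exact_mod_cast a1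
    have b2 : -1 < m := by exact_mod_cast a2
    omega
  have hne := Complex.slitPlane_ne_zero hmem
  have key : 1 - Complex.exp w
      = Complex.exp (Complex.log (1 - Complex.exp (-w)) + w - Real.pi * Complex.I) := by
    rw [Complex.exp_sub, Complex.exp_add, Complex.exp_log hne, Complex.exp_pi_mul_I, sub_mul,
      ← Complex.exp_add]
    simp [div_neg]
  have him : (1 - Complex.exp (-w)).im = Real.exp (-w.re) * Real.sin w.im := by
    simp [Complex.exp_im]
  have hE := Real.exp_pos (-w.re)
  have harg := Complex.neg_pi_lt_arg (1 - Complex.exp (-w))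
  have harg' := Complex.arg_le_pi (1 - Complex.exp (-w))
  have hi : (Complex.log (1 - Complex.exp (-w)) + w - Real.pi * Complex.I).im
      = (1 - Complex.exp (-w)).arg + w.im - Real.pi := by
    simp [Complex.log_im]
  rw [key, Complex.log_exp]
  · rw [hi]
    rcases le_or_gt w.im Real.pi with hle | hgt
    · have : 0 ≤ (1 - Complex.exp (-w)).arg := by
        rw [Complex.arg_nonneg_iff, him]
        exact mul_nonneg hE.le (Real.sin_nonneg_of_nonneg_of_le_pi h0.le hle)
      linarith
    · linarith
  · rw [hi]
    rcases le_or_gt w.im Real.pi with hle | hgt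
    · linarith
    · have : (1 - Complex.exp (-w)).arg < 0 := by
        rw [Complex.arg_neg_iff, him]
        refine mul_neg_of_pos_of_neg hE ?_
        have : Real.sin w.im = -Real.sin (w.im - Real.pi) := by rw [Real.sin_sub_pi]; ring
        rw [this]
        have := Real.sin_pos_of_pos_of_lt_pi (x := w.im - Real.pi) (by linarith) (by linarith)
        linarith
      linarith

lemma log_one_sub_exp_sub {w : ℂ} (k : ℤ) (h0 : 2 * Real.pi * k < w.im)
    (h1 : w.im < 2 * Real.pi * (k + 1)) :
    Complex.log (1 - Complex.exp w) - Complex.log (1 - Complex.exp (-w))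
      = w - Real.pi * Complex.I * (2 * k + 1) := by
  have e1 : Complex.exp (w - k * (2 * Real.pi * Complex.I)) = Complex.exp w :=
    Complex.exp_eq_exp_iff_exists_int.2 ⟨-k, by push_cast; ring⟩
  have e2 : Complex.exp (-(w - k * (2 * Real.pi * Complex.I))) = Complex.exp (-w) :=
    Complex.exp_eq_exp_iff_exists_int.2 ⟨k, by ring⟩
  have him : (w - k * (2 * Real.pi * Complex.I)).im = w.im - 2 * Real.pi * k := by
    simp; ring
  have := log_one_sub_exp_of_im_mem (w := w - k * (2 * Real.pi * Complex.I))
    (by rw [him]; linarith) (by rw [him]; linarith)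
  rw [e1, e2] at this
  rw [this]; ring

/-- Time and space separations `t`, `x` that are spacelike modulo the period of the cylinder. -/
def Spacelike (t x : ℝ) : Prop := ∀ m : ℤ, |t| < |x + 2 * m|

lemma SpacelikeSeparated.spacelike {u v : ℝ × ℝ} (h : SpacelikeSeparated u v) :
    Spacelike (u.1 - v.1) (u.2 - v.2) := fun m =>
  h.trans_le (ciInf_le ⟨0, by rintro _ ⟨m, rfl⟩; exact abs_nonneg _⟩ m)

lemma Spacelike.neg {t x : ℝ} (h : Spacelike t x) : Spacelike (-t) (-x) := fun m => by
  have := h (-m)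
  rw [abs_neg, ← abs_neg (-x + _)]
  convert this using 2
  push_cast; ring

lemma Spacelike.sub_comm {t t' x x' : ℝ} (h : Spacelike (t - t') (x - x')) :
    Spacelike (t' - t) (x' - x) := by
  simpa using h.neg

/-- Comparing with the two multiples of the period next to x puts both x - t and x + t in one open
cell (2k, 2k + 2). This common cell is what makes the branch constants cancel in `green_neg_left`.
-/
lemma Spacelike.exists_int {t x : ℝ} (h : Spacelike t x) :
    ∃ k : ℤ, |t| < x - 2 * k ∧ |t| < 2 * (k + 1) - x := by
  refine ⟨⌊x / 2⌋, ?_, ?_⟩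
  · have := h (-⌊x / 2⌋)
    have h2 := Int.floor_le (x / 2)
    rwa [abs_of_nonneg (a := x + _) (by push_cast; linarith), show x + 2 * ((-⌊x / 2⌋ : ℤ) : ℝ)
      = x - 2 * ⌊x / 2⌋ by push_cast; ring] at this
  · have := h (-(⌊x / 2⌋ + 1))
    have h2 := Int.lt_floor_add_one (x / 2)
    rw [abs_of_nonpos (a := x + _) (by push_cast; linarith)] at this
    push_cast at this
    linarith

lemma green_neg_right (τ : ℂ) (x : ℝ) : green τ (-x) = green τ x := by
  unfold green
  push_cast
  rw [show -(Real.pi : ℂ) * τ + Real.pi * Complex.I * -(x : ℂ)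
      = -Real.pi * τ - Real.pi * Complex.I * x by ring,
    show -(Real.pi : ℂ) * τ - Real.pi * Complex.I * -(x : ℂ)
      = -Real.pi * τ + Real.pi * Complex.I * x by ring]
  ring

lemma green_neg_left {τ : ℂ} {x : ℝ} (h : Spacelike τ.im x) : green (-τ) x = green τ x := by
  obtain ⟨k, h1, h2⟩ := h.exists_int
  have hpi := Real.pi_pos
  have ht := abs_lt.1 h1
  have ht' := abs_lt.1 h2
  have i1 : (-(Real.pi : ℂ) * τ + Real.pi * Complex.I * x).im = Real.pi * (x - τ.im) := by
    simp; ring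
  have i2 : (-(Real.pi : ℂ) * τ - Real.pi * Complex.I * x).im = Real.pi * (-x - τ.im) := by
    simp; ring
  have e1 := log_one_sub_exp_sub (w := -(Real.pi : ℂ) * τ + Real.pi * Complex.I * x) k
    (by rw [i1]; nlinarith) (by rw [i1]; nlinarith)
  -- The second exponent has imaginary part π(-x - Im τ), in the cell with index -k - 1. Its
  -- constant 2(-k - 1) + 1 is the negative of 2k + 1, and the sum of the exponents is -2πτ.
  have e2 := log_one_sub_exp_sub (w := -(Real.pi : ℂ) * τ - Real.pi * Complex.I * x) (-k - 1)
    (by rw [i2]; push_cast; nlinarith) (by rw [i2]; push_cast; nlinarith)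
  unfold green
  rw [show -(Real.pi : ℂ) * -τ + Real.pi * Complex.I * x
      = -(-Real.pi * τ - Real.pi * Complex.I * x) by ring,
    show -(Real.pi : ℂ) * -τ - Real.pi * Complex.I * x
      = -(-Real.pi * τ + Real.pi * Complex.I * x) by ring]
  push_cast at e2
  linear_combination (1 / 2) * e1 + (1 / 2) * e2

lemma orderedGreen_of_spacelike {u u' : Visit}
    (h : Spacelike (u.time.im - u'.time.im) (u.space - u'.space)) :
    orderedGreen u u' = green (u'.time - u.time) (u'.space - u.space) := by
  unfold orderedGreen
  split_ifs
  · rw [← neg_sub u.time, ← neg_sub u.space, green_neg_right,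
      green_neg_left (by simpa using h)]
  · rfl

lemma orderedGreen_of_spacelike' {u u' : Visit}
    (h : Spacelike (u.time.im - u'.time.im) (u.space - u'.space)) :
    orderedGreen u u' = green (u.time - u'.time) (u.space - u'.space) := by
  rw [orderedGreen_of_spacelike h, ← neg_sub u.time, ← neg_sub u.space, green_neg_right,
      green_neg_left (by simpa using h)]

lemma orderedGreen_of_lt {u u' : Visit} (h : u.param < u'.param) :
    orderedGreen u u' = green (u'.time - u.time) (u'.space - u.space) := by
  unfold orderedGreen
  rw [if_neg (not_le.2 h)]

lemma orderedGreen_of_ge {u u' : Visit} (h : u'.param ≤ u.param) :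
    orderedGreen u u' = green (u.time - u'.time) (u.space - u'.space) := by
  unfold orderedGreen
  rw [if_pos h]

lemma orderedGreen_of_time_eq {u u' : Visit} (h : u.time = u'.time) :
    orderedGreen u u' = green 0 (u.space - u'.space) := by
  unfold orderedGreen
  rw [h, sub_self, ← neg_sub u.space, green_neg_right, ite_self]

lemma orderedGreen_comm_of_param_ne {u u' : Visit} (h : u.param ≠ u'.param) :
    orderedGreen u u' = orderedGreen u' u := by
  rcases lt_or_gt_of_ne h with h | h
  · rw [orderedGreen_of_lt h, orderedGreen_of_ge h.le]
  · rw [orderedGreen_of_lt h, orderedGreen_of_ge h.le]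

/-- The value depends on the parameters only through their order. -/
lemma orderedGreen_congr {u u' y y' : Visit} (h1 : u.time = y.time) (h2 : u'.time = y'.time)
    (h3 : u.space = y.space) (h4 : u'.space = y'.space)
    (h : (u'.param ≤ u.param ↔ y'.param ≤ y.param) ∨ u.time = u'.time ∨
      Spacelike (u.time.im - u'.time.im) (u.space - u'.space)) :
    orderedGreen u u' = orderedGreen y y' := by
  rcases h with h | h | h
  · unfold orderedGreen
    simp only [h1, h2, h3, h4, h]
  · rw [orderedGreen_of_time_eq h, orderedGreen_of_time_eq (by rw [← h1, ← h2, h]), h3, h4]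
  · rw [orderedGreen_of_spacelike h, orderedGreen_of_spacelike (by rwa [← h1, ← h2, ← h3, ← h4]),
      h1, h2, h3, h4]

/-! ### Piecewise linear contours with free vertex heights -/

/-- Height at parameter `s` of the contour with vertices `h 0, …, h m`. -/
noncomputable def path (m : ℕ) (h : ℕ → ℝ) (s : ℝ) : ℝ :=
  h 0 + ∑ j ∈ Finset.range m, (h (j + 1) - h j) * max 0 (min 1 (s - (j : ℕ)))

/-- Real part at parameter `s` of a contour with `m` vertical segments. -/
noncomputable def rpart (m : ℕ) (s : ℝ) : ℝ := min s 0 + max (s - m) 0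

open Classical in
/-- The derivative of the contour with vertices `h 0, …, h m`, away from the vertices. -/
noncomputable def dens (m : ℕ) (h : ℕ → ℝ) (s : ℝ) : ℂ :=
  (((if s < 0 then 1 else 0) + (if (m : ℝ) < s then 1 else 0) : ℝ) : ℂ) + Complex.I *
    ((∑ j ∈ Finset.range m, (h (j + 1) - h j) *
      (if (j : ℝ) < s ∧ s < j + 1 then 1 else 0) : ℝ) : ℂ)

lemma path_succ (m : ℕ) (h : ℕ → ℝ) (s : ℝ) :
    path (m + 1) h s = path m h s + (h (m + 1) - h m) * max 0 (min 1 (s - m)) := by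
  simp only [path, Finset.sum_range_succ]; ring

lemma path_of_le_zero {m : ℕ} {h : ℕ → ℝ} {s : ℝ} (hs : s ≤ 0) : path m h s = h 0 := by
  simp only [path]
  rw [Finset.sum_eq_zero, add_zero]
  intro j _
  have : (0 : ℝ) ≤ j := j.cast_nonneg
  rw [max_eq_left ((min_le_right _ _).trans (by linarith)), mul_zero]

lemma path_of_ge {m : ℕ} {h : ℕ → ℝ} {s : ℝ} (hs : (m : ℝ) ≤ s) : path m h s = h m := by
  induction m with
  | zero => simp [path]
  | succ m ih =>
    push_cast at hs
    rw [path_succ, ih (by linarith), min_eq_left (by linarith), max_eq_right zero_le_one]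
    ring

lemma path_of_mem {m : ℕ} {h : ℕ → ℝ} {s : ℝ} {j : ℕ} (hj : j < m) (h0 : (j : ℝ) ≤ s)
    (h1 : s ≤ j + 1) : path m h s = h j + (h (j + 1) - h j) * (s - j) := by
  induction m with
  | zero => omega
  | succ m ih =>
    rw [path_succ]
    rcases Nat.lt_succ_iff_lt_or_eq.1 hj with hlt | rfl
    · have : ((j : ℝ) + 1) ≤ m := by exact_mod_cast hlt
      rw [ih hlt, max_eq_left ((min_le_right _ _).trans (by linarith)), mul_zero, add_zero]
    · rw [path_of_ge h0, min_eq_right (by linarith), max_eq_right (by linarith)]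

lemma path_natCast {m : ℕ} {h : ℕ → ℝ} {j : ℕ} (hj : j ≤ m) : path m h j = h j := by
  rcases hj.lt_or_eq with hj | rfl
  · rw [path_of_mem hj le_rfl (by linarith)]; ring
  · exact path_of_ge le_rfl

lemma path_congr {m : ℕ} {h h' : ℕ → ℝ} (H : ∀ j ≤ m, h j = h' j) (s : ℝ) :
    path m h s = path m h' s := by
  simp only [path]
  rw [H 0 (Nat.zero_le _)]
  congr 1
  refine Finset.sum_congr rfl fun j hj => ?_
  have := Finset.mem_range.1 hj
  rw [H j (by omega), H (j + 1) (by omega)]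

lemma dens_congr {m : ℕ} {h h' : ℕ → ℝ} (H : ∀ j ≤ m, h j = h' j) (s : ℝ) :
    dens m h s = dens m h' s := by
  simp only [dens]
  congr 3
  refine Finset.sum_congr rfl fun j hj => ?_
  have := Finset.mem_range.1 hj
  rw [H j (by omega), H (j + 1) (by omega)]

lemma dens_of_lt_zero {m : ℕ} {h : ℕ → ℝ} {s : ℝ} (hs : s < 0) : dens m h s = 1 := by
  have hm : (0 : ℝ) ≤ m := m.cast_nonneg
  simp only [dens]
  rw [if_pos hs, if_neg (by linarith), Finset.sum_eq_zero]
  · simp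
  · intro j _
    have : (0 : ℝ) ≤ j := j.cast_nonneg
    rw [if_neg (fun h => by linarith [h.1]), mul_zero]

lemma dens_of_gt {m : ℕ} {h : ℕ → ℝ} {s : ℝ} (hs : (m : ℝ) < s) : dens m h s = 1 := by
  have hm : (0 : ℝ) ≤ m := m.cast_nonneg
  simp only [dens]
  rw [if_neg (by linarith), if_pos hs, Finset.sum_eq_zero]
  · simp
  · intro j hj
    have : ((j : ℝ) + 1) ≤ m := by exact_mod_cast Finset.mem_range.1 hj
    rw [if_neg (fun h => by linarith [h.2]), mul_zero]

lemma dens_of_mem {m : ℕ} {h : ℕ → ℝ} {s : ℝ} {j : ℕ} (hj : j < m) (h0 : (j : ℝ) < s)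
    (h1 : s < j + 1) : dens m h s = Complex.I * ((h (j + 1) - h j : ℝ) : ℂ) := by
  have hj0 : (0 : ℝ) ≤ j := j.cast_nonneg
  have hjm : ((j : ℝ) + 1) ≤ m := by exact_mod_cast hj
  simp only [dens]
  rw [if_neg (by linarith), if_neg (by linarith),
    Finset.sum_eq_single_of_mem j (Finset.mem_range.2 hj), if_pos ⟨h0, h1⟩]
  · simp
  · intro i _ hi
    rw [if_neg, mul_zero]
    rintro ⟨a, b⟩
    have c1 : (i : ℝ) < j + 1 := by linarith
    have c2 : (j : ℝ) < i + 1 := by linarith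
    norm_cast at c1 c2
    omega

@[fun_prop]
lemma continuous_path (m : ℕ) (h : ℕ → ℝ) : Continuous (path m h) := by
  unfold path; fun_prop

@[fun_prop]
lemma continuous_rpart (m : ℕ) : Continuous (rpart m) := by
  unfold rpart; fun_prop

@[fun_prop]
lemma measurable_dens (m : ℕ) (h : ℕ → ℝ) : Measurable (dens m h) := by
  unfold dens
  have h1 : Measurable fun s : ℝ => (if s < 0 then (1 : ℝ) else 0) :=
    Measurable.ite measurableSet_Iio measurable_const measurable_const
  have h2 : Measurable fun s : ℝ => (if (m : ℝ) < s then (1 : ℝ) else 0) :=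
    Measurable.ite measurableSet_Ioi measurable_const measurable_const
  have h3 : ∀ j : ℕ, Measurable fun s : ℝ => (if (j : ℝ) < s ∧ s < j + 1 then (1 : ℝ) else 0) :=
    fun j => Measurable.ite measurableSet_Ioo measurable_const measurable_const
  fun_prop

lemma rpart_of_mem {m : ℕ} {s : ℝ} (h0 : 0 ≤ s) (h1 : s ≤ m) : rpart m s = 0 := by
  simp [rpart, h0, h1]

lemma rpart_of_le_zero {m : ℕ} {s : ℝ} (h0 : s ≤ 0) : rpart m s = s := by
  have hm : (0 : ℝ) ≤ m := m.cast_nonneg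
  rw [rpart, min_eq_left h0, max_eq_right (by linarith), add_zero]

lemma rpart_of_ge {m : ℕ} {s : ℝ} (h0 : (m : ℝ) ≤ s) : rpart m s = s - m := by
  have hm : (0 : ℝ) ≤ m := m.cast_nonneg
  rw [rpart, min_eq_right (by linarith), max_eq_left (by linarith), zero_add]

lemma rpart_mono (m : ℕ) : Monotone (rpart m) := fun a b hab => by
  unfold rpart; gcongr

lemma rpart_nonneg {m : ℕ} {s : ℝ} (h0 : 0 ≤ s) : 0 ≤ rpart m s := by
  rw [rpart, min_eq_right h0, zero_add]; exact le_max_right _ _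

lemma rpart_nonpos {m : ℕ} {s : ℝ} (h0 : s ≤ m) : rpart m s ≤ 0 := by
  rw [rpart, max_eq_right (by linarith), add_zero]; exact min_le_right _ _

/-- Away from the vertices, a parameter lies on a leg or in the interior of a segment. -/
lemma param_cases (m : ℕ) {s : ℝ} (hs : ∀ j : ℕ, s ≠ j) :
    s < 0 ∨ (m : ℝ) < s ∨ ∃ j < m, (j : ℝ) < s ∧ s < j + 1 := by
  rcases lt_or_ge s 0 with h | h
  · exact .inl h
  rcases lt_or_ge (m : ℝ) s with h' | h'
  · exact .inr (.inl h')
  refine .inr (.inr ⟨⌊s⌋₊, ?_, ?_, Nat.lt_floor_add_one s⟩)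
  · rw [Nat.floor_lt h]
    exact lt_of_le_of_ne h' (hs m)
  · exact lt_of_le_of_ne (Nat.floor_le h) (hs _).symm

/-- The contour with the height function `η`, as a curve of visits. -/
noncomputable def visit (m : ℕ) (η : ℝ → ℝ) (z : ℝ × ℝ) : Visit :=
  ⟨z.1, (rpart m z.1 : ℂ) + Complex.I * (η z.1 : ℝ), z.2⟩

/-- The visit of the insertion `j` at the vertex `e j` of the contour. -/
noncomputable def mark {k : ℕ} (e : Fin k → ℕ) (v : Fin k → ℝ × ℝ) (j : Fin k) : Visit :=
  ⟨(e j : ℕ), Complex.I * (v j).1, (v j).2⟩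

/-- The Boltzmann weight with external pair energies `A` and internal pair energies `P`. -/
noncomputable def pairWeight {k w : ℕ} (b : ℝ) (α : Fin k → ℂ) (A : Fin k → Fin w → ℂ)
    (P : Fin w → Fin w → ℂ) : ℂ :=
  Complex.exp (-4 * b * ∑ j, ∑ l, α j * A j l
    - 4 * (b : ℂ) ^ 2 * ∑ l, ∑ l' ∈ Finset.Ioi l, P l l')

/-- The weight of the visits `U` of the screening points in the presence of the visits `E`. -/
noncomputable def weight {k w : ℕ} (b : ℝ) (α : Fin k → ℂ) (E : Fin k → Visit)
    (U : Fin w → Visit) : ℂ :=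
  pairWeight b α (fun j l => orderedGreen (E j) (U l)) (fun l l' => orderedGreen (U l) (U l'))

/-- The integrand for screening points that move on contours with heights `η l` and speeds
`ρ l`. -/
noncomputable def pathIntegrand {k w : ℕ} (b : ℝ) (α : Fin k → ℂ) (v : Fin k → ℝ × ℝ)
    (e : Fin k → ℕ) (m : ℕ) (η : Fin w → ℝ → ℝ) (ρ : Fin w → ℝ → ℂ) (z : Fin w → ℝ × ℝ) : ℂ :=
  weight b α (mark e v) (fun l => visit m (η l) (z l)) * ∏ l, ρ l (z l).1

/-- The screening integral over the contour with vertices `h 0, …, h m`. -/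
noncomputable def pathIntegral {k : ℕ} (b : ℝ) (α : Fin k → ℂ) (v : Fin k → ℝ × ℝ)
    (w : ℕ) (e : Fin k → ℕ) (m : ℕ) (h : ℕ → ℝ) : ℂ :=
  ∫ z, pathIntegrand b α v e m (fun _ : Fin w => path m h) (fun _ => dens m h) z
    ∂screeningMeasure w

lemma pairWeight_congr {k w : ℕ} {b : ℝ} {α : Fin k → ℂ} {A A' : Fin k → Fin w → ℂ}
    {P P' : Fin w → Fin w → ℂ} (h1 : ∀ j l, A j l = A' j l)
    (h2 : ∀ l l', l < l' → P l l' = P' l l') :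
    pairWeight b α A P = pairWeight b α A' P' := by
  unfold pairWeight
  congr 3
  · simp only [h1]
  · exact Finset.sum_congr rfl fun l _ => Finset.sum_congr rfl fun l' hl' =>
      h2 l l' (Finset.mem_Ioi.1 hl')

lemma weight_congr {k w : ℕ} {b : ℝ} {α : Fin k → ℂ} {E E' : Fin k → Visit}
    {U U' : Fin w → Visit} (h1 : ∀ j l, orderedGreen (E j) (U l) = orderedGreen (E' j) (U' l))
    (h2 : ∀ l l', l < l' → orderedGreen (U l) (U l') = orderedGreen (U' l) (U' l')) :
    weight b α E U = weight b α E' U' := pairWeight_congr h1 h2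

lemma ae_screeningMeasure_of_ae {w : ℕ} {p : ℝ → Prop} (hp : ∀ᵐ s, p s) :
    ∀ᵐ z ∂screeningMeasure w, ∀ l, p (z l).1 := by
  rw [ae_all_iff]
  intro l
  have h1 : ∀ᵐ y ∂((volume : Measure ℝ).prod (volume.restrict (Set.Icc (-1 : ℝ) 1))), p y.1 :=
    Measure.quasiMeasurePreserving_fst.ae hp
  exact (Measure.quasiMeasurePreserving_eval
    (fun _ : Fin w => (volume : Measure ℝ).prod (volume.restrict (Set.Icc (-1 : ℝ) 1))) l).ae h1

lemma ae_ne_natCast : ∀ᵐ s : ℝ, ∀ j : ℕ, s ≠ j := by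
  rw [ae_all_iff]
  intro j
  exact Measure.ae_ne volume (j : ℝ)

lemma pathIntegrand_ae_congr {k w : ℕ} {b : ℝ} {α : Fin k → ℂ} {v : Fin k → ℝ × ℝ}
    {e : Fin k → ℕ} {m : ℕ} {η η' : Fin w → ℝ → ℝ} {ρ ρ' : Fin w → ℝ → ℂ}
    (h : ∀ l, ∀ᵐ s : ℝ, η l s = η' l s ∧ ρ l s = ρ' l s) :
    pathIntegrand b α v e m η ρ =ᵐ[screeningMeasure w] pathIntegrand b α v e m η' ρ' := by
  filter_upwards [ae_screeningMeasure_of_ae (w := w) (ae_all_iff.2 h)] with z hz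
  unfold pathIntegrand
  congr 1
  · congr 1
    funext l
    simp only [visit, (hz l l).1]
  · exact Finset.prod_congr rfl fun l _ => (hz l l).2

lemma pathIntegral_congr {k : ℕ} {b : ℝ} {α : Fin k → ℂ} {v : Fin k → ℝ × ℝ} {w : ℕ}
    {e e' : Fin k → ℕ} {m : ℕ} {h h' : ℕ → ℝ} (he : e = e') (H : ∀ j ≤ m, h j = h' j) :
    pathIntegral b α v w e m h = pathIntegral b α v w e' m h' := by
  subst he
  unfold pathIntegral
  rw [show path m h = path m h' from funext (path_congr H),
    show dens m h = dens m h' from funext (dens_congr H)]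

/-- The heights of the vertices of the contour of a list of insertions. -/
noncomputable def heights {n : ℕ} (v : Fin (n + 1) → ℝ × ℝ) (j : ℕ) : ℝ :=
  if h : j < n + 1 then (v ⟨j, h⟩).1 else 0

lemma contour_eq {n : ℕ} (v : Fin (n + 1) → ℝ × ℝ) (s : ℝ) :
    contour v s = (rpart n s : ℂ) + Complex.I * (path n (heights v) s : ℝ) := by
  unfold contour rpart path
  congr 4
  rw [Finset.sum_range]
  refine Finset.sum_congr rfl fun j _ => ?_
  have h1 : heights v j = (v j.castSucc).1 := by
    rw [heights, dif_pos (by omega)]; rfl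
  have h2 : heights v (j + 1) = (v j.succ).1 := by
    rw [heights, dif_pos (by omega)]; rfl
  rw [h1, h2]

lemma deriv_contour {n : ℕ} (v : Fin (n + 1) → ℝ × ℝ) {s : ℝ} (hs : ∀ j : ℕ, s ≠ j) :
    deriv (contour v) s = dens n (heights v) s := by
  have key : ∀ {t : Set ℝ} (_ : IsOpen t) (_ : s ∈ t) (a c : ℂ)
      (_ : ∀ y ∈ t, contour v y = a + y * c), deriv (contour v) s = c := by
    intro t ht hst a c hc
    have : contour v =ᶠ[nhds s] fun y => a + y * c := by
      filter_upwards [ht.mem_nhds hst] with y hy using hc y hy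
    rw [this.deriv_eq]
    have : HasDerivAt (fun y : ℝ => a + (y : ℂ) * c) (1 * c) s :=
      ((Complex.ofRealCLM.hasDerivAt (x := s)).mul_const c).const_add a
    rw [this.deriv, one_mul]
  rcases param_cases n hs with h | h | ⟨j, hj, h0, h1⟩
  · rw [dens_of_lt_zero h]
    refine key isOpen_Iio h (Complex.I * (heights v 0 : ℝ)) 1 fun y hy => ?_
    rw [contour_eq, rpart_of_le_zero (le_of_lt hy), path_of_le_zero (le_of_lt hy)]; ring
  · rw [dens_of_gt h]
    refine key isOpen_Ioi h (-n + Complex.I * (heights v n : ℝ)) 1 fun y hy => ?_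
    rw [contour_eq, rpart_of_ge (le_of_lt hy), path_of_ge (le_of_lt hy)]; push_cast; ring
  · rw [dens_of_mem hj h0 h1]
    refine key isOpen_Ioo ⟨h0, h1⟩ (Complex.I * (heights v j
      - (heights v (j + 1) - heights v j) * j : ℝ)) _ fun y hy => ?_
    have : ((j : ℝ) + 1) ≤ n := by exact_mod_cast hj
    have hj0 : (0 : ℝ) ≤ j := j.cast_nonneg
    rw [contour_eq, rpart_of_mem (by linarith [hy.1]) (by linarith [hy.2]),
      path_of_mem hj hy.1.le hy.2.le]; push_cast; ring

/-- Away from the vertices, a null set of parameters, `deriv` is the explicit speed `dens`. This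
puts the correlator into a form in which vertices and marks can be changed separately. -/
lemma screeningIntegrand_ae_eq {n : ℕ} (b : ℝ) (α : Fin (n + 1) → ℂ)
    (v : Fin (n + 1) → ℝ × ℝ) (w : ℕ) :
    screeningIntegrand b α v w =ᵐ[screeningMeasure w]
      pathIntegrand b α v (fun j => (j : ℕ)) n (fun _ : Fin w => path n (heights v))
        (fun _ => dens n (heights v)) := by
  filter_upwards [ae_screeningMeasure_of_ae (w := w) ae_ne_natCast] with z hz
  have h1 : (fun l => screeningVisit v (z l)) = fun l => visit n (path n (heights v)) (z l) := by
    funext l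
    simp only [screeningVisit, visit, contour_eq]
  have h2 : (externalVisit v) = mark (fun j => (j : ℕ)) v := rfl
  unfold pathIntegrand weight pairWeight
  rw [← h1, ← h2]
  unfold screeningIntegrand
  congr 1
  exact Finset.prod_congr rfl fun l _ => deriv_contour v (hz l)

/-! ### Size of the light-cone singularities -/

/-- The distance from `1` to the point of modulus `exp (-π |r|)` and argument `π y`. -/
noncomputable def gap (r y : ℝ) : ℝ :=
  ‖1 - Complex.exp (((-(Real.pi * |r|) : ℝ) : ℂ) + ((Real.pi * y : ℝ) : ℂ) * Complex.I)‖

/-- A power of `gap`, equal to `1` where the gap closes. -/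
noncomputable def gapPow (β r y : ℝ) : ℝ := Real.exp (β * Real.log (gap r y))

lemma gap_nonneg (r y : ℝ) : 0 ≤ gap r y := norm_nonneg _

lemma gapPow_pos (β r y : ℝ) : 0 < gapPow β r y := Real.exp_pos _

lemma norm_one_sub_exp_conj (a c : ℝ) :
    ‖1 - Complex.exp ((a : ℂ) + ((-c : ℝ) : ℂ) * Complex.I)‖
      = ‖1 - Complex.exp ((a : ℂ) + (c : ℂ) * Complex.I)‖ := by
  rw [← Complex.norm_conj]
  congr 1
  rw [map_sub, map_one, ← Complex.exp_conj]
  simp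

lemma gap_neg_right (r y : ℝ) : gap r (-y) = gap r y := by
  unfold gap
  rw [mul_neg, norm_one_sub_exp_conj]

lemma gap_neg_left (r y : ℝ) : gap (-r) y = gap r y := by
  unfold gap
  rw [abs_neg]

lemma norm_one_sub_exp {w : ℂ} (h : w.re ≤ 0) :
    ‖1 - Complex.exp w‖ = gap (w.re / Real.pi) (w.im / Real.pi) := by
  have hpi := Real.pi_pos
  unfold gap
  rw [abs_of_nonpos (div_nonpos_of_nonpos_of_nonneg h hpi.le), mul_neg, neg_neg,
    mul_div_cancel₀ _ hpi.ne', mul_div_cancel₀ _ hpi.ne', Complex.re_add_im]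

lemma gap_le_two (r y : ℝ) : gap r y ≤ 2 := by
  unfold gap
  refine (norm_sub_le _ _).trans ?_
  rw [norm_one, Complex.norm_exp]
  have : Real.exp (-(Real.pi * |r|)) ≤ 1 := Real.exp_le_one_iff.2 (by
    have := mul_nonneg Real.pi_pos.le (abs_nonneg r); linarith)
  simp only [Complex.add_re, Complex.ofReal_re, Complex.mul_re, Complex.I_re, mul_zero,
    Complex.ofReal_im, Complex.I_im, mul_one, sub_self, add_zero]
  linarith

lemma log_gap_le (r y : ℝ) : Real.log (gap r y) ≤ Real.log 2 := by
  rcases (gap_nonneg r y).eq_or_lt with h | h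
  · rw [← h, Real.log_zero]; exact Real.log_nonneg one_le_two
  · exact Real.log_le_log h (gap_le_two r y)

lemma exp_add_mul_I (a c : ℝ) : Complex.exp ((a : ℂ) + (c : ℂ) * Complex.I)
    = (Real.exp a : ℂ) * Complex.exp ((c : ℂ) * Complex.I) := by
  rw [Complex.exp_add, Complex.ofReal_exp]

/-- |1 - ρe^(iu)| is the distance from ρ to e^(-iu); this is the triangle inequality through ρ. It
prevents two gaps with distinct angles from being small at the same time. -/
lemma gap_zero_add_le (r y y' : ℝ) : gap 0 (y - y') ≤ gap r y + gap r y' := by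
  unfold gap
  set ρ : ℂ := (Real.exp (-(Real.pi * |r|)) : ℂ)
  rw [exp_add_mul_I, exp_add_mul_I, exp_add_mul_I]
  simp only [abs_zero, mul_zero, neg_zero, Real.exp_zero, Complex.ofReal_one, one_mul]
  have e1 : ∀ u : ℝ, ‖Complex.exp ((Real.pi * u : ℝ) * Complex.I)‖ = 1 := fun u =>
    Complex.norm_exp_ofReal_mul_I _
  have h1 : ∀ u : ℝ, ‖1 - ρ * Complex.exp ((Real.pi * u : ℝ) * Complex.I)‖
      = ‖Complex.exp ((Real.pi * (-u) : ℝ) * Complex.I) - ρ‖ := by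
    intro u
    rw [← one_mul ‖1 - _‖, ← e1 (-u), ← norm_mul, mul_sub, mul_one, mul_left_comm,
      ← Complex.exp_add]
    congr 2
    rw [show ((Real.pi * -u : ℝ) : ℂ) * Complex.I + (Real.pi * u : ℝ) * Complex.I = 0 by
      push_cast; ring, Complex.exp_zero, mul_one]
  have h2 : ‖1 - Complex.exp ((Real.pi * (y - y') : ℝ) * Complex.I)‖
      = ‖Complex.exp ((Real.pi * (-y) : ℝ) * Complex.I)
        - Complex.exp ((Real.pi * (-y') : ℝ) * Complex.I)‖ := by
    rw [← one_mul ‖1 - _‖, ← e1 (-y), ← norm_mul, mul_sub, mul_one, ← Complex.exp_add]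
    congr 3
    push_cast; ring_nf
  rw [h1, h1, h2]
  exact (norm_sub_le_norm_sub_add_norm_sub _ ρ _).trans (by rw [norm_sub_rev ρ (Complex.exp _)])

/-- With ρ = exp(-π|r|) and E on the unit circle, |1 - E| is at most |1 - ρE| + (1 - ρ), and 1 - ρ
is at most |1 - ρE|. -/
lemma gap_zero_le (r y : ℝ) : gap 0 y ≤ 2 * gap r y := by
  unfold gap
  set ρ : ℝ := Real.exp (-(Real.pi * |r|)) with hρ
  have h1 : ρ ≤ 1 := Real.exp_le_one_iff.2 (by
    have := mul_nonneg Real.pi_pos.le (abs_nonneg r); linarith)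
  have h0 : 0 < ρ := Real.exp_pos _
  rw [exp_add_mul_I, exp_add_mul_I]
  simp only [abs_zero, mul_zero, neg_zero, Real.exp_zero, Complex.ofReal_one, one_mul]
  rw [← hρ]
  set E := Complex.exp ((Real.pi * y : ℝ) * Complex.I) with hE
  have e1 : ‖E‖ = 1 := Complex.norm_exp_ofReal_mul_I _
  have h2 : ‖(ρ : ℂ) * E‖ = ρ := by rw [norm_mul, e1, mul_one, Complex.norm_of_nonneg h0.le]
  have h3 : 1 - ρ ≤ ‖1 - (ρ : ℂ) * E‖ := by
    have := norm_sub_norm_le (1 : ℂ) ((ρ : ℂ) * E)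
    rwa [norm_one, h2] at this
  have h4 : ‖1 - E‖ ≤ ‖1 - (ρ : ℂ) * E‖ + ‖((ρ - 1 : ℝ) : ℂ) * E‖ := by
    refine le_trans (le_of_eq ?_) (norm_add_le _ _)
    congr 1; push_cast; ring
  rw [norm_mul, e1, mul_one, Complex.norm_real, Real.norm_of_nonpos (by linarith)] at h4
  linarith

lemma abs_div_le_gap (r y : ℝ) : |r| / (1 + |r|) ≤ gap r y := by
  have hr := abs_nonneg r
  have hpi := Real.pi_gt_three
  have h3 : 1 - Real.exp (-(Real.pi * |r|)) ≤ gap r y := by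
    unfold gap
    have := norm_sub_norm_le (1 : ℂ)
      (Complex.exp (((-(Real.pi * |r|) : ℝ) : ℂ) + ((Real.pi * y : ℝ) : ℂ) * Complex.I))
    rw [norm_one, Complex.norm_exp] at this
    simpa using this
  refine le_trans ?_ h3
  have h5 : |r| + 1 ≤ Real.exp (Real.pi * |r|) :=
    le_trans (by nlinarith) (Real.add_one_le_exp (Real.pi * |r|))
  rw [Real.exp_neg, show |r| / (1 + |r|) = 1 - (1 + |r|)⁻¹ by field_simp; ring]
  have : (Real.exp (Real.pi * |r|))⁻¹ ≤ (1 + |r|)⁻¹ := inv_anti₀ (by linarith) (by linarith)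
  linarith

lemma gap_zero_eq (y : ℝ) : gap 0 y = 2 * |Real.sin (Real.pi * y / 2)| := by
  unfold gap
  have h : (1 : ℂ) - Complex.exp ((Real.pi * y : ℝ) * Complex.I)
      = Complex.exp ((Real.pi * y / 2 : ℝ) * Complex.I) *
        (-(2 * Real.sin (Real.pi * y / 2) : ℝ) * Complex.I) := by
    have hs : ((Real.sin (Real.pi * y / 2) : ℝ) : ℂ) =
      (Complex.exp (-((Real.pi * y / 2 : ℝ) * Complex.I)) -
        Complex.exp ((Real.pi * y / 2 : ℝ) * Complex.I)) * Complex.I / 2 := by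
      rw [Complex.ofReal_sin, Complex.sin, neg_mul]
    have h1 : Complex.exp ((Real.pi * y / 2 : ℝ) * Complex.I) *
        Complex.exp (-((Real.pi * y / 2 : ℝ) * Complex.I)) = 1 := by
      rw [← Complex.exp_add, add_neg_cancel, Complex.exp_zero]
    have h2 : Complex.exp ((Real.pi * y : ℝ) * Complex.I) =
        Complex.exp ((Real.pi * y / 2 : ℝ) * Complex.I) *
        Complex.exp ((Real.pi * y / 2 : ℝ) * Complex.I) := by
      rw [← Complex.exp_add]; congr 1; push_cast; ring
    rw [Complex.ofReal_mul 2, hs, h2]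
    push_cast at h1 ⊢
    ring_nf at h1 ⊢
    rw [Complex.I_sq]
    linear_combination (-1 : ℂ) * h1
  simp only [abs_zero, mul_zero, neg_zero, Complex.ofReal_zero, zero_add]
  rw [h, norm_mul, Complex.norm_exp_ofReal_mul_I, one_mul, norm_mul, Complex.norm_I, mul_one,
    norm_neg, Complex.norm_real, Real.norm_eq_abs, abs_mul, abs_two]

lemma gap_zero_pos_iff {y : ℝ} : 0 < gap 0 y ↔ ∀ m : ℤ, y ≠ 2 * m := by
  rw [gap_zero_eq]
  have hpi := Real.pi_pos
  constructor
  · rintro h m rfl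
    rw [show Real.pi * (2 * (m : ℝ)) / 2 = m * Real.pi by ring, Real.sin_int_mul_pi] at h
    simp at h
  · intro h
    have : Real.sin (Real.pi * y / 2) ≠ 0 := by
      intro h0
      obtain ⟨n, hn⟩ := Real.sin_eq_zero_iff.1 h0
      apply h n
      field_simp at hn
      linarith
    positivity

lemma gapPow_le_of_le {β δ r y : ℝ} (hβ : β ≤ 0) (hδ : 0 < δ) (h : δ ≤ gap r y) :
    gapPow β r y ≤ Real.exp (β * Real.log δ) := by
  unfold gapPow
  exact Real.exp_le_exp.2 (mul_le_mul_of_nonpos_left (Real.log_le_log hδ h) hβ)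

lemma gapPow_le_zero {β r y : ℝ} (hβ : β ≤ 0) (h : 0 < gap 0 y) :
    gapPow β r y ≤ Real.exp (-(β * Real.log 2)) * gapPow β 0 y := by
  refine (gapPow_le_of_le hβ (half_pos h) (by linarith [gap_zero_le r y])).trans (le_of_eq ?_)
  unfold gapPow
  rw [← Real.exp_add, Real.log_div h.ne' two_ne_zero]
  ring_nf

/-- This bound depends on r only and `gapPow_le_zero` gives one that depends on the angle only. The
factor 1 + |r|, which absorbs (1 + |r|)^(-β), is harmless against exponential decay. -/
lemma gapPow_le_rpow {β r y : ℝ} (hβ : β ≤ 0) (hβ' : -1 ≤ β) (hr : r ≠ 0) :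
    gapPow β r y ≤ |r| ^ β * (1 + |r|) := by
  have h0 := abs_pos.2 hr
  refine (gapPow_le_of_le hβ (by positivity) (abs_div_le_gap r y)).trans ?_
  rw [Real.log_div h0.ne' (by positivity), mul_sub, Real.exp_sub, mul_comm β, mul_comm β,
    ← Real.rpow_def_of_pos h0, ← Real.rpow_def_of_pos (by positivity), div_eq_mul_inv,
    ← Real.rpow_neg (by positivity)]
  gcongr
  calc (1 + |r|) ^ (-β) ≤ (1 + |r|) ^ (1 : ℝ) :=
        Real.rpow_le_rpow_of_exponent_le (by linarith) (by linarith)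
    _ = 1 + |r| := Real.rpow_one _

/-- If the singular points are distinct, at most one factor is large. -/
lemma prod_gapPow_le {k : ℕ} {β : Fin k → ℝ} (hβ : ∀ j, β j ≤ 0) {y : Fin k → ℝ}
    (hy : ∀ i j, i ≠ j → ∀ m : ℤ, y i - y j ≠ 2 * m) :
    ∃ C, 0 ≤ C ∧ ∀ r x, ∏ j, gapPow (β j) r (y j + x)
      ≤ C * (1 + ∑ j, gapPow (β j) r (y j + x)) := by
  -- 2δ is below every distance between the finitely many singular points on the circle, so by
  -- `gap_zero_add_le` at most one gap is smaller than δ.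
  obtain ⟨δ, hδ0, hδ1, hδ⟩ : ∃ δ : ℝ, 0 < δ ∧ δ ≤ 1 ∧
      ∀ i j, i ≠ j → 2 * δ ≤ gap 0 (y i - y j) := by
    rcases (Finset.univ.filter fun q : Fin k × Fin k => q.1 ≠ q.2).eq_empty_or_nonempty
      with he | hne
    · refine ⟨1, one_pos, le_rfl, fun i j hij => ?_⟩
      have : (i, j) ∈ Finset.univ.filter fun q : Fin k × Fin k => q.1 ≠ q.2 := by simp [hij]
      rw [he] at this
      simp at this
    · obtain ⟨q, hq, hmin⟩ := Finset.exists_min_image _ (fun q => gap 0 (y q.1 - y q.2)) hne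
      have hq0 : 0 < gap 0 (y q.1 - y q.2) :=
        gap_zero_pos_iff.2 (hy _ _ (Finset.mem_filter.1 hq).2)
      refine ⟨gap 0 (y q.1 - y q.2) / 2, half_pos hq0, ?_, fun i j hij => ?_⟩
      · linarith [gap_le_two 0 (y q.1 - y q.2)]
      · have := hmin (i, j) (by simp [hij])
        linarith
  -- M j bounds the j-th factor once its gap is at least δ, and M j ≥ 1 because β j ≤ 0 and δ ≤ 1.
  -- The constant ∏ M j therefore also bounds products over fewer factors.
  set M : Fin k → ℝ := fun j => Real.exp (β j * Real.log δ)
  have hM : ∀ j, 1 ≤ M j := fun j => Real.one_le_exp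
    (mul_nonneg_of_nonpos_of_nonpos (hβ j) (Real.log_nonpos hδ0.le hδ1))
  have hMp : ∀ s : Finset (Fin k), 1 ≤ ∏ j ∈ s, M j := fun s =>
    Finset.prod_induction M (1 ≤ ·) (fun _ _ => one_le_mul_of_one_le_of_one_le) le_rfl
      fun j _ => hM j
  refine ⟨∏ j, M j, (zero_le_one.trans (hMp _)), fun r x => ?_⟩
  have hS : 0 ≤ ∑ j, gapPow (β j) r (y j + x) :=
    Finset.sum_nonneg fun j _ => (gapPow_pos _ _ _).le
  by_cases h : ∃ j, gap r (y j + x) < δ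
  · obtain ⟨j, hj⟩ := h
    have h1 : ∀ i ∈ Finset.univ.erase j, gapPow (β i) r (y i + x) ≤ M i := by
      intro i hi
      have hij := Finset.ne_of_mem_erase hi
      refine gapPow_le_of_le (hβ i) hδ0 ?_
      have := gap_zero_add_le r (y i + x) (y j + x)
      rw [add_sub_add_right_eq_sub] at this
      linarith [hδ i j hij]
    rw [← Finset.mul_prod_erase _ _ (Finset.mem_univ j)]
    have h2 : ∏ i ∈ Finset.univ.erase j, gapPow (β i) r (y i + x)
        ≤ ∏ i, M i := by
      refine (Finset.prod_le_prod (fun i _ => (gapPow_pos _ _ _).le) h1).trans ?_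
      rw [← Finset.mul_prod_erase _ M (Finset.mem_univ j)]
      exact le_mul_of_one_le_left (zero_le_one.trans (hMp _)) (hM j)
    rw [mul_comm (∏ j, M j)]
    have h3 : gapPow (β j) r (y j + x) ≤ 1 + ∑ j, gapPow (β j) r (y j + x) := by
      have := Finset.single_le_sum (f := fun j => gapPow (β j) r (y j + x))
        (fun j _ => (gapPow_pos _ _ _).le) (Finset.mem_univ j)
      linarith
    exact mul_le_mul h3 h2 (Finset.prod_nonneg fun i _ => (gapPow_pos _ _ _).le)
      (by linarith)
  · push Not at h
    have h1 : ∏ j, gapPow (β j) r (y j + x) ≤ ∏ j, M j :=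
      Finset.prod_le_prod (fun i _ => (gapPow_pos _ _ _).le)
        fun i _ => gapPow_le_of_le (hβ i) hδ0 (h i)
    exact h1.trans (le_mul_of_one_le_right (zero_le_one.trans (hMp _)) (by linarith))

lemma measurable_gap : Measurable fun p : ℝ × ℝ => gap p.1 p.2 := by
  have h1 : Continuous fun p : ℝ × ℝ => -(Real.pi * |p.1|) :=
    (continuous_const.mul continuous_fst.abs).neg
  have h2 : Continuous fun p : ℝ × ℝ => Real.pi * p.2 := continuous_const.mul continuous_snd
  exact (continuous_const.sub (Complex.continuous_exp.comp ((Complex.continuous_ofReal.comp h1).add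
    ((Complex.continuous_ofReal.comp h2).mul continuous_const)))).norm.measurable

lemma measurable_gapPow {X : Type*} [MeasurableSpace X] {f g : X → ℝ} (β : ℝ)
    (hf : Measurable f) (hg : Measurable g) : Measurable fun x => gapPow β (f x) (g x) := by
  unfold gapPow
  have h := measurable_gap.comp (hf.prodMk hg)
  have : Measurable fun x => gap (f x) (g x) := by simpa only [Function.comp_def] using h
  exact Real.measurable_exp.comp ((Real.measurable_log.comp this).const_mul β)

/-- By periodicity and evenness it suffices to look at (0, 1], where Jordan's inequality for
2|sin(πy/2)| gives a gap of at least y, and y^β is integrable for β > -1. -/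
lemma intervalIntegrable_gapPow {β : ℝ} (hβ : β ≤ 0) (hβ' : -1 < β) (a c : ℝ) :
    IntervalIntegrable (gapPow β 0) volume a c := by
  have hper : Function.Periodic (gapPow β 0) 2 := by
    intro y
    have : gap 0 (y + 2) = gap 0 y := by
      rw [gap_zero_eq, gap_zero_eq, show Real.pi * (y + 2) / 2 = Real.pi * y / 2 + Real.pi by ring,
        Real.sin_add_pi, abs_neg]
    simp only [gapPow, this]
  refine hper.intervalIntegrable (t := -1) two_pos.ne' ?_ a c
  have hm : Measurable (gapPow β 0) := measurable_gapPow β measurable_const measurable_id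
  have key : IntervalIntegrable (gapPow β 0) volume 0 1 := by
    have h := intervalIntegral.intervalIntegrable_rpow' (a := 0) (b := 1) hβ'
    refine h.mono_fun' hm.aestronglyMeasurable ?_
    rw [Filter.EventuallyLE, ae_restrict_iff' measurableSet_uIoc]
    refine Filter.Eventually.of_forall fun y hy => ?_
    rw [Set.uIoc_of_le zero_le_one] at hy
    rw [Real.norm_of_nonneg (gapPow_pos _ _ _).le, Real.rpow_def_of_pos hy.1, mul_comm]
    refine gapPow_le_of_le hβ hy.1 ?_
    rw [gap_zero_eq]
    have hpi := Real.pi_pos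
    have := Real.mul_le_sin (x := Real.pi * y / 2) (by nlinarith [hy.1]) (by nlinarith [hy.2])
    have h2 : 2 / Real.pi * (Real.pi * y / 2) = y := by field_simp
    rw [h2] at this
    have h3 := le_abs_self (Real.sin (Real.pi * y / 2))
    linarith [hy.1]
  have key2 : IntervalIntegrable (gapPow β 0) volume (-1) 0 := by
    have := (IntervalIntegrable.iff_comp_neg (by simp)).1 key
    simp only [neg_zero] at this
    refine (this.symm).congr ?_
    exact fun y _ => by simp [gapPow, gap_neg_right]
  norm_num
  exact key2.trans key

/-! ### Integrability along horizontal legs and vertical segments -/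

/-- Lebesgue measure on `ℝ × [-1,1]`. -/
noncomputable abbrev strip : Measure (ℝ × ℝ) :=
  (volume : Measure ℝ).prod (volume.restrict (Set.Icc (-1) 1))

lemma integrable_of_abs {f : ℝ → ℝ} (h : IntegrableOn (fun s => f |s|) (Set.Ioi 0)) :
    Integrable fun s => f |s| := by
  rw [← integrableOn_univ, ← Set.Iio_union_Ici (a := (0 : ℝ)), integrableOn_union,
    integrableOn_Ici_iff_integrableOn_Ioi]
  refine ⟨?_, h⟩
  rw [← (Measure.measurePreserving_neg (volume : Measure ℝ)).integrableOn_comp_preimage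
    (Homeomorph.neg ℝ).measurableEmbedding]
  simpa [Function.comp_def] using h

lemma integrable_exp_neg_abs_mul_rpow {κ s : ℝ} (hκ : 0 < κ) (hs : -1 < s) :
    Integrable fun r : ℝ => Real.exp (-(κ * |r|)) * |r| ^ s := by
  apply integrable_of_abs (f := fun r => Real.exp (-(κ * r)) * r ^ s)
  refine (integrableOn_rpow_mul_exp_neg_mul_rpow hs one_pos hκ).congr_fun (fun r hr => ?_)
    measurableSet_Ioi
  have hr' : (0 : ℝ) < r := hr
  simp only [abs_of_pos hr', Real.rpow_one]
  ring_nf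

lemma integrable_exp_neg_abs {κ : ℝ} (hκ : 0 < κ) :
    Integrable fun r : ℝ => Real.exp (-(κ * |r|)) := by
  simpa using integrable_exp_neg_abs_mul_rpow hκ (s := 0) (by norm_num)

lemma integrable_exp_neg_abs_mul_rpow_mul {κ s : ℝ} (hκ : 0 < κ) (hs : -1 < s) :
    Integrable fun r : ℝ => Real.exp (-(κ * |r|)) * (|r| ^ s * (1 + |r|)) := by
  refine ((integrable_exp_neg_abs_mul_rpow hκ hs).add
    (integrable_exp_neg_abs_mul_rpow (s := s + 1) hκ (by linarith))).congr ?_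
  filter_upwards [Measure.ae_ne volume (0 : ℝ)] with r hr
  rw [Pi.add_apply, Real.rpow_add_one (abs_ne_zero.2 hr)]
  ring

/-- The singular factor of a screening point at real part `r`, height `η` and position `x`. -/
noncomputable def singular {k : ℕ} (β : Fin k → ℝ) (v : Fin k → ℝ × ℝ) (r η x : ℝ) : ℝ :=
  (∏ j, gapPow (β j) r ((v j).2 - (v j).1 + (η - x))) *
    ∏ j, gapPow (β j) r ((v j).2 + (v j).1 + (-η - x))

lemma singular_pos {k : ℕ} (β : Fin k → ℝ) (v : Fin k → ℝ × ℝ) (r η x : ℝ) :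
    0 < singular β v r η x :=
  mul_pos (Finset.prod_pos fun _ _ => gapPow_pos _ _ _) (Finset.prod_pos fun _ _ => gapPow_pos _ _ _)

lemma measurable_singular {k : ℕ} (β : Fin k → ℝ) (v : Fin k → ℝ × ℝ) {X : Type*}
    [MeasurableSpace X] {f g h : X → ℝ} (hf : Measurable f) (hg : Measurable g)
    (hh : Measurable h) : Measurable fun x => singular β v (f x) (g x) (h x) := by
  unfold singular
  refine Measurable.mul ?_ ?_
  · exact Finset.measurable_fun_prod _ fun j _ => measurable_gapPow _ hf (by fun_prop)
  · exact Finset.measurable_fun_prod _ fun j _ => measurable_gapPow _ hf (by fun_prop)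

lemma NonLightCone.ne_of_ne {k : ℕ} {v : Fin k → ℝ × ℝ} (hv : NonLightCone v) {i j : Fin k}
    (hij : i ≠ j) (m : ℤ) :
    ((v i).2 - (v i).1) - ((v j).2 - (v j).1) ≠ 2 * (m : ℝ) ∧
    ((v i).2 + (v i).1) - ((v j).2 + (v j).1) ≠ 2 * (m : ℝ) := by
  rcases lt_or_gt_of_ne hij with h | h
  · obtain ⟨-, h2⟩ := hv i j h (-m)
    obtain ⟨h1, -⟩ := hv i j h m
    push_cast at h2
    exact ⟨fun h => h2 (by linarith), fun h => h1 (by linarith)⟩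
  · obtain ⟨h1, -⟩ := hv j i h (-m)
    obtain ⟨-, h2⟩ := hv j i h m
    push_cast at h1
    exact ⟨fun h => h2 (by linarith), fun h => h1 (by linarith)⟩

lemma sq_one_add_sum_le {k : ℕ} (a : Fin k → ℝ) :
    (1 + ∑ j, a j) ^ 2 ≤ (k + 1) * (1 + ∑ j, a j ^ 2) := by
  have := sq_sum_le_card_mul_sum_sq (s := (Finset.univ : Finset (Option (Fin k))))
    (f := fun o => o.elim 1 a)
  simpa [Fintype.sum_option] using this

lemma ae_gap_zero_pos (y : ℝ) : ∀ᵐ x : ℝ, 0 < gap 0 (y - x) := by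
  simp_rw [gap_zero_pos_iff, ae_all_iff]
  intro m
  filter_upwards [Measure.ae_ne volume (y - 2 * m)] with x hx h
  exact hx (by linarith)

/-- The singular point is isolated in two dimensions, so the exponent 2β is allowed to drop below
-1. One copy of the factor is bounded in terms of r and the other in terms of the angle, which
leaves a product of one-variable integrable functions. -/
lemma integrable_gapPow_sq {κ β : ℝ} (hκ : 0 < κ) (hβ : β ≤ 0) (hβ' : -1 < β) (y : ℝ) :
    Integrable (fun z : ℝ × ℝ => Real.exp (-(κ * |z.1|)) * gapPow β z.1 (y - z.2) ^ 2) strip := by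
  have h1 := integrable_exp_neg_abs_mul_rpow_mul hκ hβ'
  have h2 : Integrable (fun x => Real.exp (-(β * Real.log 2)) * gapPow β 0 (y - x))
      (volume.restrict (Set.Icc (-1) 1)) := by
    refine Integrable.const_mul ?_ _
    have := (intervalIntegrable_gapPow hβ hβ' (y - (-1)) (y - 1)).comp_sub_left y
    rw [sub_sub_cancel, sub_sub_cancel] at this
    rw [← IntegrableOn, integrableOn_Icc_iff_integrableOn_Ioc]
    exact (intervalIntegrable_iff_integrableOn_Ioc_of_le (by norm_num)).1 this
  refine (h1.mul_prod h2).mono' ?_ ?_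
  · refine Measurable.aestronglyMeasurable ?_
    exact (by fun_prop : Measurable fun z : ℝ × ℝ => Real.exp (-(κ * |z.1|))).mul
      ((measurable_gapPow β measurable_fst (by fun_prop)).pow_const 2)
  · have a1 : ∀ᵐ z ∂strip, z.1 ≠ 0 :=
      Measure.quasiMeasurePreserving_fst.ae (Measure.ae_ne volume (0 : ℝ))
    have a2 : ∀ᵐ z ∂strip, 0 < gap 0 (y - z.2) :=
      Measure.quasiMeasurePreserving_snd.ae (ae_restrict_of_ae (ae_gap_zero_pos y))
    filter_upwards [a1, a2] with z hz1 hz2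
    rw [Real.norm_of_nonneg (by positivity), mul_assoc, sq]
    gcongr ?_ * ?_
    have hp := gapPow_pos β z.1 (y - z.2)
    exact mul_le_mul (gapPow_le_rpow hβ hβ'.le hz1) (gapPow_le_zero hβ hz2) hp.le (by positivity)

/-- Integrability of the singular factor along a horizontal leg. -/
lemma integrable_singular_leg {k : ℕ} {β : Fin k → ℝ} (hβ : ∀ j, β j ≤ 0) (hβ' : ∀ j, -1 < β j)
    {v : Fin k → ℝ × ℝ} (hv : NonLightCone v) {κ : ℝ} (hκ : 0 < κ) (η : ℝ) :
    Integrable (fun z : ℝ × ℝ => Real.exp (-(κ * |z.1|)) * singular β v z.1 η z.2) strip := by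
  obtain ⟨C, hC0, hC⟩ := prod_gapPow_le hβ (y := fun j => (v j).2 - (v j).1)
    fun i j hij m => (hv.ne_of_ne hij m).1
  obtain ⟨C', hC0', hC'⟩ := prod_gapPow_le hβ (y := fun j => (v j).2 + (v j).1)
    fun i j hij m => (hv.ne_of_ne hij m).2
  set y : Fin k → ℝ := fun j => (v j).2 - (v j).1 + η with hy
  set y' : Fin k → ℝ := fun j => (v j).2 + (v j).1 - η with hy'
  have I0 : Integrable (fun z : ℝ × ℝ => Real.exp (-(κ * |z.1|)) * (1 : ℝ)) strip :=
    (integrable_exp_neg_abs hκ).mul_prod (integrable_const 1)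
  have I1 : Integrable (fun z : ℝ × ℝ => (C * C') * ((k + 1 : ℝ) * (
      Real.exp (-(κ * |z.1|)) * 1 + ∑ j, Real.exp (-(κ * |z.1|)) * gapPow (β j) z.1 (y j - z.2) ^ 2)
      + (k + 1 : ℝ) * (Real.exp (-(κ * |z.1|)) * 1
        + ∑ j, Real.exp (-(κ * |z.1|)) * gapPow (β j) z.1 (y' j - z.2) ^ 2))) strip := by
    refine Integrable.const_mul (Integrable.add (Integrable.const_mul (I0.add ?_) _)
      (Integrable.const_mul (I0.add ?_) _)) _
    · exact integrable_finsetSum _ fun j _ => integrable_gapPow_sq hκ (hβ j) (hβ' j) _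
    · exact integrable_finsetSum _ fun j _ => integrable_gapPow_sq hκ (hβ j) (hβ' j) _
  refine I1.mono' ?_ (Filter.Eventually.of_forall fun z => ?_)
  · refine Measurable.aestronglyMeasurable ?_
    exact (by fun_prop : Measurable fun z : ℝ × ℝ => Real.exp (-(κ * |z.1|))).mul
      (measurable_singular β v measurable_fst measurable_const measurable_snd)
  · rw [Real.norm_of_nonneg (mul_pos (Real.exp_pos _) (singular_pos _ _ _ _ _)).le]
    have e1 := hC z.1 (η - z.2)
    have e2 := hC' z.1 (-η - z.2)
    have f1 : ∀ j, (v j).2 - (v j).1 + (η - z.2) = y j - z.2 := fun j => by simp only [hy]; ring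
    have f2 : ∀ j, (v j).2 + (v j).1 + (-η - z.2) = y' j - z.2 := fun j => by simp only [hy']; ring
    simp only [f1, f2] at e1 e2
    have q1 := sq_one_add_sum_le fun j => gapPow (β j) z.1 (y j - z.2)
    have q2 := sq_one_add_sum_le fun j => gapPow (β j) z.1 (y' j - z.2)
    have p1 : 0 ≤ ∑ j, gapPow (β j) z.1 (y j - z.2) :=
      Finset.sum_nonneg fun j _ => (gapPow_pos _ _ _).le
    have p2 : 0 ≤ ∑ j, gapPow (β j) z.1 (y' j - z.2) :=
      Finset.sum_nonneg fun j _ => (gapPow_pos _ _ _).le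
    -- The products in the two light-cone coordinates can be singular at the same point, so 2ab ≤ a²
    -- + b² and then Cauchy–Schwarz reduce to squares of single factors.
    have hS : singular β v z.1 η z.2 ≤ (C * C') * ((k + 1 : ℝ) *
        (1 + ∑ j, gapPow (β j) z.1 (y j - z.2) ^ 2)
        + (k + 1 : ℝ) * (1 + ∑ j, gapPow (β j) z.1 (y' j - z.2) ^ 2)) := by
      unfold singular
      simp only [f1, f2]
      refine (mul_le_mul e1 e2 (Finset.prod_nonneg fun _ _ => (gapPow_pos _ _ _).le)
        (by positivity)).trans ?_
      rw [mul_mul_mul_comm]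
      refine mul_le_mul_of_nonneg_left ?_ (by positivity)
      nlinarith [sq_nonneg ((1 + ∑ j, gapPow (β j) z.1 (y j - z.2))
        - (1 + ∑ j, gapPow (β j) z.1 (y' j - z.2)))]
    refine (mul_le_mul_of_nonneg_left hS (Real.exp_pos _).le).trans (le_of_eq ?_)
    simp only [← Finset.mul_sum]
    ring

lemma intervalIntegrable_prod_gapPow {k : ℕ} {β : Fin k → ℝ} (hβ : ∀ j, β j ≤ 0)
    (hβ' : ∀ j, -1 < β j) {y : Fin k → ℝ} (hy : ∀ i j, i ≠ j → ∀ m : ℤ, y i - y j ≠ 2 * m)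
    (a c : ℝ) : IntervalIntegrable (fun u => ∏ j, gapPow (β j) 0 (y j + u)) volume a c := by
  obtain ⟨C, hC0, hC⟩ := prod_gapPow_le hβ hy
  have I : IntervalIntegrable (fun u => C * (1 + ∑ j, gapPow (β j) 0 (y j + u))) volume a c := by
    refine IntervalIntegrable.const_mul (IntervalIntegrable.add intervalIntegrable_const ?_) _
    have : IntervalIntegrable (∑ j, fun u => gapPow (β j) 0 (y j + u)) volume a c := by
      refine IntervalIntegrable.sum _ fun j _ => ?_
      have := (intervalIntegrable_gapPow (hβ j) (hβ' j) (y j + a) (y j + c)).comp_add_left (y j)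
      rwa [add_sub_cancel_left, add_sub_cancel_left] at this
    refine this.congr fun u _ => by simp
  refine I.mono_fun' ?_ ?_
  · exact (Finset.measurable_fun_prod _ fun j _ => measurable_gapPow _ measurable_const
      (by fun_prop)).aestronglyMeasurable
  · refine Filter.Eventually.of_forall fun u => ?_
    simp only
    rw [Real.norm_of_nonneg (Finset.prod_nonneg fun _ _ => (gapPow_pos _ _ _).le)]
    exact hC 0 u

/-- For q ≠ 0 the light-cone coordinates are linear coordinates on the plane, and in them the
function is a product of functions of one variable each. -/
lemma integrable_comp_lightCone {f g : ℝ → ℝ} (hf : Integrable f) (hg : Integrable g) {q : ℝ}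
    (hq : q ≠ 0) (p : ℝ) :
    Integrable fun z : ℝ × ℝ => f (p + q * z.1 - z.2) * g (-(p + q * z.1) - z.2) := by
  have h1 : Integrable (fun z : ℝ × ℝ => f (p + z.1) * g (-p + z.2)) :=
    Integrable.mul_prod (f := fun u => f (p + u)) (g := fun u => g (-p + u))
      (hf.comp_add_left p) (hg.comp_add_left (-p))
  let e : (ℝ × ℝ) ≃ₗ[ℝ] (ℝ × ℝ) :=
    { toFun := fun z => (q * z.1 - z.2, -(q * z.1) - z.2)
      map_add' := fun a b => by ext <;> simp <;> ring
      map_smul' := fun a b => by ext <;> simp <;> ring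
      invFun := fun z => ((z.1 - z.2) / (2 * q), -(z.1 + z.2) / 2)
      left_inv := fun z => by ext <;> simp <;> field_simp <;> ring
      right_inv := fun z => by ext <;> simp <;> field_simp <;> ring }
  have hdet : LinearMap.det (e : (ℝ × ℝ) →ₗ[ℝ] ℝ × ℝ) ≠ 0 := (LinearEquiv.isUnit_det' e).ne_zero
  have hm := Measure.map_linearMap_addHaar_eq_smul_addHaar (volume : Measure (ℝ × ℝ)) hdet
  have h2 : Integrable (fun z : ℝ × ℝ => f (p + z.1) * g (-p + z.2))
      (Measure.map (e : (ℝ × ℝ) →ₗ[ℝ] ℝ × ℝ) volume) := by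
    rw [hm]
    exact h1.smul_measure ENNReal.ofReal_ne_top
  have hc : Continuous (e : (ℝ × ℝ) →ₗ[ℝ] ℝ × ℝ) := LinearMap.continuous_of_finiteDimensional _
  have h3 := h2.comp_measurable hc.measurable
  refine h3.congr (Filter.Eventually.of_forall fun z => ?_)
  simp [e]
  ring_nf

/-- Integrability of the singular factor along a vertical segment. -/
lemma integrable_singular_segment {k : ℕ} {β : Fin k → ℝ} (hβ : ∀ j, β j ≤ 0)
    (hβ' : ∀ j, -1 < β j) {v : Fin k → ℝ × ℝ} (hv : NonLightCone v) (p : ℝ) {q : ℝ}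
    (hq : q ≠ 0) (a c : ℝ) :
    IntegrableOn (fun z : ℝ × ℝ => singular β v 0 (p + q * z.1) z.2)
      (Set.Ioo a c ×ˢ Set.univ) strip := by
  -- B bounds |p + qs| + |x| for s in (a, c) and |x| ≤ 1, so cutting the one-variable products off
  -- at ±B changes nothing on the segment.
  set B : ℝ := |p| + |q| * (|a| + |c|) + 1 with hB
  have F1 := intervalIntegrable_prod_gapPow hβ hβ' (y := fun j => (v j).2 - (v j).1)
    (fun i j hij m => (hv.ne_of_ne hij m).1) (-B) B
  have F2 := intervalIntegrable_prod_gapPow hβ hβ' (y := fun j => (v j).2 + (v j).1)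
    (fun i j hij m => (hv.ne_of_ne hij m).2) (-B) B
  have hB0 : -B ≤ B := by have : 0 ≤ B := by positivity
                          linarith
  rw [intervalIntegrable_iff_integrableOn_Icc_of_le hB0,
    ← integrable_indicator_iff measurableSet_Icc] at F1 F2
  have key := integrable_comp_lightCone F1 F2 hq p
  have hS : strip.restrict (Set.Ioo a c ×ˢ Set.univ)
      = (volume : Measure (ℝ × ℝ)).restrict (Set.Ioo a c ×ˢ Set.Icc (-1) 1) := by
    unfold strip
    rw [← Measure.prod_restrict, Measure.restrict_univ, Measure.volume_eq_prod,
      ← Measure.prod_restrict]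
  rw [IntegrableOn, hS]
  refine (key.integrableOn (s := Set.Ioo a c ×ˢ Set.Icc (-1) 1)).congr_fun (fun z hz => ?_)
    (measurableSet_Ioo.prod measurableSet_Icc)
  obtain ⟨⟨h1, h2⟩, h3, h4⟩ := hz
  have hz1 : |z.1| ≤ |a| + |c| := by
    rw [abs_le]
    constructor
    · linarith [neg_abs_le a, abs_nonneg c]
    · linarith [le_abs_self c, abs_nonneg a]
  have hz2 : |p + q * z.1| ≤ |p| + |q| * (|a| + |c|) := by
    refine (abs_add_le _ _).trans ?_
    rw [abs_mul]
    gcongr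
  have := abs_le.1 hz2
  simp only
  rw [Set.indicator_of_mem, Set.indicator_of_mem]
  · rfl
  · constructor <;> linarith
  · constructor <;> linarith

/-! ### Contours with admissible height and speed -/

/-- A contour with `m` vertical segments, height `η` and speed `ρ`. On the segments the contour
may stop where the speed vanishes. -/
structure Admissible (m : ℕ) (η : ℝ → ℝ) (ρ : ℝ → ℂ) : Prop where
  measurable_height : Measurable η
  measurable_speed : Measurable ρ
  bounded : ∃ B, ∀ s, |η s| ≤ B
  left : ∃ c, ∀ s < 0, η s = c ∧ ‖ρ s‖ ≤ 1
  right : ∃ c, ∀ s, (m : ℝ) < s → η s = c ∧ ‖ρ s‖ ≤ 1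
  middle : ∀ j < m, ∃ p q : ℝ, ∀ s, (j : ℝ) < s → s < j + 1 →
    ρ s = 0 ∨ (η s = p + q * s ∧ ‖ρ s‖ ≤ |q|)

lemma exists_abs_path_le (m : ℕ) (h : ℕ → ℝ) : ∃ B, ∀ s, |path m h s| ≤ B := by
  induction m with
  | zero => exact ⟨|h 0|, fun s => by simp [path]⟩
  | succ m ih =>
    obtain ⟨B, hB⟩ := ih
    refine ⟨B + |h (m + 1) - h m|, fun s => ?_⟩
    rw [path_succ]
    refine (abs_add_le _ _).trans (add_le_add (hB s) ?_)
    rw [abs_mul]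
    refine mul_le_of_le_one_right (abs_nonneg _) ?_
    rw [abs_of_nonneg (le_max_left _ _)]
    exact max_le zero_le_one (min_le_left _ _)

lemma admissible_path (m : ℕ) (h : ℕ → ℝ) : Admissible m (path m h) (dens m h) where
  measurable_height := (continuous_path m h).measurable
  measurable_speed := measurable_dens m h
  bounded := exists_abs_path_le m h
  left := ⟨h 0, fun s hs => ⟨path_of_le_zero hs.le, by rw [dens_of_lt_zero hs, norm_one]⟩⟩
  right := ⟨h m, fun s hs => ⟨path_of_ge hs.le, by rw [dens_of_gt hs, norm_one]⟩⟩
  middle j hj := ⟨h j - (h (j + 1) - h j) * j, h (j + 1) - h j, fun s h0 h1 => .inr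
    ⟨by rw [path_of_mem hj h0.le h1.le]; ring, by
      rw [dens_of_mem hj h0 h1, norm_mul, Complex.norm_I, one_mul, Complex.norm_real,
        Real.norm_eq_abs]⟩⟩

lemma Admissible.integrable_singular {m : ℕ} {η : ℝ → ℝ} {ρ : ℝ → ℂ} (h : Admissible m η ρ)
    {k : ℕ} {β : Fin k → ℝ} (hβ : ∀ j, β j ≤ 0) (hβ' : ∀ j, -1 < β j) {v : Fin k → ℝ × ℝ}
    (hv : NonLightCone v) {κ : ℝ} (hκ : 0 < κ) :
    Integrable (fun z : ℝ × ℝ => Real.exp (-(κ * |rpart m z.1|)) *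
      singular β v (rpart m z.1) (η z.1) z.2 * ‖ρ z.1‖) strip := by
  set F := fun z : ℝ × ℝ => Real.exp (-(κ * |rpart m z.1|)) *
      singular β v (rpart m z.1) (η z.1) z.2 * ‖ρ z.1‖ with hF
  have hη := h.measurable_height
  have hρ := h.measurable_speed
  have hr := (continuous_rpart m).measurable
  have hFm : Measurable F := by
    refine Measurable.mul (Measurable.mul (by fun_prop) ?_) (by fun_prop)
    exact measurable_singular β v (by fun_prop) (by fun_prop) (by fun_prop)
  have hm0 : (0 : ℝ) ≤ m := m.cast_nonneg
  have hFle : ∀ z {C : ℝ}, ‖ρ z.1‖ ≤ C → ‖F z‖ ≤ Real.exp (-(κ * |rpart m z.1|)) *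
      singular β v (rpart m z.1) (η z.1) z.2 * C := by
    intro z C hC
    have hs := singular_pos β v (rpart m z.1) (η z.1) z.2
    rw [Real.norm_of_nonneg (by positivity)]
    exact mul_le_mul_of_nonneg_left hC (by positivity)
  have hL : IntegrableOn F (Set.Iio 0 ×ˢ Set.univ) strip := by
    obtain ⟨c, hc⟩ := h.left
    refine (integrable_singular_leg hβ hβ' hv hκ c).integrableOn.mono'
      hFm.aestronglyMeasurable.restrict ?_
    rw [ae_restrict_iff' (measurableSet_Iio.prod MeasurableSet.univ)]
    refine Filter.Eventually.of_forall fun z hz => ?_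
    have hz0 : z.1 < 0 := hz.1
    refine (hFle z (hc _ hz0).2).trans (le_of_eq ?_)
    rw [mul_one, (hc _ hz0).1, rpart_of_le_zero hz0.le]
  have hR : IntegrableOn F (Set.Ioi (m : ℝ) ×ˢ Set.univ) strip := by
    obtain ⟨c, hc⟩ := h.right
    have hmp : MeasurePreserving (Prod.map (fun s : ℝ => s - m) (id : ℝ → ℝ)) strip strip :=
      (measurePreserving_sub_right volume (m : ℝ)).prod (MeasurePreserving.id _)
    have hi := hmp.integrable_comp_of_integrable (integrable_singular_leg hβ hβ' hv hκ c)
    refine hi.integrableOn.mono' hFm.aestronglyMeasurable.restrict ?_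
    rw [ae_restrict_iff' (measurableSet_Ioi.prod MeasurableSet.univ)]
    refine Filter.Eventually.of_forall fun z hz => ?_
    have hz0 : (m : ℝ) < z.1 := hz.1
    refine (hFle z (hc _ hz0).2).trans (le_of_eq ?_)
    rw [mul_one, (hc _ hz0).1, rpart_of_ge hz0.le]
    rfl
  have hM : ∀ j < m, IntegrableOn F (Set.Ioo (j : ℝ) (j + 1) ×ˢ Set.univ) strip := by
    intro j hj
    obtain ⟨p, q, hpq⟩ := h.middle j hj
    have hj0 : (0 : ℝ) ≤ j := j.cast_nonneg
    have hjm : ((j : ℝ) + 1) ≤ m := by exact_mod_cast hj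
    have hms : MeasurableSet (Set.Ioo (j : ℝ) (j + 1) ×ˢ (Set.univ : Set ℝ)) :=
      measurableSet_Ioo.prod MeasurableSet.univ
    -- On a segment of constant height the speed vanishes, so the integrand is zero. The change to
    -- light-cone coordinates would be degenerate there.
    by_cases hq : q = 0
    · refine (integrable_zero (ℝ × ℝ) ℝ strip).integrableOn.congr_fun (fun z hz => ?_) hms
      rcases hpq z.1 hz.1.1 hz.1.2 with h0 | h0
      · simp [hF, h0]
      · have := h0.2
        rw [hq, abs_zero] at this
        simp [hF, norm_le_zero_iff.1 this]
    · have := (integrable_singular_segment hβ hβ' hv p hq (j : ℝ) (j + 1)).mul_const |q|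
      refine this.mono' hFm.aestronglyMeasurable.restrict ?_
      rw [ae_restrict_iff' hms]
      refine Filter.Eventually.of_forall fun z hz => ?_
      have hz1 : (j : ℝ) < z.1 := hz.1.1
      have hz2 : z.1 < j + 1 := hz.1.2
      have hs := singular_pos β v 0 (p + q * z.1) z.2
      rcases hpq z.1 hz1 hz2 with h0 | h0
      · have : F z = 0 := by simp [hF, h0]
        rw [this, norm_zero]
        positivity
      · refine (hFle z h0.2).trans (le_of_eq ?_)
        rw [h0.1, rpart_of_mem (by linarith) (by linarith), abs_zero, mul_zero, neg_zero,
          Real.exp_zero, one_mul]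
  have hU : IntegrableOn F ((Set.Iio 0 ×ˢ Set.univ) ∪ (Set.Ioi (m : ℝ) ×ˢ Set.univ) ∪
      ⋃ j ∈ Finset.range m, Set.Ioo (j : ℝ) (j + 1) ×ˢ (Set.univ : Set ℝ)) strip := by
    refine (hL.union hR).union ?_
    rw [integrableOn_finset_iUnion]
    exact fun j hj => hM j (Finset.mem_range.1 hj)
  rw [← integrableOn_univ]
  refine hU.congr_set_ae ?_
  have hae : ∀ᵐ z ∂strip, ∀ j : ℕ, z.1 ≠ (j : ℝ) :=
    Measure.quasiMeasurePreserving_fst.ae ae_ne_natCast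
  filter_upwards [hae] with z hz
  refine propext ⟨fun _ => ?_, fun _ => trivial⟩
  rcases param_cases m hz with h | h | ⟨j, hj, h0, h1⟩
  · exact .inl (.inl ⟨h, trivial⟩)
  · exact .inl (.inr ⟨h, trivial⟩)
  · refine .inr ?_
    exact Set.mem_biUnion (Finset.mem_coe.2 (Finset.mem_range.2 hj)) ⟨⟨h0, h1⟩, trivial⟩

/-! ### Energy bounds and absolute convergence -/

lemma green_re {τ : ℂ} {x : ℝ} (h : 0 ≤ τ.re) : (green τ x).re = -(Real.pi * τ.re / 2)
    - 1 / 2 * Real.log (gap τ.re (x - τ.im)) - 1 / 2 * Real.log (gap τ.re (x + τ.im)) := by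
  have hpi := Real.pi_pos
  have r1 : (-(Real.pi : ℂ) * τ + Real.pi * Complex.I * x).re = -(Real.pi * τ.re) := by simp
  have r2 : (-(Real.pi : ℂ) * τ - Real.pi * Complex.I * x).re = -(Real.pi * τ.re) := by simp
  have i1 : (-(Real.pi : ℂ) * τ + Real.pi * Complex.I * x).im = Real.pi * (x - τ.im) := by
    simp; ring
  have i2 : (-(Real.pi : ℂ) * τ - Real.pi * Complex.I * x).im = Real.pi * (-(x + τ.im)) := by
    simp; ring
  have hn : -(Real.pi * τ.re) ≤ 0 := by have := mul_nonneg hpi.le h; linarith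
  have g1 := norm_one_sub_exp (r1.trans_le hn)
  have g2 := norm_one_sub_exp (r2.trans_le hn)
  rw [r1, i1, ← mul_neg, mul_div_cancel_left₀ _ hpi.ne', mul_div_cancel_left₀ _ hpi.ne',
    gap_neg_left] at g1
  rw [r2, i2, ← mul_neg, mul_div_cancel_left₀ _ hpi.ne', mul_div_cancel_left₀ _ hpi.ne',
    gap_neg_left, gap_neg_right] at g2
  rw [← g1, ← g2, ← Complex.log_re, ← Complex.log_re]
  unfold green
  have h3 : ∀ a c d : ℂ, (-a - 1 / 2 * c - 1 / 2 * d).re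
      = -a.re - 1 / 2 * c.re - 1 / 2 * d.re := by
    intro a c d
    simp
  rw [h3]
  congr 3
  simp

/-- Complex charges turn the phase of e^g into modulus, so the phase must be bounded too. Principal
logarithms contribute at most π in total. -/
lemma abs_green_im_le (τ : ℂ) (x : ℝ) : |(green τ x).im| ≤ Real.pi * |τ.im| / 2 + Real.pi := by
  unfold green
  set A := Complex.log (1 - Complex.exp (-(Real.pi : ℂ) * τ + Real.pi * Complex.I * x)) with hA
  set A' := Complex.log (1 - Complex.exp (-(Real.pi : ℂ) * τ - Real.pi * Complex.I * x)) with hA'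
  have h3 : (-((Real.pi : ℂ) * τ / 2) - 1 / 2 * A - 1 / 2 * A').im
      = -(Real.pi * τ.im / 2) - 1 / 2 * A.im - 1 / 2 * A'.im := by
    simp
  have a1 : |A.im| ≤ Real.pi := by rw [hA, Complex.log_im]; exact Complex.abs_arg_le_pi _
  have a2 : |A'.im| ≤ Real.pi := by rw [hA', Complex.log_im]; exact Complex.abs_arg_le_pi _
  have a3 : |Real.pi * τ.im / 2| = Real.pi * |τ.im| / 2 := by
    rw [abs_div, abs_mul, abs_of_pos Real.pi_pos, abs_two]
  rw [h3, ← a3]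
  rw [abs_le] at a1 a2 ⊢
  have b1 := neg_abs_le (Real.pi * τ.im / 2)
  have b2 := le_abs_self (Real.pi * τ.im / 2)
  constructor <;> linarith [a1.1, a1.2, a2.1, a2.2]

/-- The three groups are linear growth in Re τ, a constant, and the singular part. Positive
exponents go into the constant because the gap is at most 2; only negative exponents survive in the
singular part. -/
lemma external_energy_le {b B : ℝ} (hb : 0 < b) (a : ℂ) {τ : ℂ} (hτ : 0 ≤ τ.re)
    (hB : |τ.im| ≤ B) (x : ℝ) :
    (-4 * b * (a * green τ x)).re ≤ 2 * Real.pi * b * a.re * τ.re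
      + (2 * (max (2 * b * a.re) 0 * Real.log 2) + 4 * b * |a.im| * (Real.pi * B / 2 + Real.pi))
      + min (2 * b * a.re) 0 *
        (Real.log (gap τ.re (x - τ.im)) + Real.log (gap τ.re (x + τ.im))) := by
  have h1 : (-4 * (b : ℂ) * (a * green τ x)).re
      = -4 * b * (a.re * (green τ x).re) + 4 * b * (a.im * (green τ x).im) := by
    simp; ring
  have hpi := Real.pi_pos
  have h2 : a.im * (green τ x).im ≤ |a.im| * (Real.pi * B / 2 + Real.pi) := by
    refine (le_abs_self _).trans ?_
    rw [abs_mul]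
    refine mul_le_mul_of_nonneg_left ((abs_green_im_le τ x).trans ?_) (abs_nonneg _)
    gcongr
  have h3 : ∀ y, 2 * b * a.re * Real.log (gap τ.re y) ≤
      max (2 * b * a.re) 0 * Real.log 2 + min (2 * b * a.re) 0 * Real.log (gap τ.re y) := by
    intro y
    have e : 2 * b * a.re = max (2 * b * a.re) 0 + min (2 * b * a.re) 0 := by
      rw [max_add_min, add_zero]
    have := mul_le_mul_of_nonneg_left (log_gap_le τ.re y) (le_max_right (2 * b * a.re) 0)
    calc 2 * b * a.re * Real.log (gap τ.re y)
        = (max (2 * b * a.re) 0 + min (2 * b * a.re) 0) * Real.log (gap τ.re y) := by rw [← e]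
      _ ≤ _ := by rw [add_mul]; linarith
  rw [h1, green_re hτ]
  have e1 := h3 (x - τ.im)
  have e2 := h3 (x + τ.im)
  have e3 := mul_le_mul_of_nonneg_left h2 (by linarith : 0 ≤ 4 * b)
  nlinarith [e1, e2, e3]

/-- The exponent 2b² of the gap is nonnegative, so coinciding screening points produce no
singularity. No sign of Re τ is assumed, because `norm_legWeight_le` allows arbitrary real parts for
the other visits. -/
lemma internal_energy_le (b : ℝ) (τ : ℂ) (x : ℝ) :
    (-4 * (b : ℂ) ^ 2 * green τ x).re ≤ 2 * Real.pi * b ^ 2 * τ.re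
      + 4 * b ^ 2 * Real.log (1 + Real.exp (-(Real.pi * τ.re))) := by
  have hlog : ∀ w : ℂ, w.re = -(Real.pi * τ.re) → (Complex.log (1 - Complex.exp w)).re ≤
      Real.log (1 + Real.exp (-(Real.pi * τ.re))) := by
    intro w hw
    rw [Complex.log_re]
    have hE := Real.exp_pos (-(Real.pi * τ.re))
    rcases (norm_nonneg (1 - Complex.exp w)).eq_or_lt with h | h
    · rw [← h, Real.log_zero]; exact Real.log_nonneg (by linarith)
    · refine Real.log_le_log h ((norm_sub_le _ _).trans ?_)
      rw [norm_one, Complex.norm_exp, hw]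
  have e1 := hlog (-(Real.pi : ℂ) * τ + Real.pi * Complex.I * x) (by simp)
  have e2 := hlog (-(Real.pi : ℂ) * τ - Real.pi * Complex.I * x) (by simp)
  unfold green
  have h3 : ∀ c d : ℂ, (-4 * (b : ℂ) ^ 2 * (-(Real.pi * τ / 2) - 1 / 2 * c - 1 / 2 * d)).re
      = 2 * Real.pi * b ^ 2 * τ.re + 2 * b ^ 2 * (c.re + d.re) := by
    intro c d
    have : (-4 * (b : ℂ) ^ 2 * (-(Real.pi * τ / 2) - 1 / 2 * c - 1 / 2 * d))
      = ((2 * Real.pi * b ^ 2 : ℝ) : ℂ) * τ + ((2 * b ^ 2 : ℝ) : ℂ) * (c + d) := by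
      push_cast; ring
    rw [this, Complex.add_re, Complex.re_ofReal_mul, Complex.re_ofReal_mul, Complex.add_re]
  rw [h3]
  nlinarith [mul_le_mul_of_nonneg_left (add_le_add e1 e2) (by positivity : 0 ≤ 2 * b ^ 2)]

lemma sum_pairs_add {w : ℕ} (R : Fin w → ℝ) :
    ∑ l, ∑ l' ∈ Finset.Ioi l, (R l + R l') = (w - 1) * ∑ l, R l := by
  simp only [Finset.sum_add_distrib]
  have h2 : ∑ l : Fin w, ∑ l' ∈ Finset.Ioi l, R l' = ∑ l', ∑ l ∈ Finset.Iio l', R l' :=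
    Finset.sum_comm' (by simp)
  rw [h2, ← Finset.sum_add_distrib, Finset.mul_sum]
  refine Finset.sum_congr rfl fun l _ => ?_
  rw [Finset.sum_const, Finset.sum_const, Fin.card_Ioi, Fin.card_Iio, ← add_smul, nsmul_eq_mul]
  congr 1
  have := l.2
  rw [show w - 1 - (l : ℕ) + l = w - 1 by omega, Nat.cast_sub (by omega), Nat.cast_one]

/-- Neutrality at work: for each l the insertions contribute -2πb²w R_l to the exponent, while the w
- 1 pairs that contain l contribute 2πb²(w - 1) R_l. What remains is decay at the rate 2πb² in every
R_l. -/
lemma norm_pairWeight_le {k w : ℕ} {b : ℝ} {α : Fin k → ℂ}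
    (hsum : ∑ j, (α j).re = -(b * w)) {A : Fin k → Fin w → ℂ} {P : Fin w → Fin w → ℂ}
    {R : Fin w → ℝ} {c S : Fin k → Fin w → ℝ} {d : Fin w → Fin w → ℝ}
    (hA : ∀ j l, (-4 * b * (α j * A j l)).re ≤ 2 * Real.pi * b * (α j).re * R l + c j l + S j l)
    (hP : ∀ l l', l < l' →
      (-4 * (b : ℂ) ^ 2 * P l l').re ≤ 2 * Real.pi * b ^ 2 * (R l + R l') + d l l') :
    ‖pairWeight b α A P‖ ≤ Real.exp ((∑ j, ∑ l, c j l) + ∑ l, ∑ l' ∈ Finset.Ioi l, d l l') *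
      ∏ l, (Real.exp (-(2 * Real.pi * b ^ 2 * R l)) * ∏ j, Real.exp (S j l)) := by
  have e1 : (-4 * (b : ℂ) * ∑ j, ∑ l, α j * A j l
      - 4 * (b : ℂ) ^ 2 * ∑ l, ∑ l' ∈ Finset.Ioi l, P l l').re
      = ∑ j, ∑ l, (-4 * b * (α j * A j l)).re
        + ∑ l, ∑ l' ∈ Finset.Ioi l, (-4 * (b : ℂ) ^ 2 * P l l').re := by
    simp only [← Complex.re_sum, ← Finset.mul_sum]
    rw [← Complex.add_re]
    ring_nf
  have e2 : ∑ j, ∑ l, (-4 * b * (α j * A j l)).re ≤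
      ∑ j, ∑ l, (2 * Real.pi * b * (α j).re * R l + c j l + S j l) :=
    Finset.sum_le_sum fun j _ => Finset.sum_le_sum fun l _ => hA j l
  have e3 : ∑ l, ∑ l' ∈ Finset.Ioi l, (-4 * (b : ℂ) ^ 2 * P l l').re ≤
      ∑ l, ∑ l' ∈ Finset.Ioi l, (2 * Real.pi * b ^ 2 * (R l + R l') + d l l') :=
    Finset.sum_le_sum fun l _ => Finset.sum_le_sum fun l' hl' => hP l l' (Finset.mem_Ioi.1 hl')
  unfold pairWeight
  rw [Complex.norm_exp, e1]
  simp only [← Real.exp_sum, ← Real.exp_add]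
  refine Real.exp_le_exp.2 ((add_le_add e2 e3).trans (le_of_eq ?_))
  simp only [Finset.sum_add_distrib, ← Finset.mul_sum]
  have e4 : ∑ j, 2 * Real.pi * b * (α j).re * ∑ l, R l
      = 2 * Real.pi * b * (-(b * w)) * ∑ l, R l := by
    rw [← Finset.sum_mul, ← Finset.mul_sum, hsum]
  have e5 := sum_pairs_add R
  simp only [Finset.sum_add_distrib] at e5
  rw [e4, e5, Finset.sum_comm (f := S), Finset.sum_neg_distrib, ← Finset.mul_sum]
  ring

/-- A mark with e j ≤ m has real part 0 and parameter in [0, m], so earlier points have nonpositive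
and later points nonnegative real part. The ordered difference thus has real part |rpart| in both
cases, whatever the heights are. -/
lemma mark_visit_energy_le {k : ℕ} {b B : ℝ} (hb : 0 < b) {α : Fin k → ℂ} {v : Fin k → ℝ × ℝ}
    {e : Fin k → ℕ} {m : ℕ} {j : Fin k} (he : e j ≤ m) {η : ℝ → ℝ} {z : ℝ × ℝ}
    (hB : |η z.1| ≤ B) :
    (-4 * b * (α j * orderedGreen (mark e v j) (visit m η z))).re ≤
      2 * Real.pi * b * (α j).re * |rpart m z.1|
      + (2 * (max (2 * b * (α j).re) 0 * Real.log 2)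
        + 4 * b * |(α j).im| * (Real.pi * (B + |(v j).1|) / 2 + Real.pi))
      + min (2 * b * (α j).re) 0 *
        (Real.log (gap (rpart m z.1) ((v j).2 - (v j).1 + (η z.1 - z.2)))
          + Real.log (gap (rpart m z.1) ((v j).2 + (v j).1 + (-η z.1 - z.2)))) := by
  have he' : (e j : ℝ) ≤ m := by exact_mod_cast he
  have he0 : (0 : ℝ) ≤ e j := (e j).cast_nonneg
  rcases le_or_gt z.1 (e j) with h | h
  · rw [orderedGreen_of_ge (by exact h)]
    have hr : rpart m z.1 ≤ 0 := rpart_nonpos (h.trans he')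
    have hre : ((mark e v j).time - (visit m η z).time).re = -rpart m z.1 := by simp [mark, visit]
    have him : ((mark e v j).time - (visit m η z).time).im = (v j).1 - η z.1 := by
      simp [mark, visit]
    have := external_energy_le hb (α j) (τ := (mark e v j).time - (visit m η z).time)
      (B := B + |(v j).1|) (by rw [hre]; linarith)
      (by rw [him, add_comm]; exact (abs_sub _ _).trans (by gcongr))
      ((mark e v j).space - (visit m η z).space)
    have x1 : (mark e v j).space - (visit m η z).space - ((v j).1 - η z.1)
        = (v j).2 - (v j).1 + (η z.1 - z.2) := by simp only [mark, visit]; ring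
    have x2 : (mark e v j).space - (visit m η z).space + ((v j).1 - η z.1)
        = (v j).2 + (v j).1 + (-η z.1 - z.2) := by simp only [mark, visit]; ring
    rw [hre, him, gap_neg_left, gap_neg_left, x1, x2] at this
    rwa [abs_of_nonpos hr]
  · rw [orderedGreen_of_lt (by exact h)]
    have hr : 0 ≤ rpart m z.1 := rpart_nonneg (he0.trans h.le)
    have hre : ((visit m η z).time - (mark e v j).time).re = rpart m z.1 := by simp [mark, visit]
    have him : ((visit m η z).time - (mark e v j).time).im = η z.1 - (v j).1 := by
      simp [mark, visit]
    have := external_energy_le hb (α j) (τ := (visit m η z).time - (mark e v j).time)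
      (B := B + |(v j).1|) (by rw [hre]; exact hr)
      (by rw [him]; exact (abs_sub _ _).trans (by gcongr))
      ((visit m η z).space - (mark e v j).space)
    have x1 : (visit m η z).space - (mark e v j).space - (η z.1 - (v j).1)
        = -((v j).2 - (v j).1 + (η z.1 - z.2)) := by simp only [mark, visit]; ring
    have x2 : (visit m η z).space - (mark e v j).space + (η z.1 - (v j).1)
        = -((v j).2 + (v j).1 + (-η z.1 - z.2)) := by simp only [mark, visit]; ring
    rw [hre, him, x1, x2, gap_neg_right, gap_neg_right] at this
    rwa [abs_of_nonneg hr]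

/-- The real part is monotone along the contour, so the ordered difference has nonnegative real
part. The heights η and η' may differ, which is needed when screening points are moved to a new
contour one by one. -/
lemma visit_visit_energy_le (b : ℝ) {m : ℕ} {η η' : ℝ → ℝ} {z z' : ℝ × ℝ} :
    (-4 * (b : ℂ) ^ 2 * orderedGreen (visit m η z) (visit m η' z')).re ≤
      2 * Real.pi * b ^ 2 * (|rpart m z.1| + |rpart m z'.1|) + 4 * b ^ 2 * Real.log 2 := by
  have hpi := Real.pi_pos
  have key : ∀ (τ : ℂ) (x : ℝ), 0 ≤ τ.re → τ.re ≤ |rpart m z.1| + |rpart m z'.1| →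
      (-4 * (b : ℂ) ^ 2 * green τ x).re ≤
      2 * Real.pi * b ^ 2 * (|rpart m z.1| + |rpart m z'.1|) + 4 * b ^ 2 * Real.log 2 := by
    intro τ x h0 h1
    refine (internal_energy_le b τ x).trans ?_
    have : Real.exp (-(Real.pi * τ.re)) ≤ 1 := Real.exp_le_one_iff.2 (by
      have := mul_nonneg hpi.le h0; linarith)
    have hE := Real.exp_pos (-(Real.pi * τ.re))
    gcongr
    linarith
  unfold orderedGreen
  split_ifs with h
  · have hr : rpart m z'.1 ≤ rpart m z.1 := rpart_mono m h
    have hre : ((visit m η z).time - (visit m η' z').time).re = rpart m z.1 - rpart m z'.1 := by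
      simp [visit]
    refine key _ _ ?_ ?_ <;> rw [hre]
    · linarith
    · linarith [le_abs_self (rpart m z.1), neg_abs_le (rpart m z'.1)]
  · have hr : rpart m z.1 ≤ rpart m z'.1 := rpart_mono m (not_le.1 h).le
    have hre : ((visit m η' z').time - (visit m η z).time).re = rpart m z'.1 - rpart m z.1 := by
      simp [visit]
    refine key _ _ ?_ ?_ <;> rw [hre]
    · linarith
    · linarith [le_abs_self (rpart m z'.1), neg_abs_le (rpart m z.1)]

lemma measurable_green : Measurable fun p : ℂ × ℝ => green p.1 p.2 := by
  have h0 : Measurable fun z : ℂ => Complex.log (1 - Complex.exp z) := by fun_prop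
  have h1 : Measurable fun p : ℂ × ℝ => -(Real.pi : ℂ) * p.1 + Real.pi * Complex.I * (p.2 : ℂ) := by
    fun_prop
  have h2 : Measurable fun p : ℂ × ℝ => -(Real.pi : ℂ) * p.1 - Real.pi * Complex.I * (p.2 : ℂ) := by
    fun_prop
  have h3 : Measurable fun p : ℂ × ℝ => -((Real.pi : ℂ) * p.1 / 2) := by fun_prop
  exact (h3.sub ((h0.comp h1).const_mul (1 / 2))).sub ((h0.comp h2).const_mul (1 / 2))

lemma measurable_orderedGreen {X : Type*} [MeasurableSpace X] {u u' : X → Visit}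
    (h1 : Measurable fun x => (u x).param) (h2 : Measurable fun x => (u x).time)
    (h3 : Measurable fun x => (u x).space) (h1' : Measurable fun x => (u' x).param)
    (h2' : Measurable fun x => (u' x).time) (h3' : Measurable fun x => (u' x).space) :
    Measurable fun x => orderedGreen (u x) (u' x) := by
  unfold orderedGreen
  refine Measurable.ite (measurableSet_le h1' h1) ?_ ?_
  · have := measurable_green.comp ((h2.sub h2').prodMk (h3.sub h3'))
    simpa only [Function.comp_def, Pi.sub_apply] using this
  · have := measurable_green.comp ((h2'.sub h2).prodMk (h3'.sub h3))
    simpa only [Function.comp_def, Pi.sub_apply] using this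

lemma measurable_pathIntegrand {k w : ℕ} (b : ℝ) (α : Fin k → ℂ) (v : Fin k → ℝ × ℝ)
    (e : Fin k → ℕ) (m : ℕ) {η : Fin w → ℝ → ℝ} {ρ : Fin w → ℝ → ℂ}
    (hη : ∀ l, Measurable (η l)) (hρ : ∀ l, Measurable (ρ l)) :
    Measurable (pathIntegrand b α v e m η ρ) := by
  have hp : ∀ l : Fin w, Measurable fun z : Fin w → ℝ × ℝ => (z l).1 := fun l =>
    measurable_fst.comp (measurable_pi_apply l)
  have hs : ∀ l : Fin w, Measurable fun z : Fin w → ℝ × ℝ => (z l).2 := fun l =>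
    measurable_snd.comp (measurable_pi_apply l)
  have ht : ∀ l : Fin w, Measurable fun z : Fin w → ℝ × ℝ => (visit m (η l) (z l)).time := by
    intro l
    exact (Complex.measurable_ofReal.comp ((continuous_rpart m).measurable.comp (hp l))).add
      ((Complex.measurable_ofReal.comp ((hη l).comp (hp l))).const_mul _)
  unfold pathIntegrand weight pairWeight
  refine Measurable.mul (Complex.measurable_exp.comp (Measurable.sub ?_ ?_)) ?_
  · refine Measurable.const_mul (Finset.measurable_fun_sum _ fun j _ =>
      Finset.measurable_fun_sum _ fun l _ => Measurable.const_mul ?_ _) _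
    exact measurable_orderedGreen measurable_const measurable_const measurable_const
      (hp l) (ht l) (hs l)
  · refine Measurable.const_mul (Finset.measurable_fun_sum _ fun l _ =>
      Finset.measurable_fun_sum _ fun l' _ => ?_) _
    exact measurable_orderedGreen (hp l) (ht l) (hs l) (hp l') (ht l') (hs l')
  · exact Finset.measurable_fun_prod _ fun l _ => (hρ l).comp (hp l)

/-- Absolute convergence of the screening integrals. -/
theorem integrable_pathIntegrand {k w : ℕ} {b : ℝ} (hb : 0 < b) {α : Fin k → ℂ}
    (hα : ∀ j, -(1 / (2 * b)) < (α j).re) (hsum : ∑ j, (α j).re = -(b * w))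
    {v : Fin k → ℝ × ℝ} (hv : NonLightCone v) {e : Fin k → ℕ} {m : ℕ} (he : ∀ j, e j ≤ m)
    {η : Fin w → ℝ → ℝ} {ρ : Fin w → ℝ → ℂ} (hadm : ∀ l, Admissible m (η l) (ρ l)) :
    Integrable (pathIntegrand b α v e m η ρ) (screeningMeasure w) := by
  set β : Fin k → ℝ := fun j => min (2 * b * (α j).re) 0 with hβdef
  have hβ : ∀ j, β j ≤ 0 := fun j => min_le_right _ _
  have hβ' : ∀ j, -1 < β j := by
    intro j
    refine lt_min ?_ (by norm_num)
    have := mul_lt_mul_of_pos_left (hα j) (by positivity : 0 < 2 * b)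
    rwa [mul_neg, mul_one_div_cancel (by positivity)] at this
  have hκ : 0 < 2 * Real.pi * b ^ 2 := by have := Real.pi_pos; positivity
  choose B hB using fun l => (hadm l).bounded
  set c : Fin k → Fin w → ℝ := fun j l => 2 * (max (2 * b * (α j).re) 0 * Real.log 2)
        + 4 * b * |(α j).im| * (Real.pi * (B l + |(v j).1|) / 2 + Real.pi) with hc
  set d : Fin w → Fin w → ℝ := fun _ _ => 4 * b ^ 2 * Real.log 2 with hd
  set K := Real.exp ((∑ j, ∑ l, c j l) + ∑ l, ∑ l' ∈ Finset.Ioi l, d l l') with hK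
  have hI : Integrable (fun z : Fin w → ℝ × ℝ => ∏ l, (Real.exp (-(2 * Real.pi * b ^ 2 *
      |rpart m (z l).1|)) * singular β v (rpart m (z l).1) (η l (z l).1) (z l).2
        * ‖ρ l (z l).1‖)) (screeningMeasure w) :=
    Integrable.fintype_prod fun l => (hadm l).integrable_singular hβ hβ' hv hκ
  refine (hI.const_mul K).mono' (measurable_pathIntegrand b α v e m
    (fun l => (hadm l).measurable_height)
    fun l => (hadm l).measurable_speed).aestronglyMeasurable (Filter.Eventually.of_forall fun z => ?_)
  unfold pathIntegrand weight
  rw [norm_mul, norm_prod, Finset.prod_mul_distrib, ← mul_assoc]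
  refine mul_le_mul_of_nonneg_right ?_ (Finset.prod_nonneg fun _ _ => norm_nonneg _)
  have := norm_pairWeight_le (b := b) hsum (R := fun l => |rpart m (z l).1|) (c := c) (d := d)
    (A := fun j l => orderedGreen (mark e v j) (visit m (η l) (z l)))
    (P := fun l l' => orderedGreen (visit m (η l) (z l)) (visit m (η l') (z l')))
    (fun j l => mark_visit_energy_le hb (he j) (hB l _))
    (fun l l' _ => visit_visit_energy_le b)
  refine this.trans (le_of_eq ?_)
  rw [hK]
  congr 1
  refine Finset.prod_congr rfl fun l _ => ?_
  congr 1
  unfold singular gapPow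
  rw [← Finset.prod_mul_distrib]
  refine Finset.prod_congr rfl fun j _ => ?_
  rw [← Real.exp_add, ← mul_add]

/-- The assumptions on insertions and charges under which `w` screening charges are integrable on
every contour. -/
structure Screened {k : ℕ} (b : ℝ) (α : Fin k → ℂ) (v : Fin k → ℝ × ℝ) (w : ℕ) : Prop where
  pos : 0 < b
  re_gt : ∀ j, -(1 / (2 * b)) < (α j).re
  sum_re : ∑ j, (α j).re = -(b * w)
  nonLightCone : NonLightCone v

lemma Screened.integrable {k w : ℕ} {b : ℝ} {α : Fin k → ℂ} {v : Fin k → ℝ × ℝ}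
    (H : Screened b α v w) {e : Fin k → ℕ} {m : ℕ} (he : ∀ j, e j ≤ m)
    {η : Fin w → ℝ → ℝ} {ρ : Fin w → ℝ → ℂ} (hadm : ∀ l, Admissible m (η l) (ρ l)) :
    Integrable (pathIntegrand b α v e m η ρ) (screeningMeasure w) :=
  integrable_pathIntegrand H.pos H.re_gt H.sum_re H.nonLightCone he hadm

lemma Screened.integrable_path {k w : ℕ} {b : ℝ} {α : Fin k → ℂ} {v : Fin k → ℝ × ℝ}
    (H : Screened b α v w) {e : Fin k → ℕ} {m : ℕ} (he : ∀ j, e j ≤ m) (h : ℕ → ℝ) :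
    Integrable (pathIntegrand b α v e m (fun _ : Fin w => path m h) (fun _ => dens m h))
      (screeningMeasure w) :=
  H.integrable he fun _ => admissible_path m h

/-! ### Cancellation of screening points on folds -/

lemma measurePreserving_update {w : ℕ} {σ : ℝ × ℝ → ℝ × ℝ} (hσ : MeasurePreserving σ strip strip)
    (l : Fin w) :
    MeasurePreserving (fun z : Fin w → ℝ × ℝ => Function.update z l (σ (z l)))
      (screeningMeasure w) (screeningMeasure w) := by
  have := measurePreserving_pi (fun _ : Fin w => strip) (fun _ : Fin w => strip)
    (f := fun i => if i = l then σ else id) (fun i => by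
      by_cases h : i = l
      · simpa [h] using hσ
      · simpa [h] using MeasurePreserving.id strip)
  have e : (fun z : Fin w → ℝ × ℝ => Function.update z l (σ (z l)))
      = fun a i => (if i = l then σ else id) (a i) := by
    funext z i
    by_cases h : i = l
    · subst h; simp
    · simp [h]
  rw [e]
  exact this

/-- Reflection of the contour parameter about `c`. -/
def paramFlip (c : ℝ) (z : ℝ × ℝ) : ℝ × ℝ := (2 * c - z.1, z.2)

lemma measurePreserving_paramFlip (c : ℝ) : MeasurePreserving (paramFlip c) strip strip :=
  (Measure.measurePreserving_sub_left volume (2 * c)).prod (MeasurePreserving.id _)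

lemma paramFlip_paramFlip (c : ℝ) (z : ℝ × ℝ) : paramFlip c (paramFlip c z) = z := by
  simp [paramFlip]

/-- Reflection about the tip keeps time and position and changes only the place in the order. This
is invisible to a point that is not visited between the two passages, and to a point for which the
order is immaterial anyway. -/
lemma orderedGreen_visit_paramFlip {m q : ℕ} {η : ℝ → ℝ} (hqm : q + 2 ≤ m)
    {z : ℝ × ℝ} (hη : η (2 * (q + 1) - z.1) = η z.1) (hz : (q : ℝ) < z.1) (hz' : z.1 < q + 2)
    {u : Visit} (h : u.param ≤ q ∨ (q : ℝ) + 2 ≤ u.param ∨ |z.1 - (q + 1)| < |u.param - (q + 1)| ∨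
      u.time = (visit m η z).time ∨ Spacelike (u.time.im - η z.1) (u.space - z.2)) :
    orderedGreen (visit m η (paramFlip (q + 1) z)) u = orderedGreen (visit m η z) u ∧
    orderedGreen u (visit m η (paramFlip (q + 1) z)) = orderedGreen u (visit m η z) := by
  have hqm' : (q : ℝ) + 2 ≤ m := by exact_mod_cast hqm
  have hq0 : (0 : ℝ) ≤ q := q.cast_nonneg
  have ht : (visit m η (paramFlip (q + 1) z)).time = (visit m η z).time := by
    simp only [visit, paramFlip]
    rw [hη, rpart_of_mem (by linarith) (by linarith), rpart_of_mem (by linarith) (by linarith)]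
  have him : (visit m η z).time.im = η z.1 := by simp [visit]
  have hp : (visit m η z).param = z.1 := rfl
  have hp' : (visit m η (paramFlip (q + 1) z)).param = 2 * (q + 1) - z.1 := rfl
  have hcases : ((u.param ≤ 2 * (q + 1) - z.1 ↔ u.param ≤ z.1) ∧
      (2 * (q + 1) - z.1 ≤ u.param ↔ z.1 ≤ u.param)) ∨
      u.time = (visit m η z).time ∨ Spacelike (u.time.im - η z.1) (u.space - z.2) := by
    rcases h with h | h | h | h
    · left
      constructor <;> constructor <;> intro _ <;> linarith
    · left
      constructor <;> constructor <;> intro _ <;> linarith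
    · left
      rcases abs_cases (z.1 - (q + 1)) with ⟨a1, a2⟩ | ⟨a1, a2⟩ <;>
      rcases abs_cases (u.param - (q + 1)) with ⟨b1, b2⟩ | ⟨b1, b2⟩ <;>
      rw [a1, b1] at h <;>
      constructor <;> constructor <;> intro _ <;> linarith
    · exact .inr h
  constructor
  · refine orderedGreen_congr ht rfl rfl rfl ?_
    rw [ht, hp, hp', him]
    rcases hcases with h | h | h
    · exact .inl h.1
    · exact .inr (.inl h.symm)
    · exact .inr (.inr h.sub_comm)
  · refine orderedGreen_congr rfl ht rfl rfl ?_
    rw [ht, hp, hp', him]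
    rcases hcases with h | h | h
    · exact .inl h.2
    · exact .inr (.inl h)
    · exact .inr (.inr h)

/-- Screening points in a symmetric region `N` of a fold of the contour cancel, if every insertion
and every point outside `N` that separates the two branches is spacelike to `N`. -/
theorem integral_eq_setIntegral_of_fold {k w : ℕ} {b : ℝ} {α : Fin k → ℂ} {v : Fin k → ℝ × ℝ}
    {e : Fin k → ℕ} {m q : ℕ} (hqm : q + 2 ≤ m) {η : ℝ → ℝ} {ρ : ℝ → ℂ}
    (hη : ∀ s, (q : ℝ) < s → s < q + 2 → η (2 * (q + 1) - s) = η s)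
    (hρ : ∀ s, (q : ℝ) < s → s < q + 2 → s ≠ q + 1 → ρ (2 * (q + 1) - s) = -ρ s)
    (hint : Integrable (pathIntegrand b α v e m (fun _ : Fin w => η) (fun _ => ρ))
      (screeningMeasure w))
    {N : Set (ℝ × ℝ)} (hNm : MeasurableSet N) (hN : ∀ z ∈ N, (q : ℝ) < z.1 ∧ z.1 < q + 2)
    (hflip : ∀ z ∈ N, paramFlip (q + 1) z ∈ N)
    (hext : ∀ j, ∀ z ∈ N, e j ≤ q ∨ q + 2 ≤ e j ∨
      Spacelike ((v j).1 - η z.1) ((v j).2 - z.2))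
    (hout : ∀ z ∈ N, ∀ z' : ℝ × ℝ, z' ∉ N → (q : ℝ) < z'.1 → z'.1 < q + 2 →
      |z'.1 - (q + 1)| < |z.1 - (q + 1)| → Spacelike (η z'.1 - η z.1) (z'.2 - z.2)) :
    ∫ z, pathIntegrand b α v e m (fun _ : Fin w => η) (fun _ => ρ) z ∂screeningMeasure w
      = ∫ z in {z | ∀ l, z l ∉ N}, pathIntegrand b α v e m (fun _ : Fin w => η) (fun _ => ρ) z
        ∂screeningMeasure w := by
  set f := pathIntegrand b α v e m (fun _ : Fin w => η) (fun _ => ρ) with hf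
  set θ : ℝ × ℝ → ℝ := fun z => |z.1 - (q + 1)| with hθ
  have hθm : Measurable θ := by fun_prop
  -- On A l, the point l is the one in N nearest to the tip, ties going to the smallest label. The
  -- sets A l are disjoint and exhaust the configurations with some point in N.
  set A : Fin w → Set (Fin w → ℝ × ℝ) := fun l => {z | z l ∈ N ∧ ∀ l', z l' ∈ N →
    (l' < l → θ (z l) < θ (z l')) ∧ θ (z l) ≤ θ (z l')} with hA
  have hAm : ∀ l, MeasurableSet (A l) := by
    intro l
    refine (hNm.preimage (measurable_pi_apply l)).inter ?_
    have hset : ∀ l', {z : Fin w → ℝ × ℝ | z l' ∈ N → (l' < l → θ (z l) < θ (z l')) ∧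
        θ (z l) ≤ θ (z l')} = {z | z l' ∈ N}ᶜ ∪
        ({z | l' < l}ᶜ ∪ {z | θ (z l) < θ (z l')}) ∩ {z | θ (z l) ≤ θ (z l')} := by
      intro l'
      ext z
      simp only [Set.mem_ofPred_eq, Set.mem_union, Set.mem_compl_iff, Set.mem_inter_iff]
      tauto
    have : {z : Fin w → ℝ × ℝ | ∀ l', z l' ∈ N → (l' < l → θ (z l) < θ (z l')) ∧
        θ (z l) ≤ θ (z l')} = ⋂ l', ({z | z l' ∈ N}ᶜ ∪
        ({z | l' < l}ᶜ ∪ {z | θ (z l) < θ (z l')}) ∩ {z | θ (z l) ≤ θ (z l')}) := by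
      rw [Set.ofPred_forall]
      exact Set.iInter_congr hset
    change MeasurableSet {z : Fin w → ℝ × ℝ | ∀ l', z l' ∈ N → (l' < l → θ (z l) < θ (z l')) ∧
        θ (z l) ≤ θ (z l')}
    rw [this]
    refine MeasurableSet.iInter fun l' => ?_
    refine (hNm.preimage (measurable_pi_apply l')).compl.union
      (((MeasurableSet.const _).compl.union ?_).inter ?_)
    · exact measurableSet_lt (hθm.comp (measurable_pi_apply l)) (hθm.comp (measurable_pi_apply l'))
    · exact measurableSet_le (hθm.comp (measurable_pi_apply l)) (hθm.comp (measurable_pi_apply l'))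
  have hdisj : Pairwise (Function.onFun Disjoint A) := by
    have : ∀ l l', l < l' → Disjoint (A l) (A l') := by
      intro l l' hll
      rw [Set.disjoint_left]
      intro z hz hz'
      have h1 := (hz'.2 l hz.1).1 hll
      have h2 := (hz.2 l' hz'.1).2
      linarith
    intro l l' hll
    rcases lt_or_gt_of_ne hll with h | h
    · exact this l l' h
    · exact (this l' l h).symm
  have hcompl : {z : Fin w → ℝ × ℝ | ∀ l, z l ∉ N}ᶜ = ⋃ l, A l := by
    classical
    ext z
    simp only [Set.mem_compl_iff, Set.mem_ofPred_eq, not_forall, not_not, Set.mem_iUnion]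
    constructor
    · rintro ⟨l, hl⟩
      obtain ⟨i, hi, hmin⟩ := Finset.exists_min_image (Finset.univ.filter fun l => z l ∈ N)
        (fun l => toLex (θ (z l), l)) ⟨l, by simp [hl]⟩
      refine ⟨i, (Finset.mem_filter.1 hi).2, fun l' hl' => ?_⟩
      have := hmin l' (by simp [hl'])
      rw [Prod.Lex.toLex_le_toLex] at this
      rcases this with h | ⟨h1, h2⟩
      · exact ⟨fun _ => h, le_of_lt h⟩
      · exact ⟨fun h => absurd h2 (not_le.2 h), le_of_eq h1⟩
    · rintro ⟨l, hl⟩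
      exact ⟨l, hl.1⟩
  have hzero : ∀ l, ∫ z in A l, f z ∂screeningMeasure w = 0 := by
    intro l
    set T : (Fin w → ℝ × ℝ) → (Fin w → ℝ × ℝ) := fun z =>
      Function.update z l (paramFlip (q + 1) (z l)) with hT
    have hTmp : MeasurePreserving T (screeningMeasure w) (screeningMeasure w) :=
      measurePreserving_update (measurePreserving_paramFlip _) l
    have hTT : Function.Involutive T := by
      intro z
      simp only [hT, Function.update_self, Function.update_idem, paramFlip_paramFlip,
        Function.update_eq_self]
    have hTe : MeasurableEmbedding T :=
      (MeasurableEquiv.mk hTT.toPerm hTmp.measurable hTmp.measurable).measurableEmbedding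
    have hθT : ∀ z, θ (paramFlip (q + 1) z) = θ z := by
      intro z
      simp only [hθ, paramFlip]
      rw [← abs_neg]
      congr 1
      ring
    have hNT : ∀ z, paramFlip (q + 1) z ∈ N ↔ z ∈ N := fun z =>
      ⟨fun h => by simpa [paramFlip_paramFlip] using hflip _ h, hflip z⟩
    have hpre : T ⁻¹' A l = A l := by
      have h1 : ∀ z l', T z l' ∈ N ↔ z l' ∈ N := by
        intro z l'
        by_cases h : l' = l
        · subst h; simp [hT, hNT]
        · simp [hT, h]
      have h2 : ∀ z l', θ (T z l') = θ (z l') := by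
        intro z l'
        by_cases h : l' = l
        · subst h; simp [hT, hθT]
        · simp [hT, h]
      ext z
      simp only [hA, Set.mem_preimage, Set.mem_ofPred_eq, h1, h2]
    have hanti : ∀ᵐ z ∂screeningMeasure w, z ∈ A l → f (T z) = -f z := by
      filter_upwards [ae_screeningMeasure_of_ae (w := w) ae_ne_natCast] with z hz hzA
      have hzl := hN _ hzA.1
      have hne : (z l).1 ≠ q + 1 := by have := hz l (q + 1); push_cast at this; exact this
      have key : ∀ {u : Visit}, (u.param ≤ q ∨ (q : ℝ) + 2 ≤ u.param ∨
          |(z l).1 - (q + 1)| < |u.param - (q + 1)| ∨ u.time = (visit m η (z l)).time ∨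
          Spacelike (u.time.im - η (z l).1) (u.space - (z l).2)) →
          orderedGreen (visit m η (paramFlip (q + 1) (z l))) u
            = orderedGreen (visit m η (z l)) u ∧
          orderedGreen u (visit m η (paramFlip (q + 1) (z l)))
            = orderedGreen u (visit m η (z l)) := fun hu =>
        orderedGreen_visit_paramFlip hqm (hη _ hzl.1 hzl.2) hzl.1 hzl.2 hu
      have keyz : ∀ i, i ≠ l → orderedGreen (visit m η (paramFlip (q + 1) (z l))) (visit m η (z i))
            = orderedGreen (visit m η (z l)) (visit m η (z i)) ∧
          orderedGreen (visit m η (z i)) (visit m η (paramFlip (q + 1) (z l)))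
            = orderedGreen (visit m η (z i)) (visit m η (z l)) := by
        intro i hi
        apply key
        have him : (visit m η (z i)).time.im = η (z i).1 := by simp [visit]
        have hpar : (visit m η (z i)).param = (z i).1 := rfl
        have hsp : (visit m η (z i)).space = (z i).2 := rfl
        rw [him, hpar, hsp]
        by_cases h1 : (z i).1 ≤ q
        · exact .inl h1
        by_cases h2 : (q : ℝ) + 2 ≤ (z i).1
        · exact .inr (.inl h2)
        push Not at h1 h2
        refine .inr (.inr ?_)
        -- A point farther from the tip is not visited between the two passages of l. A point at the
        -- same distance has the same complex time. A nearer point lies outside N because l is the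
        -- nearest one in N, so `hout` makes it spacelike.
        rcases lt_trichotomy |(z l).1 - (q + 1)| |(z i).1 - (q + 1)| with h | h | h
        · exact .inl h
        · refine .inr (.inl ?_)
          have hqm' : (q : ℝ) + 2 ≤ m := by exact_mod_cast hqm
          have hq0 : (0 : ℝ) ≤ q := q.cast_nonneg
          simp only [visit]
          rw [rpart_of_mem (by linarith) (by linarith),
            rpart_of_mem (by linarith [hzl.1]) (by linarith [hzl.2])]
          rcases abs_eq_abs.1 h with h | h
          · rw [show (z l).1 = (z i).1 by linarith]
          · rw [show (z l).1 = 2 * (q + 1) - (z i).1 by linarith, hη _ h1 h2]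
        · refine .inr (.inr ?_)
          by_cases hiN : z i ∈ N
          · exact absurd ((hzA.2 i hiN).2) (not_le.2 h)
          · exact hout _ hzA.1 _ hiN h1 h2 h
      rw [hf]
      unfold pathIntegrand
      have hw : weight b α (mark e v) (fun i => visit m η (T z i))
          = weight b α (mark e v) (fun i => visit m η (z i)) := by
        refine weight_congr (fun j i => ?_) (fun i i' hii => ?_)
        · by_cases hi : i = l
          · subst hi
            simp only [hT, Function.update_self]
            refine (key ?_).2
            have him : (mark e v j).time.im = (v j).1 := by simp [mark]
            rw [him]
            rcases hext j _ hzA.1 with h | h | h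
            · exact .inl (by simpa [mark] using h)
            · exact .inr (.inl (by simp only [mark]; exact_mod_cast h))
            · exact .inr (.inr (.inr (.inr h)))
          · simp only [hT, Function.update_of_ne hi]
        · by_cases hi : i = l
          · subst hi
            simp only [hT, Function.update_self, Function.update_of_ne hii.ne']
            exact (keyz _ hii.ne').1
          · by_cases hi' : i' = l
            · subst hi'
              simp only [hT, Function.update_self, Function.update_of_ne hi]
              exact (keyz _ hi).2
            · simp only [hT, Function.update_of_ne hi, Function.update_of_ne hi']
      rw [hw]
      have hp : ∏ i, ρ (T z i).1 = -∏ i, ρ (z i).1 := by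
        rw [← Finset.mul_prod_erase _ _ (Finset.mem_univ l),
          ← Finset.mul_prod_erase _ (fun i => ρ (z i).1) (Finset.mem_univ l)]
        have e1 : ρ (T z l).1 = -ρ (z l).1 := by
          simp only [hT, Function.update_self, paramFlip]
          exact hρ _ hzl.1 hzl.2 hne
        rw [e1, neg_mul]
        congr 2
        refine Finset.prod_congr rfl fun i hi => ?_
        simp only [hT, Function.update_of_ne (Finset.ne_of_mem_erase hi)]
      rw [hp, mul_neg]
    -- The reflection of point l preserves the measure and A l and reverses the sign of the
    -- integrand, so the integral over A l equals its own negative.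
    have h1 := hTmp.setIntegral_preimage_emb hTe f (A l)
    rw [hpre] at h1
    have h2 : ∫ z in A l, f (T z) ∂screeningMeasure w = ∫ z in A l, -f z ∂screeningMeasure w :=
      setIntegral_congr_ae (hAm l) hanti
    rw [h2, integral_neg] at h1
    exact self_eq_neg.1 h1.symm
  have hm0 : MeasurableSet {z : Fin w → ℝ × ℝ | ∀ l, z l ∉ N} := by
    rw [← MeasurableSet.compl_iff, hcompl]
    exact MeasurableSet.iUnion hAm
  rw [← integral_add_compl hm0 hint, hcompl, integral_iUnion_fintype hAm hdisj
    (fun l => hint.integrableOn)]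
  simp [hzero]

lemma measurableSet_spacelike {f g : ℝ × ℝ → ℝ} (hf : Measurable f) (hg : Measurable g) :
    MeasurableSet {z : ℝ × ℝ | Spacelike (f z) (g z)} := by
  unfold Spacelike
  simp only [Set.ofPred_forall]
  exact MeasurableSet.iInter fun m => measurableSet_lt (by fun_prop) (by fun_prop)

lemma path_fold {m q : ℕ} (hqm : q + 2 ≤ m) {h : ℕ → ℝ} (hh : h (q + 2) = h q) {s : ℝ}
    (h0 : (q : ℝ) ≤ s) (h1 : s ≤ q + 2) :
    path m h s = h (q + 1) + (h q - h (q + 1)) * |s - (q + 1)| := by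
  rcases le_total s (q + 1) with hs | hs
  · rw [path_of_mem (j := q) (by omega) h0 hs, abs_of_nonpos (by linarith)]; ring
  · rw [path_of_mem (j := q + 1) (by omega) (by push_cast; exact hs) (by push_cast; linarith),
      abs_of_nonneg (by linarith), hh]; push_cast; ring

lemma path_fold_symm {m q : ℕ} (hqm : q + 2 ≤ m) {h : ℕ → ℝ} (hh : h (q + 2) = h q) (s : ℝ)
    (h0 : (q : ℝ) < s) (h1 : s < q + 2) : path m h (2 * (q + 1) - s) = path m h s := by
  rw [path_fold hqm hh h0.le h1.le, path_fold hqm hh (by linarith) (by linarith), ← abs_neg (s - _)]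
  congr 3
  ring

lemma dens_fold_symm {m q : ℕ} (hqm : q + 2 ≤ m) {h : ℕ → ℝ} (hh : h (q + 2) = h q) (s : ℝ)
    (h0 : (q : ℝ) < s) (h1 : s < q + 2) (hs : s ≠ q + 1) :
    dens m h (2 * (q + 1) - s) = -dens m h s := by
  rcases lt_or_gt_of_ne hs with hs | hs
  · rw [dens_of_mem (s := s) (j := q) (by omega) h0 hs,
      dens_of_mem (j := q + 1) (by omega) (by push_cast; linarith) (by push_cast; linarith), hh]
    push_cast; ring
  · rw [dens_of_mem (s := s) (j := q + 1) (by omega) (by push_cast; exact hs)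
      (by push_cast; linarith),
      dens_of_mem (j := q) (by omega) (by linarith) (by linarith), hh]
    push_cast; ring

lemma path_dens_congr_off {m q : ℕ} {h h' : ℕ → ℝ} (hh : ∀ j, j ≠ q + 1 → h j = h' j) {s : ℝ}
    (hs : ∀ j : ℕ, s ≠ j) (hsq : ¬ ((q : ℝ) < s ∧ s < q + 2)) (hqm : q + 2 ≤ m) :
    path m h s = path m h' s ∧ dens m h s = dens m h' s := by
  rcases param_cases m hs with h0 | h0 | ⟨j, hj, h0, h1⟩
  · rw [path_of_le_zero h0.le, path_of_le_zero h0.le, dens_of_lt_zero h0, dens_of_lt_zero h0]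
    exact ⟨hh 0 (by omega), rfl⟩
  · rw [path_of_ge h0.le, path_of_ge h0.le, dens_of_gt h0, dens_of_gt h0]
    exact ⟨hh m (by omega), rfl⟩
  · have hjq : j ≠ q ∧ j ≠ q + 1 := by
      constructor
      · rintro rfl
        exact hsq ⟨h0, by linarith⟩
      · rintro rfl
        push_cast at h0 h1
        exact hsq ⟨by linarith, by linarith⟩
    rw [path_of_mem hj h0.le h1.le, path_of_mem hj h0.le h1.le, dens_of_mem hj h0 h1,
      dens_of_mem hj h0 h1, hh j hjq.2, hh (j + 1) (by omega)]
    exact ⟨rfl, rfl⟩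

/-- A fold of the contour without insertion at its tip may be deleted. -/
theorem pathIntegral_unfold {k w : ℕ} {b : ℝ} {α : Fin k → ℂ} {v : Fin k → ℝ × ℝ}
    (H : Screened b α v w) {e : Fin k → ℕ} {m : ℕ} (he : ∀ j, e j ≤ m) {q : ℕ} (hqm : q + 2 ≤ m)
    (heq : ∀ j, e j ≠ q + 1) {h h' : ℕ → ℝ} (hh : h (q + 2) = h q)
    (hh' : ∀ j, j ≠ q + 1 → h j = h' j) :
    pathIntegral b α v w e m h = pathIntegral b α v w e m h' := by
  -- With N the whole fold, no point of the fold lies outside N, so `hout` is vacuous. Both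
  -- integrals reduce to configurations off the fold, where the two contours agree.
  set N : Set (ℝ × ℝ) := Set.Ioo (q : ℝ) (q + 2) ×ˢ Set.univ with hN
  have hNm : MeasurableSet N := measurableSet_Ioo.prod MeasurableSet.univ
  have key : ∀ h : ℕ → ℝ, h (q + 2) = h q → pathIntegral b α v w e m h =
      ∫ z in {z | ∀ l, z l ∉ N}, pathIntegrand b α v e m (fun _ : Fin w => path m h)
        (fun _ => dens m h) z ∂screeningMeasure w := by
    intro h hh
    refine integral_eq_setIntegral_of_fold hqm (path_fold_symm hqm hh) (dens_fold_symm hqm hh)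
      (H.integrable_path he h) hNm (fun z hz => hz.1) (fun z hz => ⟨⟨?_, ?_⟩, trivial⟩)
      (fun j z _ => ?_) (fun z _ z' hz' a c => absurd ⟨⟨a, c⟩, trivial⟩ hz')
    · simp only [paramFlip]; linarith [hz.1.2]
    · simp only [paramFlip]; linarith [hz.1.1]
    · have := heq j
      omega
  rw [key h hh, key h' (by rw [← hh' _ (by omega), hh, hh' q (by omega)])]
  have hset : MeasurableSet {z : Fin w → ℝ × ℝ | ∀ l, z l ∉ N} := by
    simp only [Set.ofPred_forall]
    exact MeasurableSet.iInter fun l => (hNm.preimage (measurable_pi_apply l)).compl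
  refine setIntegral_congr_ae hset ?_
  filter_upwards [ae_screeningMeasure_of_ae (w := w) ae_ne_natCast] with z hz hzN
  have hpd : ∀ l, path m h (z l).1 = path m h' (z l).1 ∧ dens m h (z l).1 = dens m h' (z l).1 :=
    fun l => path_dens_congr_off hh' (hz l) (fun hs => hzN l ⟨hs, trivial⟩) hqm
  unfold pathIntegrand
  congr 1
  · congr 1
    funext l
    simp only [visit, (hpd l).1]
  · exact Finset.prod_congr rfl fun l _ => (hpd l).2

/-- Triangle inequality: if (t', x') is within causal reach of a point to which (t, x) is spacelike,
the remaining spatial distance exceeds |t| - |t'|. On a straight segment r is the remaining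
difference of heights. -/
lemma Spacelike.of_inside {t t' x x' : ℝ} {r : ℝ} (h : Spacelike t x)
    (h' : ¬ Spacelike t' x') (hr : r + |t'| ≤ |t|) : ∀ m : ℤ, r < |x - x' + 2 * m| := by
  unfold Spacelike at h'
  push Not at h'
  obtain ⟨a, ha⟩ := h'
  intro m
  have h1 := h (m + a)
  have h2 : |x + 2 * ((m + a : ℤ) : ℝ)| ≤ |x - x' + 2 * m| + |x' + 2 * a| := by
    refine le_trans (le_of_eq ?_) (abs_add_le _ _)
    congr 1
    push_cast; ring
  linarith

/-- Locality: an insertion may be moved across a fold at whose tip a spacelike insertion sits. -/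
theorem pathIntegral_move_across {k w : ℕ} {b : ℝ} {α : Fin k → ℂ} {v : Fin k → ℝ × ℝ}
    (H : Screened b α v w) {e e' : Fin k → ℕ} {m : ℕ} (he : ∀ j, e j ≤ m) (he' : ∀ j, e' j ≤ m)
    {q : ℕ} (hqm : q + 2 ≤ m) {i i' : Fin k} {h : ℕ → ℝ} (hq : h q = (v i).1)
    (hq1 : h (q + 1) = (v i').1) (hq2 : h (q + 2) = (v i).1)
    (hei : e i = q) (hei' : e' i = q + 2)
    (hee : ∀ j, j ≠ i → e j = e' j) (heq : ∀ j, j ≠ i' → e j ≠ q + 1)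
    (hsp : Spacelike ((v i).1 - (v i').1) ((v i).2 - (v i').2)) :
    pathIntegral b α v w e m h = pathIntegral b α v w e' m h := by
  -- Only the part of the fold spacelike to the insertion at the tip can cancel: the reflected point
  -- must not notice that insertion.
  set N : Set (ℝ × ℝ) := (Set.Ioo (q : ℝ) (q + 2) ×ˢ Set.univ) ∩
    {z | Spacelike ((v i').1 - path m h z.1) ((v i').2 - z.2)} with hN
  have hNm : MeasurableSet N := by
    have hc := continuous_path m h
    exact (measurableSet_Ioo.prod MeasurableSet.univ).inter
      (measurableSet_spacelike (by fun_prop) (by fun_prop))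
  have hh : h (q + 2) = h q := by rw [hq2, hq]
  have hdist : ∀ s, (q : ℝ) ≤ s → s ≤ q + 2 →
      (v i').1 - path m h s = (h (q + 1) - h q) * |s - (q + 1)| := by
    intro s h0 h1
    rw [path_fold hqm hh h0 h1, hq1]; ring
  have key : ∀ e : Fin k → ℕ, (∀ j, e j ≤ m) → (∀ j, j ≠ i' → e j ≠ q + 1) →
      pathIntegral b α v w e m h =
      ∫ z in {z | ∀ l, z l ∉ N}, pathIntegrand b α v e m (fun _ : Fin w => path m h)
        (fun _ => dens m h) z ∂screeningMeasure w := by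
    intro e he heq
    refine integral_eq_setIntegral_of_fold hqm (path_fold_symm hqm hh) (dens_fold_symm hqm hh)
      (H.integrable_path he h) hNm (fun z hz => hz.1.1) (fun z hz => ⟨⟨⟨?_, ?_⟩, trivial⟩, ?_⟩)
      (fun j z hz => ?_) (fun z hz z' hz' a c hlt => ?_)
    · simp only [paramFlip]; linarith [hz.1.1.2]
    · simp only [paramFlip]; linarith [hz.1.1.1]
    · simp only [paramFlip, Set.mem_ofPred_eq]
      rw [path_fold_symm hqm hh _ hz.1.1.1 hz.1.1.2]
      exact hz.2
    · by_cases hj : j = i'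
      · subst hj
        exact .inr (.inr hz.2)
      · have := heq j hj
        omega
    · have hns : ¬ Spacelike ((v i').1 - path m h z'.1) ((v i').2 - z'.2) := fun hs =>
        hz' ⟨⟨⟨a, c⟩, trivial⟩, hs⟩
      have e1 := hdist z.1 hz.1.1.1.le hz.1.1.2.le
      have e2 := hdist z'.1 a.le c.le
      -- z' lies between z and the tip and height is linear in the distance to the tip, so the
      -- differences of heights add up exactly.
      have hr : |path m h z'.1 - path m h z.1| + |(v i').1 - path m h z'.1|
          ≤ |(v i').1 - path m h z.1| := by
        rw [show path m h z'.1 - path m h z.1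
          = ((v i').1 - path m h z.1) - ((v i').1 - path m h z'.1) by ring, e1, e2, ← mul_sub,
          abs_mul, abs_mul, abs_mul, abs_abs, abs_abs, abs_of_pos (sub_pos.2 hlt)]
        exact le_of_eq (by ring)
      have := Spacelike.of_inside hz.2 hns hr
      intro n
      have := this n
      rwa [show (v i').2 - z.2 - ((v i').2 - z'.2) = z'.2 - z.2 by ring] at this
  have heq' : ∀ j, j ≠ i' → e' j ≠ q + 1 := by
    intro j hj
    by_cases hji : j = i
    · rw [hji, hei']; omega
    · rw [← hee j hji]; exact heq j hj
  rw [key e he heq, key e' he' heq']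
  have hset : MeasurableSet {z : Fin w → ℝ × ℝ | ∀ l, z l ∉ N} := by
    simp only [Set.ofPred_forall]
    exact MeasurableSet.iInter fun l => (hNm.preimage (measurable_pi_apply l)).compl
  refine setIntegral_congr_ae hset ?_
  filter_upwards [ae_screeningMeasure_of_ae (w := w) ae_ne_natCast] with z hz hzN
  unfold pathIntegrand
  congr 1
  refine weight_congr (fun j l => ?_) (fun _ _ _ => rfl)
  by_cases hj : j = i
  · subst hj
    refine orderedGreen_congr rfl rfl rfl rfl ?_
    have him : (mark e v j).time.im = (v j).1 := by simp [mark]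
    have him' : (visit m (path m h) (z l)).time.im = path m h (z l).1 := by simp [visit]
    rw [him, him']
    simp only [visit, mark, hei, hei']
    have hne := hz l q
    have hne2 := hz l (q + 2)
    push_cast at hne2 ⊢
    by_cases h0 : (q : ℝ) < (z l).1
    · by_cases h1 : (z l).1 < q + 2
      -- A point left on the fold is causally related to the tip. Its height lies between those of
      -- the base and the tip, which are spacelike, so it is spacelike to the insertion at the base;
      -- hence moving that insertion from q to q + 2 is invisible to it.
      · refine .inr (.inr ?_)
        have hns : ¬ Spacelike ((v i').1 - path m h (z l).1) ((v i').2 - (z l).2) := fun hs =>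
          hzN l ⟨⟨⟨h0, h1⟩, trivial⟩, hs⟩
        have e1 := hdist _ h0.le h1.le
        have hθ : |(z l).1 - (q + 1)| ≤ 1 := by rw [abs_le]; constructor <;> linarith
        have hr : |(v j).1 - path m h (z l).1| + |(v i').1 - path m h (z l).1|
            ≤ |(v i').1 - (v j).1| := by
          rw [show (v j).1 - path m h (z l).1
            = -((h (q + 1) - h q) * (1 - |(z l).1 - (q + 1)|)) by
              rw [path_fold hqm hh h0.le h1.le, hq]; ring, e1, ← hq, ← hq1, abs_neg,
            abs_mul, abs_mul, abs_abs, abs_of_nonneg (sub_nonneg.2 hθ)]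
          exact le_of_eq (by ring)
        have := Spacelike.of_inside hsp.sub_comm hns hr
        refine Spacelike.sub_comm fun n => ?_
        rw [abs_sub_comm]
        have := this n
        rwa [show (v i').2 - (v j).2 - ((v i').2 - (z l).2) = (z l).2 - (v j).2 by ring] at this
      · left
        have h2 : (q : ℝ) + 2 < (z l).1 := lt_of_le_of_ne (not_lt.1 h1) (Ne.symm hne2)
        exact ⟨fun _ => by linarith, fun _ => by linarith⟩
    · left
      have h2 : (z l).1 < q := lt_of_le_of_ne (not_lt.1 h0) hne
      exact ⟨fun _ => by linarith, fun _ => by linarith⟩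
  · have : mark e v j = mark e' v j := by simp only [mark, hee j hj]
    rw [this]

/-! ### Reparametrization and insertion of vertices -/

lemma lintegral_pi_prod {n : ℕ} {E : Type*} [MeasurableSpace E] (μ : Fin n → Measure E)
    [∀ i, SigmaFinite (μ i)] {f : Fin n → E → ENNReal} (hf : ∀ i, Measurable (f i)) :
    ∫⁻ z, ∏ i, f i (z i) ∂Measure.pi μ = ∏ i, ∫⁻ x, f i x ∂μ i := by
  induction n with
  | zero => simp
  | succ n ih =>
    have hmp := (measurePreserving_piFinSuccAbove μ 0).symm
    have hm : Measurable fun z : Fin (n + 1) → E => ∏ i, f i (z i) :=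
      Finset.measurable_fun_prod _ fun i _ => (hf i).comp (measurable_pi_apply i)
    rw [← hmp.lintegral_comp hm, Fin.prod_univ_succ]
    simp only [MeasurableEquiv.piFinSuccAbove_symm_apply, Fin.insertNthEquiv,
        Fin.prod_univ_succ, Fin.insertNth_zero, Equiv.coe_fn_mk, Fin.cons_succ, Fin.cons_zero,
        Fin.zero_succAbove, cast_eq]
    have hm' : Measurable fun z : Fin n → E => ∏ i, f i.succ (z i) :=
      Finset.measurable_fun_prod _ fun i _ => (hf i.succ).comp (measurable_pi_apply i)
    rw [← ih (fun i => μ i.succ) (fun i => hf i.succ), lintegral_prod_mul (hf 0).aemeasurable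
      hm'.aemeasurable]

lemma pi_withDensity_prod {n : ℕ} {E : Type*} [MeasurableSpace E] (μ : Measure E) [SigmaFinite μ]
    {f : E → ENNReal} (hf : Measurable f) [SigmaFinite (μ.withDensity f)] :
    (Measure.pi fun _ : Fin n => μ).withDensity (fun z => ∏ i, f (z i))
      = Measure.pi fun _ => μ.withDensity f := by
  refine (Measure.pi_eq fun s hs => ?_).symm
  rw [withDensity_apply _ (MeasurableSet.univ_pi hs), Measure.restrict_pi_pi,
    lintegral_pi_prod _ fun _ => hf]
  exact Finset.prod_congr rfl fun i _ => (withDensity_apply _ (hs i)).symm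

/-- The piecewise linear map that traverses `[q, q + 1]` in two steps, divided in the ratio `c`. -/
noncomputable def slow (q : ℕ) (c s : ℝ) : ℝ :=
  if s ≤ q then s else if s ≤ q + 1 then q + c * (s - q)
  else if s ≤ q + 2 then q + c + (1 - c) * (s - (q + 1)) else s - 1

/-- The derivative of `slow q c`. -/
noncomputable def slowDeriv (q : ℕ) (c s : ℝ) : ℝ :=
  if s ≤ q then 1 else if s ≤ q + 1 then c else if s ≤ q + 2 then 1 - c else 1

lemma measurable_slow (q : ℕ) (c : ℝ) : Measurable (slow q c) := by
  unfold slow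
  exact Measurable.ite measurableSet_Iic measurable_id (Measurable.ite measurableSet_Iic
    (by fun_prop) (Measurable.ite measurableSet_Iic (by fun_prop) (by fun_prop)))

lemma measurable_slowDeriv (q : ℕ) (c : ℝ) : Measurable (slowDeriv q c) := by
  unfold slowDeriv
  exact Measurable.ite measurableSet_Iic measurable_const (Measurable.ite measurableSet_Iic
    measurable_const (Measurable.ite measurableSet_Iic measurable_const measurable_const))

lemma slowDeriv_nonneg (q : ℕ) {c : ℝ} (h0 : 0 ≤ c) (h1 : c ≤ 1) (s : ℝ) :
    0 ≤ slowDeriv q c s := by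
  unfold slowDeriv
  split_ifs <;> linarith

/-- Change of variables for one affine piece. Half-open intervals make the collapsed piece c = 0 fit
in, with both sides zero. -/
lemma mul_volume_affine_preimage {c : ℝ} (hc : 0 ≤ c) (a p : ℝ) (A : Set ℝ) :
    ENNReal.ofReal c * volume ((fun s => p + c * (s - a)) ⁻¹' A ∩ Set.Ioc a (a + 1))
      = volume (A ∩ Set.Ioc p (p + c)) := by
  rcases hc.eq_or_lt with rfl | hc
  · simp
  · have : (fun s => p + c * (s - a)) ⁻¹' A ∩ Set.Ioc a (a + 1)
        = (fun s => c * s) ⁻¹' ((fun s => (p - c * a) + s) ⁻¹' (A ∩ Set.Ioc p (p + c))) := by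
      ext s
      simp only [Set.mem_inter_iff, Set.mem_preimage, Set.mem_Ioc]
      rw [show p - c * a + c * s = p + c * (s - a) by ring]
      refine and_congr_right fun _ => and_congr ?_ ?_
      · constructor
        · intro h; nlinarith
        · intro h
          have : 0 < c * (s - a) := by linarith
          linarith [(mul_pos_iff_of_pos_left hc).1 this]
      · constructor
        · intro h; nlinarith
        · intro h
          have : 0 ≤ c * (a + 1 - s) := by linarith
          linarith [(mul_nonneg_iff_of_pos_left hc).1 this]
    rw [this, Real.volume_preimage_mul_left hc.ne', measure_preimage_add, ← mul_assoc,
      ← ENNReal.ofReal_mul hc.le, abs_of_pos (inv_pos.2 hc), mul_inv_cancel₀ hc.ne',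
      ENNReal.ofReal_one, one_mul]

/-- `slow` is affine on four pieces with slope `slowDeriv`, and their images tile the line. For c =
0 or c = 1 one piece is collapsed to a point and has density zero. -/
lemma measurePreserving_slow (q : ℕ) {c : ℝ} (h0 : 0 ≤ c) (h1 : c ≤ 1) :
    MeasurePreserving (slow q c)
      ((volume : Measure ℝ).withDensity fun s => ENNReal.ofReal (slowDeriv q c s)) volume := by
  refine ⟨measurable_slow q c, ?_⟩
  ext A hA
  have hpre := measurable_slow q c hA
  rw [Measure.map_apply (measurable_slow q c) hA, withDensity_apply _ hpre]
  set B := slow q c ⁻¹' A with hB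
  have split4 : ∀ (a b d : ℝ), a ≤ b → b ≤ d → ∀ (C : Set ℝ), MeasurableSet C →
      ∀ f : ℝ → ENNReal, ∫⁻ s in C, f s = (∫⁻ s in C ∩ Set.Iic a, f s)
        + (∫⁻ s in C ∩ Set.Ioc a b, f s) + (∫⁻ s in C ∩ Set.Ioc b d, f s)
        + ∫⁻ s in C ∩ Set.Ioi d, f s := by
    intro a b d hab hbd C hC f
    have hu : C = (((C ∩ Set.Iic a) ∪ (C ∩ Set.Ioc a b)) ∪ (C ∩ Set.Ioc b d)) ∪
        (C ∩ Set.Ioi d) := by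
      rw [← Set.inter_union_distrib_left, ← Set.inter_union_distrib_left,
        ← Set.inter_union_distrib_left, Set.Iic_union_Ioc_eq_Iic hab,
        Set.Iic_union_Ioc_eq_Iic hbd, Set.Iic_union_Ioi, Set.inter_univ]
    conv_lhs => rw [hu]
    rw [lintegral_union (hC.inter measurableSet_Ioi), lintegral_union (hC.inter measurableSet_Ioc),
      lintegral_union (hC.inter measurableSet_Ioc)]
    · rw [Set.disjoint_left]
      rintro s ⟨_, hs⟩ ⟨_, hs'⟩
      exact absurd hs (not_le.2 hs'.1)
    · rw [Set.disjoint_left]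
      rintro s (⟨_, hs⟩ | ⟨_, hs⟩) ⟨_, hs'⟩
      · exact absurd (hs.out.trans hab) (not_le.2 hs'.1)
      · exact absurd hs.2 (not_le.2 hs'.1)
    · rw [Set.disjoint_left]
      rintro s ((⟨_, hs⟩ | ⟨_, hs⟩) | ⟨_, hs⟩) ⟨_, hs'⟩
      · exact absurd (hs.out.trans (hab.trans hbd)) (not_le.2 hs')
      · exact absurd (hs.2.trans hbd) (not_le.2 hs')
      · exact absurd hs.2 (not_le.2 hs')
  have hconst : ∀ {S : Set ℝ} (hS : MeasurableSet S) {y : ℝ}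
      (_ : ∀ s ∈ S, slowDeriv q c s = y),
      ∫⁻ s in B ∩ S, ENNReal.ofReal (slowDeriv q c s) = ENNReal.ofReal y * volume (B ∩ S) := by
    intro S hS y hy
    rw [setLIntegral_congr_fun (g := fun _ => ENNReal.ofReal y) (hpre.inter hS)
      (fun s hs => by simp only [hy s hs.2]), setLIntegral_const]
  have hvol : volume A = volume (A ∩ Set.Iic (q : ℝ)) + volume (A ∩ Set.Ioc (q : ℝ) (q + c))
      + volume (A ∩ Set.Ioc ((q : ℝ) + c) (q + 1)) + volume (A ∩ Set.Ioi ((q : ℝ) + 1)) := by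
    have := split4 q (q + c) (q + 1) (by linarith) (by linarith) A hA 1
    simpa using this
  rw [split4 q (q + 1) (q + 2) (by linarith) (by linarith) B hpre, hvol]
  congr 1
  · congr 1
    · congr 1
      · rw [hconst measurableSet_Iic (y := 1) (fun s hs => by
          unfold slowDeriv; rw [if_pos hs.out]), ENNReal.ofReal_one, one_mul]
        congr 1
        ext s
        simp only [hB, Set.mem_inter_iff, Set.mem_preimage, Set.mem_Iic]
        refine and_congr_left fun hs => ?_
        unfold slow; rw [if_pos hs]
      · rw [hconst measurableSet_Ioc (y := c) (fun s hs => by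
          unfold slowDeriv; rw [if_neg (not_le.2 hs.1), if_pos hs.2]),
          ← mul_volume_affine_preimage h0 q q A]
        congr 2
        ext s
        simp only [hB, Set.mem_inter_iff, Set.mem_preimage]
        refine and_congr_left fun hs => ?_
        unfold slow; rw [if_neg (not_le.2 hs.1), if_pos hs.2]
    · rw [hconst measurableSet_Ioc (y := 1 - c) (fun s hs => by
          unfold slowDeriv
          rw [if_neg (not_le.2 (by linarith [hs.1])), if_neg (not_le.2 hs.1), if_pos hs.2])]
      have := mul_volume_affine_preimage (c := 1 - c) (by linarith) ((q : ℝ) + 1) (q + c) A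
      rw [show (q : ℝ) + c + (1 - c) = q + 1 by ring,
        show (q : ℝ) + 1 + 1 = q + 2 by ring] at this
      rw [← this]
      congr 2
      ext s
      simp only [hB, Set.mem_inter_iff, Set.mem_preimage]
      refine and_congr_left fun hs => ?_
      unfold slow
      rw [if_neg (not_le.2 (by linarith [hs.1])), if_neg (not_le.2 hs.1), if_pos hs.2]
  · rw [hconst measurableSet_Ioi (y := 1) (fun s hs => by
          have : (q : ℝ) + 2 < s := hs
          unfold slowDeriv
          rw [if_neg (not_le.2 (by linarith)), if_neg (not_le.2 (by linarith)),
            if_neg (not_le.2 this)]), ENNReal.ofReal_one, one_mul]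
    have : B ∩ Set.Ioi ((q : ℝ) + 2) = (fun s => s - 1) ⁻¹' (A ∩ Set.Ioi ((q : ℝ) + 1)) := by
      ext s
      simp only [hB, Set.mem_inter_iff, Set.mem_preimage, Set.mem_Ioi]
      rw [show (q : ℝ) + 1 < s - 1 ↔ (q : ℝ) + 2 < s by
        constructor <;> intro h <;> linarith]
      refine and_congr_left fun hs => ?_
      unfold slow
      rw [if_neg (not_le.2 (by linarith)), if_neg (not_le.2 (by linarith)),
            if_neg (not_le.2 hs)]
    rw [this]
    simp_rw [sub_eq_add_neg]
    exact measure_preimage_add_right _ _ _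

lemma measurePreserving_slow_pi (w q : ℕ) {c : ℝ} (h0 : 0 ≤ c) (h1 : c ≤ 1) :
    MeasurePreserving (fun (z : Fin w → ℝ × ℝ) l => (slow q c (z l).1, (z l).2))
      ((screeningMeasure w).withDensity fun z => ∏ l, ENNReal.ofReal (slowDeriv q c (z l).1))
      (screeningMeasure w) := by
  have hm : Measurable fun s => ENNReal.ofReal (slowDeriv q c s) :=
    (measurable_slowDeriv q c).ennreal_ofReal
  have : SigmaFinite ((volume : Measure ℝ).withDensity
      fun s => ENNReal.ofReal (slowDeriv q c s)) := SigmaFinite.withDensity_ofReal _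
  have h2 : (volume.withDensity fun s => ENNReal.ofReal (slowDeriv q c s)).prod
      ((volume : Measure ℝ).restrict (Set.Icc (-1) 1))
      = strip.withDensity fun z => ENNReal.ofReal (slowDeriv q c z.1) := prod_withDensity_left hm
  have : SigmaFinite (strip.withDensity fun z => ENNReal.ofReal (slowDeriv q c z.1)) := by
    rw [← h2]; infer_instance
  have h3 := (measurePreserving_slow q h0 h1).prod
    (MeasurePreserving.id ((volume : Measure ℝ).restrict (Set.Icc (-1) 1)))
  rw [h2] at h3
  have h4 := measurePreserving_pi (fun _ : Fin w => strip.withDensity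
    fun z => ENNReal.ofReal (slowDeriv q c z.1)) (fun _ => strip) (fun _ => h3)
  rw [← pi_withDensity_prod strip (f := fun z => ENNReal.ofReal (slowDeriv q c z.1))
    (hm.comp measurable_fst)] at h4
  exact h4

/-- Change of variables for the reparametrization `slow`. -/
lemma integral_slow (w q : ℕ) {c : ℝ} (h0 : 0 ≤ c) (h1 : c ≤ 1) {G : (Fin w → ℝ × ℝ) → ℂ}
    (hG : Measurable G) :
    ∫ z, (∏ l, (slowDeriv q c (z l).1 : ℂ)) * G (fun l => (slow q c (z l).1, (z l).2))
      ∂screeningMeasure w = ∫ z, G z ∂screeningMeasure w := by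
  have hmp := measurePreserving_slow_pi w q h0 h1
  have hω : Measurable fun z : Fin w → ℝ × ℝ => ∏ l, ENNReal.ofReal (slowDeriv q c (z l).1) :=
    Finset.measurable_fun_prod _ fun l _ => ((measurable_slowDeriv q c).comp
      (measurable_fst.comp (measurable_pi_apply l))).ennreal_ofReal
  conv_rhs => rw [← hmp.map_eq]
  rw [integral_map hmp.measurable.aemeasurable hG.aestronglyMeasurable,
    integral_withDensity_eq_integral_toReal_smul hω (Filter.Eventually.of_forall fun z =>
      ENNReal.prod_lt_top fun l _ => ENNReal.ofReal_lt_top)]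
  refine integral_congr_ae (Filter.Eventually.of_forall fun z => ?_)
  simp only [ENNReal.toReal_prod, ENNReal.toReal_ofReal (slowDeriv_nonneg q h0 h1 _),
    Complex.real_smul, Complex.ofReal_prod]

lemma slow_of_le {q : ℕ} {c s : ℝ} (h : s ≤ q) : slow q c s = s ∧ slowDeriv q c s = 1 := by
  unfold slow slowDeriv
  rw [if_pos h, if_pos h]
  exact ⟨rfl, rfl⟩

lemma slow_of_first {q : ℕ} {c s : ℝ} (h : (q : ℝ) < s) (h' : s ≤ q + 1) :
    slow q c s = q + c * (s - q) ∧ slowDeriv q c s = c := by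
  unfold slow slowDeriv
  rw [if_neg (not_le.2 h), if_neg (not_le.2 h), if_pos h', if_pos h']
  exact ⟨rfl, rfl⟩

lemma slow_of_second {q : ℕ} {c s : ℝ} (h : (q : ℝ) + 1 < s) (h' : s ≤ q + 2) :
    slow q c s = q + c + (1 - c) * (s - (q + 1)) ∧ slowDeriv q c s = 1 - c := by
  unfold slow slowDeriv
  have h0 : (q : ℝ) < s := by linarith
  rw [if_neg (not_le.2 h0), if_neg (not_le.2 h0), if_neg (not_le.2 h), if_neg (not_le.2 h),
    if_pos h', if_pos h']
  exact ⟨rfl, rfl⟩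

lemma slow_of_gt {q : ℕ} {c s : ℝ} (h : (q : ℝ) + 2 < s) :
    slow q c s = s - 1 ∧ slowDeriv q c s = 1 := by
  unfold slow slowDeriv
  have h0 : (q : ℝ) < s := by linarith
  have h1 : (q : ℝ) + 1 < s := by linarith
  rw [if_neg (not_le.2 h0), if_neg (not_le.2 h0), if_neg (not_le.2 h1), if_neg (not_le.2 h1),
    if_neg (not_le.2 h), if_neg (not_le.2 h)]
  exact ⟨rfl, rfl⟩

/-- Insertion of the vertex `d` after the vertex `q`. -/
def insertVertex (q : ℕ) (d : ℝ) (h : ℕ → ℝ) (j : ℕ) : ℝ :=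
  if j ≤ q then h j else if j = q + 1 then d else h (j - 1)

/-- The contour with the extra vertex is the old contour run through `slow`, and its speed follows
by the chain rule. Besides points of a segment, c = 0 allows q = m, the duplication of the last
vertex. -/
lemma insertVertex_slow {m q : ℕ} (hq : q ≤ m) {c : ℝ} (c0 : 0 ≤ c) (c1 : c ≤ 1) (hqm : c = 0 ∨ q < m)
    (h : ℕ → ℝ) {s : ℝ} (hs : ∀ j : ℕ, s ≠ j) :
    path (m + 1) (insertVertex q (h q + c * (h (q + 1) - h q)) h) s = path m h (slow q c s) ∧
    dens (m + 1) (insertVertex q (h q + c * (h (q + 1) - h q)) h) s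
      = slowDeriv q c s * dens m h (slow q c s) ∧
    rpart (m + 1) s = rpart m (slow q c s) := by
  set h' := insertVertex q (h q + c * (h (q + 1) - h q)) h with hh'
  have v1 : ∀ j ≤ q, h' j = h j := fun j hj => by rw [hh', insertVertex, if_pos hj]
  have v2 : h' (q + 1) = h q + c * (h (q + 1) - h q) := by
    rw [hh', insertVertex, if_neg (by omega), if_pos rfl]
  have v3 : ∀ j, q + 1 < j → h' j = h (j - 1) := fun j hj => by
    rw [hh', insertVertex, if_neg (by omega), if_neg (by omega)]
  have hq' : (q : ℝ) ≤ m := by exact_mod_cast hq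
  have hq0 : (0 : ℝ) ≤ q := q.cast_nonneg
  rcases param_cases (m + 1) hs with hc | hc | ⟨j, hj, hj0, hj1⟩
  · obtain ⟨e1, e2⟩ := slow_of_le (c := c) (show s ≤ q by linarith)
    rw [e1, e2, path_of_le_zero hc.le, path_of_le_zero hc.le, dens_of_lt_zero hc,
      dens_of_lt_zero hc, rpart_of_le_zero hc.le, rpart_of_le_zero hc.le]
    exact ⟨v1 0 (Nat.zero_le _), by simp, rfl⟩
  · push_cast at hc
    -- If s > m + 1 still lies in the second step, then q = m, hence c = 0, and the formula of that
    -- step already reads s - 1.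
    have e12 : slow q c s = s - 1 ∧ slowDeriv q c s = 1 := by
      by_cases h2 : s ≤ q + 2
      · have hc0 : c = 0 := by
          rcases hqm with h | h
          · exact h
          · have : ((q : ℝ) + 1) ≤ m := by exact_mod_cast h
            linarith
        obtain ⟨e1, e2⟩ := slow_of_second (c := c) (show (q : ℝ) + 1 < s by linarith) h2
        rw [e1, e2, hc0]
        exact ⟨by ring, by ring⟩
      · exact slow_of_gt (not_le.1 h2)
    rw [e12.1, e12.2, path_of_ge (m := m + 1) (by push_cast; linarith), path_of_ge (by linarith),
      dens_of_gt (m := m + 1) (by push_cast; linarith), dens_of_gt (by linarith),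
      rpart_of_ge (m := m + 1) (by push_cast; linarith), rpart_of_ge (by linarith)]
    refine ⟨?_, by simp, by push_cast; ring⟩
    rcases hq.lt_or_eq with h | rfl
    · rw [v3 _ (by omega)]; rfl
    · rw [v2, hqm.resolve_right (lt_irrefl _)]; ring
  · have hjm : ((j : ℝ) + 1) ≤ m + 1 := by exact_mod_cast hj
    have hj00 : (0 : ℝ) ≤ j := j.cast_nonneg
    rw [path_of_mem hj hj0.le hj1.le, dens_of_mem hj hj0 hj1,
      rpart_of_mem (m := m + 1) (by linarith) (by push_cast; linarith)]
    rcases lt_trichotomy j q with hjq | rfl | hjq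
    · have hjq' : ((j : ℝ) + 1) ≤ q := by exact_mod_cast hjq
      obtain ⟨e1, e2⟩ := slow_of_le (c := c) (show s ≤ q by linarith)
      rw [e1, e2, path_of_mem (j := j) (by omega) hj0.le hj1.le,
        dens_of_mem (j := j) (by omega) hj0 hj1, rpart_of_mem (by linarith) (by linarith),
        v1 j (by omega), v1 (j + 1) (by omega)]
      exact ⟨rfl, by simp, rfl⟩
    · obtain ⟨e1, e2⟩ := slow_of_first (c := c) hj0 hj1.le
      rw [e1, e2, v1 j le_rfl, v2]
      rcases eq_or_ne c 0 with rfl | hc0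
      · simp only [zero_mul, add_zero]
        rw [path_natCast hq, rpart_of_mem hq0 hq']
        exact ⟨by ring, by simp, rfl⟩
      · have hqm := hqm.resolve_left hc0
        have hqm' : ((j : ℝ) + 1) ≤ m := by exact_mod_cast hqm
        have hcp : 0 < c := lt_of_le_of_ne c0 hc0.symm
        have a1 : 0 < c * (s - j) := mul_pos hcp (by linarith)
        have a2 : c * (s - j) < 1 := by nlinarith
        rw [path_of_mem hqm (by linarith) (by linarith),
          dens_of_mem hqm (by linarith) (by linarith),
          rpart_of_mem (by linarith) (by linarith)]
        exact ⟨by ring, by push_cast; ring, rfl⟩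
    · rcases eq_or_lt_of_le (Nat.succ_le_of_lt hjq) with rfl | hjq
      · simp only [Nat.succ_eq_add_one] at *
        push_cast at hj0 hj1 hjm
        have hlt : q < m := by omega
        have hqm' : ((q : ℝ) + 1) ≤ m := by exact_mod_cast hlt
        obtain ⟨e1, e2⟩ := slow_of_second (c := c) hj0 (by linarith)
        have v3' : h' (q + 1 + 1) = h (q + 1) := v3 _ (by omega)
        rw [e1, e2, v2, v3']
        rcases eq_or_ne c 1 with rfl | hc1
        · rw [show (q : ℝ) + 1 + (1 - 1) * (s - (q + 1)) = ((q + 1 : ℕ) : ℝ) by push_cast; ring,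
            path_natCast hlt, rpart_of_mem (by positivity) (by push_cast; linarith)]
          exact ⟨by ring, by simp, rfl⟩
        · have hcp : 0 < 1 - c := sub_pos.2 (lt_of_le_of_ne c1 hc1)
          have a1 : 0 < (1 - c) * (s - (q + 1)) := mul_pos hcp (by linarith)
          have a2 : (1 - c) * (s - (q + 1)) < 1 - c := by nlinarith
          rw [path_of_mem hlt (by linarith) (by linarith),
            dens_of_mem hlt (by linarith) (by linarith),
            rpart_of_mem (by linarith) (by linarith)]
          exact ⟨by push_cast; ring, by push_cast; ring, rfl⟩
      · obtain ⟨i, rfl⟩ : ∃ i, j = i + 1 := ⟨j - 1, by omega⟩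
        push_cast at hj0 hj1 hjm
        have hiq : ((q : ℝ) + 1) ≤ i := by exact_mod_cast (show q + 1 ≤ i by omega)
        obtain ⟨e1, e2⟩ := slow_of_gt (c := c) (show (q : ℝ) + 2 < s by linarith)
        rw [e1, e2, path_of_mem (j := i) (by omega) (by linarith) (by linarith),
          dens_of_mem (j := i) (by omega) (by linarith) (by linarith),
          rpart_of_mem (by linarith) (by linarith), v3 _ (by omega), v3 _ (by omega)]
        simp only [Nat.add_sub_cancel]
        exact ⟨by push_cast; ring, by simp, trivial⟩

/-- Order is lost only on collapsed steps, where the density vanishes; hence time ordering survives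
wherever the integrand does. -/
lemma slow_lt_slow {q : ℕ} {c : ℝ} (c0 : 0 ≤ c) (c1 : c ≤ 1) {s s' : ℝ} (hss : s < s')
    (hs : slowDeriv q c s ≠ 0) (hs' : slowDeriv q c s' ≠ 0) : slow q c s < slow q c s' := by
  have cases4 : ∀ s, slowDeriv q c s ≠ 0 → (s ≤ q ∧ slow q c s = s) ∨
      ((q : ℝ) < s ∧ s ≤ q + 1 ∧ slow q c s = q + c * (s - q) ∧ 0 < c) ∨
      ((q : ℝ) + 1 < s ∧ s ≤ q + 2 ∧ slow q c s = q + 1 - (1 - c) * (q + 2 - s) ∧ 0 < 1 - c) ∨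
      ((q : ℝ) + 2 < s ∧ slow q c s = s - 1) := by
    intro s hs
    rcases le_or_gt s q with h | h
    · exact .inl ⟨h, (slow_of_le h).1⟩
    rcases le_or_gt s (q + 1) with h1 | h1
    · have := slow_of_first (c := c) h h1
      exact .inr (.inl ⟨h, h1, this.1, lt_of_le_of_ne c0 (by rw [← this.2]; exact hs.symm)⟩)
    rcases le_or_gt s (q + 2) with h2 | h2
    · have := slow_of_second (c := c) h1 h2
      refine .inr (.inr (.inl ⟨h1, h2, by rw [this.1]; ring,
        lt_of_le_of_ne (by linarith) (by rw [← this.2]; exact hs.symm)⟩))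
    · exact .inr (.inr (.inr ⟨h2, (slow_of_gt h2).1⟩))
  rcases cases4 s hs with ⟨a, e⟩ | ⟨a, a', e, p⟩ | ⟨a, a', e, p⟩ | ⟨a, e⟩ <;>
  rcases cases4 s' hs' with ⟨a2, e2⟩ | ⟨a2, a2', e2, p2⟩ | ⟨a2, a2', e2, p2⟩ | ⟨a2, e2⟩ <;>
  rw [e, e2] <;> first | linarith | nlinarith

/-- A vertex may be inserted on a segment, or at an end point. -/
theorem pathIntegral_insert {k w : ℕ} {b : ℝ} {α : Fin k → ℂ} {v : Fin k → ℝ × ℝ}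
    {e e' : Fin k → ℕ} {m q : ℕ} (hq : q ≤ m) {c : ℝ} (c0 : 0 ≤ c) (c1 : c ≤ 1)
    (hqm : c = 0 ∨ q < m) (h : ℕ → ℝ)
    (hee : ∀ j, (e j ≤ q ∧ e' j = e j) ∨ (q < e j ∧ e' j = e j + 1) ∨
      (c = 0 ∧ e j = q ∧ e' j = q + 1)) :
    pathIntegral b α v w e' (m + 1) (insertVertex q (h q + c * (h (q + 1) - h q)) h)
      = pathIntegral b α v w e m h := by
  set h' := insertVertex q (h q + c * (h (q + 1) - h q)) h with hh'
  unfold pathIntegral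
  rw [← integral_slow w q c0 c1 (measurable_pathIntegrand b α v e m
    (fun _ : Fin w => (continuous_path m h).measurable) (fun _ => measurable_dens m h))]
  refine integral_congr_ae ?_
  filter_upwards [ae_screeningMeasure_of_ae (w := w) ae_ne_natCast] with z hz
  have hf := fun l => insertVertex_slow hq c0 c1 hqm h (hz l)
  rw [← hh'] at hf
  unfold pathIntegrand
  have hprod : ∏ l, dens (m + 1) h' (z l).1
      = (∏ l, (slowDeriv q c (z l).1 : ℂ)) * ∏ l, dens m h (slow q c (z l).1) := by
    rw [← Finset.prod_mul_distrib]
    exact Finset.prod_congr rfl fun l _ => (hf l).2.1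
  rw [hprod, mul_left_comm]
  -- A point on a collapsed step gives zero on both sides; elsewhere `slow` preserves the order.
  by_cases hzero : ∃ l, slowDeriv q c (z l).1 = 0
  · obtain ⟨l, hl⟩ := hzero
    rw [Finset.prod_eq_zero (Finset.mem_univ l) (by rw [hl, Complex.ofReal_zero]), zero_mul,
      zero_mul]
  push Not at hzero
  congr 2
  have ht : ∀ l, (visit (m + 1) (path (m + 1) h') (z l)).time
      = (visit m (path m h) (slow q c (z l).1, (z l).2)).time := by
    intro l
    simp only [visit, (hf l).1, (hf l).2.2]
  refine weight_congr (fun j l => ?_) (fun l l' _ => ?_)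
  · refine orderedGreen_congr rfl (ht l) rfl rfl (.inl ?_)
    simp only [visit, mark]
    have hne := hz l
    have h0 := hzero l
    rcases hee j with ⟨a, a'⟩ | ⟨a, a'⟩ | ⟨a, a', a''⟩
    · rw [a']
      have ar : (e j : ℝ) ≤ q := by exact_mod_cast a
      have hle : slow q c (e j) = e j := (slow_of_le ar).1
      have hd : slowDeriv q c (e j) ≠ 0 := by rw [(slow_of_le ar).2]; exact one_ne_zero
      rcases lt_or_gt_of_ne (hne (e j)) with hlt | hlt
      · have := slow_lt_slow c0 c1 hlt h0 hd
        rw [hle] at this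
        exact ⟨fun _ => this.le, fun _ => hlt.le⟩
      · have := slow_lt_slow c0 c1 hlt hd h0
        rw [hle] at this
        exact ⟨fun h => absurd h (not_le.2 hlt), fun h => absurd h (not_le.2 this)⟩
    · rw [a']
      have ar : (q : ℝ) + 1 ≤ e j := by exact_mod_cast a
      have hne' := hne (e j + 1)
      push_cast at hne' ⊢
      rcases lt_or_ge (q + 2 : ℝ) (z l).1 with hlt | hlt
      · rw [(slow_of_gt hlt).1]
        constructor <;> intro _ <;> linarith
      · have hlt' : (z l).1 < q + 2 := lt_of_le_of_ne hlt (by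
          have := hne (q + 2); push_cast at this; exact this)
        have := slow_lt_slow (s' := (q : ℝ) + 2 + (q + 2 - (z l).1)) c0 c1 (by linarith) h0
          (by rw [(slow_of_gt (by linarith)).2]; exact one_ne_zero)
        have hle : slow q c (z l).1 ≤ q + 1 := by
          rcases le_or_gt (z l).1 q with g | g
          · rw [(slow_of_le g).1]; linarith
          rcases le_or_gt (z l).1 (q + 1) with g1 | g1
          · rw [(slow_of_first g g1).1]; nlinarith
          · rw [(slow_of_second g1 hlt).1]; nlinarith
        exact ⟨fun _ => by linarith, fun _ => by linarith⟩
    -- With c = 0 the contour rests between q and q + 1. No point with nonzero density lies there,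
    -- so the mark may be moved from one end of the rest to the other.
    · rw [a', a'']
      push_cast
      rcases le_or_gt (z l).1 q with g | g
      · rw [(slow_of_le g).1]
        exact ⟨fun _ => g, fun _ => by linarith⟩
      rcases le_or_gt (z l).1 (q + 1) with g1 | g1
      · exact absurd ((slow_of_first g g1).2.trans a) h0
      rcases le_or_gt (z l).1 (q + 2) with g2 | g2
      · rw [(slow_of_second g1 g2).1, a]
        constructor <;> intro _ <;> linarith
      · rw [(slow_of_gt g2).1]
        constructor <;> intro _ <;> linarith
  · refine orderedGreen_congr (ht l) (ht l') rfl rfl (.inl ?_)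
    simp only [visit]
    constructor
    · intro hle
      rcases hle.lt_or_eq with hlt | heq
      · exact (slow_lt_slow c0 c1 hlt (hzero l') (hzero l)).le
      · rw [heq]
    · intro hle
      by_contra hlt
      exact absurd hle (not_le.2 (slow_lt_slow c0 c1 (not_le.1 hlt) (hzero l) (hzero l')))

/-- Marks after the insertion of a vertex after the vertex `q`. -/
def shiftMark {k : ℕ} (q : ℕ) (e : Fin k → ℕ) (j : Fin k) : ℕ := if e j ≤ q then e j else e j + 1

lemma shiftMark_cases {k : ℕ} (q : ℕ) (e : Fin k → ℕ) (j : Fin k) :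
    (e j ≤ q ∧ shiftMark q e j = e j) ∨ (q < e j ∧ shiftMark q e j = e j + 1) := by
  unfold shiftMark
  rcases le_or_gt (e j) q with h | h
  · exact .inl ⟨h, if_pos h⟩
  · exact .inr ⟨h, if_neg (not_le.2 h)⟩

lemma insertVertex_of_le {q j : ℕ} {d : ℝ} {h : ℕ → ℝ} (hj : j ≤ q) :
    insertVertex q d h j = h j := if_pos hj

lemma insertVertex_self {q : ℕ} {d : ℝ} {h : ℕ → ℝ} : insertVertex q d h (q + 1) = d := by
  rw [insertVertex, if_neg (by omega), if_pos rfl]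

lemma insertVertex_of_gt {q j : ℕ} {d : ℝ} {h : ℕ → ℝ} (hj : q < j) :
    insertVertex q d h (j + 1) = h j := by
  rw [insertVertex, if_neg (by omega), if_neg (by omega), Nat.add_sub_cancel]

lemma exists_convex_of_le {a b d : ℝ} (h1 : a ≤ d) (h2 : d ≤ b) :
    ∃ c, 0 ≤ c ∧ c ≤ 1 ∧ d = a + c * (b - a) := by
  rcases h1.eq_or_lt with rfl | h
  · exact ⟨0, le_rfl, zero_le_one, by ring⟩
  · have hb : 0 < b - a := by linarith
    exact ⟨(d - a) / (b - a), div_nonneg (by linarith) hb.le,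
      (div_le_one hb).2 (by linarith), by field_simp; ring⟩

/-- Of three heights one lies between the other two. The three cases say whether the new vertex lies
on the segment, overshoots its end or undershoots its start. -/
lemma exists_convex (a b d : ℝ) : (∃ c, 0 ≤ c ∧ c ≤ 1 ∧ d = a + c * (b - a)) ∨
    (∃ c, 0 ≤ c ∧ c ≤ 1 ∧ b = a + c * (d - a)) ∨ (∃ c, 0 ≤ c ∧ c ≤ 1 ∧ a = d + c * (b - d)) := by
  have rev : ∀ {a b d : ℝ}, (∃ c, 0 ≤ c ∧ c ≤ 1 ∧ d = b + c * (a - b)) →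
      ∃ c, 0 ≤ c ∧ c ≤ 1 ∧ d = a + c * (b - a) := by
    rintro a b d ⟨c, h0, h1, h⟩
    exact ⟨1 - c, by linarith, by linarith, by rw [h]; ring⟩
  rcases le_total a b with h1 | h1 <;> rcases le_total b d with h2 | h2 <;>
    rcases le_total a d with h3 | h3
  · exact .inr (.inl (exists_convex_of_le h1 h2))
  · exact .inr (.inl (exists_convex_of_le h1 h2))
  · exact .inl (exists_convex_of_le h3 h2)
  · exact .inr (.inr (exists_convex_of_le h3 h1))
  · exact .inr (.inr (rev (exists_convex_of_le h1 h3)))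
  · exact .inl (rev (exists_convex_of_le h2 h3))
  · exact .inr (.inl (rev (exists_convex_of_le h2 h1)))
  · exact .inr (.inl (rev (exists_convex_of_le h2 h1)))

/-- Any vertex may be inserted in a segment. -/
theorem pathIntegral_insertVertex {k w : ℕ} {b : ℝ} {α : Fin k → ℂ} {v : Fin k → ℝ × ℝ}
    (H : Screened b α v w) {e : Fin k → ℕ} {m : ℕ} (he : ∀ j, e j ≤ m) {q : ℕ} (hq : q < m)
    (d : ℝ) (h : ℕ → ℝ) :
    pathIntegral b α v w (shiftMark q e) (m + 1) (insertVertex q d h)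
      = pathIntegral b α v w e m h := by
  have ins : ∀ {c : ℝ} {e : Fin k → ℕ} {m q : ℕ} (h : ℕ → ℝ), 0 ≤ c → c ≤ 1 → q < m →
      pathIntegral b α v w (shiftMark q e) (m + 1)
        (insertVertex q (h q + c * (h (q + 1) - h q)) h) = pathIntegral b α v w e m h := by
    intro c e m q h c0 c1 hq
    refine pathIntegral_insert hq.le c0 c1 (.inr hq) h fun j => ?_
    rcases shiftMark_cases q e j with h | h
    · exact .inl h
    · exact .inr (.inl h)
  have he2 : ∀ {q' : ℕ}, q' = q ∨ q' = q + 1 → ∀ j, shiftMark q' (shiftMark q e) j ≤ m + 2 := by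
    intro q' _ j
    have := he j
    rcases shiftMark_cases q e j with h | h <;>
    rcases shiftMark_cases q' (shiftMark q e) j with h' | h' <;> omega
  rcases exists_convex (h q) (h (q + 1)) d with ⟨c, c0, c1, hc⟩ | ⟨c, c0, c1, hc⟩ | ⟨c, c0, c1, hc⟩
  · rw [hc]
    exact ins h c0 c1 hq
  -- Overshoot: with a = h q and b = h (q + 1), the contour a, d, b is refined to a, b, d, b. Its
  -- fold with tip d unfolds to a, b, b, b, which is also obtained from a, b by two degenerate
  -- insertions.
  · set g := insertVertex q d h with hg
    have g0 : g q = h q := insertVertex_of_le le_rfl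
    have g1 : g (q + 1) = d := insertVertex_self
    have e1 := ins (e := shiftMark q e) (m := m + 1) (q := q) g c0 c1 (by omega)
    have e2 := ins (e := e) (m := m) (q := q) h (zero_le_one' ℝ) le_rfl hq
    set g' := insertVertex q (h q + 1 * (h (q + 1) - h q)) h with hg'
    have g0' : g' q = h q := insertVertex_of_le le_rfl
    have g1' : g' (q + 1) = h (q + 1) := insertVertex_self.trans (by ring)
    have e3 := ins (e := shiftMark q e) (m := m + 1) (q := q) g' (zero_le_one' ℝ) le_rfl (by omega)
    rw [← e1, ← e2, ← e3, g0, g1, g0', g1', ← hc]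
    refine pathIntegral_unfold H (he2 (.inl rfl)) (q := q + 1) (by omega) (fun j => ?_) ?_ ?_
    · rcases shiftMark_cases q e j with h | h <;>
      rcases shiftMark_cases q (shiftMark q e) j with h' | h' <;> omega
    · rw [insertVertex_of_gt (by omega), hg, insertVertex_of_gt (by omega), insertVertex_self]
    · intro j hj
      rcases le_or_gt j q with hjq | hjq
      · rw [insertVertex_of_le hjq, insertVertex_of_le hjq, hg, hg', insertVertex_of_le hjq,
          insertVertex_of_le hjq]
      rcases eq_or_ne j (q + 1) with rfl | hj1
      · rw [insertVertex_self, insertVertex_self]; ring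
      obtain ⟨i, rfl⟩ : ∃ i, j = i + 1 + 1 := ⟨j - 2, by omega⟩
      rw [insertVertex_of_gt (by omega), insertVertex_of_gt (by omega), hg, hg',
        insertVertex_of_gt (by omega), insertVertex_of_gt (by omega)]
  -- Undershoot: a, d, b is refined to a, d, a, b, whose fold with tip d unfolds to the degenerate
  -- a, a, a, b.
  · set g := insertVertex q d h with hg
    have g1 : g (q + 1) = d := insertVertex_self
    have g2 : g (q + 2) = h (q + 1) := insertVertex_of_gt (by omega)
    have e1 := ins (e := shiftMark q e) (m := m + 1) (q := q + 1) g c0 c1 (by omega)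
    have e2 := ins (e := e) (m := m) (q := q) h le_rfl (zero_le_one' ℝ) hq
    set g' := insertVertex q (h q + 0 * (h (q + 1) - h q)) h with hg'
    have g0' : g' q = h q := insertVertex_of_le le_rfl
    have e3 := ins (e := shiftMark q e) (m := m + 1) (q := q) g' le_rfl (zero_le_one' ℝ) (by omega)
    have hsh : shiftMark (q + 1) (shiftMark q e) = shiftMark q (shiftMark q e) := by
      funext j
      rcases shiftMark_cases q e j with h | h <;>
      rcases shiftMark_cases q (shiftMark q e) j with h' | h' <;>
      rcases shiftMark_cases (q + 1) (shiftMark q e) j with h'' | h'' <;> omega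
    rw [← e1, ← e2, ← e3, g1, g2, g0', ← hc, hsh]
    refine pathIntegral_unfold H (he2 (.inl rfl)) (q := q) (by omega) (fun j => ?_) ?_ ?_
    · rcases shiftMark_cases q e j with h | h <;>
      rcases shiftMark_cases q (shiftMark q e) j with h' | h' <;> omega
    · rw [insertVertex_self, insertVertex_of_le (by omega), hg, insertVertex_of_le le_rfl]
    · intro j hj
      rcases le_or_gt j q with hjq | hjq
      · rw [insertVertex_of_le (by omega), insertVertex_of_le hjq, hg, hg', insertVertex_of_le hjq,
          insertVertex_of_le hjq]
      obtain ⟨i, rfl⟩ : ∃ i, j = i + 1 + 1 := ⟨j - 2, by omega⟩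
      rcases eq_or_ne i q with rfl | hj1
      · rw [insertVertex_self, insertVertex_of_gt (by omega), hg', insertVertex_self]; ring
      rw [insertVertex_of_gt (by omega), insertVertex_of_gt (by omega), hg, hg',
        insertVertex_of_gt (by omega), insertVertex_of_gt (by omega)]

/-! ### Reversal of the contour -/

/-- Heights of the reversed contour. -/
def reverseHeights (m : ℕ) (h : ℕ → ℝ) (j : ℕ) : ℝ := -h (m - j)

lemma path_reverse {m : ℕ} {h : ℕ → ℝ} {s : ℝ} (hs : ∀ j : ℕ, s ≠ j) :
    path m (reverseHeights m h) (m - s) = -path m h s ∧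
    dens m (reverseHeights m h) (m - s) = dens m h s ∧ rpart m (m - s) = -rpart m s := by
  have hm0 : (0 : ℝ) ≤ m := m.cast_nonneg
  rcases param_cases m hs with hc | hc | ⟨j, hj, h0, h1⟩
  · rw [path_of_ge (s := m - s) (by linarith), path_of_le_zero hc.le,
      dens_of_gt (s := m - s) (by linarith), dens_of_lt_zero hc,
      rpart_of_ge (s := m - s) (by linarith), rpart_of_le_zero hc.le]
    refine ⟨?_, rfl, by ring⟩
    simp [reverseHeights]
  · rw [path_of_le_zero (s := m - s) (by linarith), path_of_ge hc.le,
      dens_of_lt_zero (s := m - s) (by linarith), dens_of_gt hc,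
      rpart_of_le_zero (s := m - s) (by linarith), rpart_of_ge hc.le]
    refine ⟨?_, rfl, by ring⟩
    simp [reverseHeights]
  · have hj0 : (0 : ℝ) ≤ j := j.cast_nonneg
    have hjm : ((j : ℝ) + 1) ≤ m := by exact_mod_cast hj
    have hcast : ((m - (j + 1) : ℕ) : ℝ) = m - (j + 1) := by
      rw [Nat.cast_sub (by omega)]; push_cast; ring
    have i1 : m - (m - (j + 1)) = j + 1 := by omega
    have i2 : m - (m - (j + 1) + 1) = j := by omega
    rw [path_of_mem hj h0.le h1.le, dens_of_mem hj h0 h1, rpart_of_mem (by linarith) (by linarith),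
      path_of_mem (j := m - (j + 1)) (by omega) (by rw [hcast]; linarith)
        (by rw [hcast]; linarith),
      dens_of_mem (j := m - (j + 1)) (by omega) (by rw [hcast]; linarith)
        (by rw [hcast]; linarith), rpart_of_mem (by linarith) (by linarith)]
    simp only [reverseHeights, i1, i2, hcast]
    exact ⟨by ring, by push_cast; ring, by simp⟩

lemma measurePreserving_reverse (m : ℝ) :
    MeasurePreserving (fun z : ℝ × ℝ => (m - z.1, -z.2)) strip strip := by
  have h := (Measure.measurePreserving_neg (volume : Measure ℝ)).restrict_preimage
    (measurableSet_Icc (a := (-1 : ℝ)) (b := 1))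
  have hpre : (Neg.neg ⁻¹' Set.Icc (-1 : ℝ) 1) = Set.Icc (-1) 1 := by
    ext x
    simp only [Set.mem_preimage, Set.mem_Icc]
    constructor <;> rintro ⟨a, c⟩ <;> constructor <;> linarith
  rw [hpre] at h
  exact (Measure.measurePreserving_sub_left volume m).prod h

/-- Negating all points while reversing the order leaves "later minus earlier" unchanged. Equal
parameters, for which `orderedGreen` breaks the tie by argument position, are covered by equality of
times. -/
lemma orderedGreen_reverse {u u' y y' : Visit} {m : ℝ} (h1 : y.param = m - u.param)
    (h2 : y.time = -u.time) (h3 : y.space = -u.space) (h1' : y'.param = m - u'.param)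
    (h2' : y'.time = -u'.time) (h3' : y'.space = -u'.space)
    (h : u.param ≠ u'.param ∨ u.time = u'.time) :
    orderedGreen y y' = orderedGreen u u' := by
  have h0 : orderedGreen y y' = orderedGreen u' u := by
    unfold orderedGreen
    rw [h1, h1', h2, h2', h3, h3']
    have : m - u'.param ≤ m - u.param ↔ u.param ≤ u'.param := by
      constructor <;> intro h <;> linarith
    simp only [this]
    congr 2 <;> ring
  rw [h0]
  rcases h with h | h
  · exact (orderedGreen_comm_of_param_ne h).symm
  · rw [orderedGreen_of_time_eq h, orderedGreen_of_time_eq h.symm, ← neg_sub u.space,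
      green_neg_right]

/-- Exchanges the two horizontal legs, so that only the left one has to be deformed. -/
theorem pathIntegral_reverse {k w : ℕ} {b : ℝ} {α : Fin k → ℂ} {v : Fin k → ℝ × ℝ}
    {e : Fin k → ℕ} {m : ℕ} (he : ∀ j, e j ≤ m) (h : ℕ → ℝ) :
    pathIntegral b α (-v) w (fun j => m - e j) m (reverseHeights m h)
      = pathIntegral b α v w e m h := by
  have hmp := measurePreserving_pi (fun _ : Fin w => strip) (fun _ => strip)
    (fun _ => measurePreserving_reverse (m : ℝ))
  have hG := measurable_pathIntegrand b α (-v) (fun j => m - e j) m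
    (fun _ : Fin w => (continuous_path m (reverseHeights m h)).measurable)
    (fun _ => measurable_dens m (reverseHeights m h))
  unfold pathIntegral screeningMeasure
  conv_lhs => rw [← hmp.map_eq]
  rw [integral_map hmp.measurable.aemeasurable hG.aestronglyMeasurable]
  refine integral_congr_ae ?_
  filter_upwards [ae_screeningMeasure_of_ae (w := w) ae_ne_natCast] with z hz
  have hf := fun l => path_reverse (m := m) (h := h) (hz l)
  unfold pathIntegrand
  congr 1
  · have ht : ∀ l, (visit m (path m (reverseHeights m h)) (m - (z l).1, -(z l).2)).time
        = -(visit m (path m h) (z l)).time := by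
      intro l
      simp only [visit, (hf l).1, (hf l).2.2]
      push_cast; ring
    refine weight_congr (fun j l => ?_) (fun l l' _ => ?_)
    · refine orderedGreen_reverse (m := m) ?_ ?_ rfl rfl (ht l) rfl (.inl ?_)
      · simp only [mark]
        exact Nat.cast_sub (he j)
      · simp [mark]
      · simp only [mark, visit]
        exact (hz l (e j)).symm
    · refine orderedGreen_reverse (m := m) rfl (ht l) rfl rfl (ht l') rfl ?_
      by_cases hll : (z l).1 = (z l').1
      · right
        simp only [visit, hll]
      · exact .inl hll
  · exact Finset.prod_congr rfl fun l _ => (hf l).2.1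

lemma Screened.neg {k w : ℕ} {b : ℝ} {α : Fin k → ℂ} {v : Fin k → ℝ × ℝ}
    (H : Screened b α v w) : Screened b α (-v) w where
  pos := H.pos
  re_gt := H.re_gt
  sum_re := H.sum_re
  nonLightCone i j hij m := by
    obtain ⟨h1, h2⟩ := H.nonLightCone i j hij (-m)
    push_cast at h1 h2
    simp only [Pi.neg_apply, Prod.fst_neg, Prod.snd_neg]
    exact ⟨fun h => h1 (by linarith), fun h => h2 (by linarith)⟩

/-! ### Cauchy's theorem for one screening point on the left leg -/

open Filter Topology in
/-- Cauchy's theorem for the half strip to the left of a vertical segment. -/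
theorem integral_leg_sub_eq {f : ℂ → ℂ} {c c' κ K : ℝ} (hκ : 0 < κ) {D : ℝ → ℝ}
    (hd : ∀ s < (0 : ℝ), ∀ y ∈ Set.uIcc c c', DifferentiableAt ℂ f (s + y * Complex.I))
    (hbound : ∀ᵐ y : ℝ, y ∈ Set.uIoc c c' → ∀ s < (0 : ℝ),
      ‖f (s + y * Complex.I)‖ ≤ K * Real.exp (κ * s) * D y)
    (hD : IntervalIntegrable D volume c c')
    (hc : IntegrableOn (fun s : ℝ => f (s + c * Complex.I)) (Set.Iio 0))
    (hc' : IntegrableOn (fun s : ℝ => f (s + c' * Complex.I)) (Set.Iio 0))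
    (hlim : ∀ᵐ y : ℝ, y ∈ Set.uIoc c c' → ContinuousAt f (y * Complex.I)) :
    (∫ s in Set.Iio (0 : ℝ), f (s + c * Complex.I)) - (∫ s in Set.Iio (0 : ℝ), f (s + c' * Complex.I))
      + Complex.I * ∫ y in c..c', f (y * Complex.I) = 0 := by
  -- The rectangles stop at E N < 0 because f may be singular on the line Re = 0. The far side
  -- vanishes by exponential decay and the near side converges by domination.
  set A : ℕ → ℝ := fun N => -((N : ℝ) + 1) with hA
  set E : ℕ → ℝ := fun N => -(1 / ((N : ℝ) + 1)) with hE
  have hE0 : ∀ N, E N < 0 := fun N => by simp only [hE]; rw [neg_lt_zero]; positivity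
  have hA0 : ∀ N, A N < 0 := fun N => by simp only [hA]; rw [neg_lt_zero]; positivity
  have hAE : ∀ N, A N ≤ E N := fun N => by
    simp only [hA, hE]
    have h1 : (1 : ℝ) ≤ (N : ℝ) + 1 := by have := N.cast_nonneg (α := ℝ); linarith
    have : 1 / ((N : ℝ) + 1) ≤ 1 := by rw [div_le_one (by linarith)]; exact h1
    linarith
  have hElim : Tendsto E atTop (𝓝 0) := by
    simpa [hE] using (tendsto_one_div_add_atTop_nhds_zero_nat (𝕜 := ℝ)).neg
  have hAlim : Tendsto A atTop atBot :=
    tendsto_neg_atTop_atBot.comp (tendsto_atTop_add_const_right _ _ tendsto_natCast_atTop_atTop)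
  have hrect : ∀ N, (∫ x in A N..E N, f (x + c * Complex.I))
      - (∫ x in A N..E N, f (x + c' * Complex.I))
      + Complex.I * (∫ y in c..c', f ((E N : ℝ) + y * Complex.I))
      - Complex.I * (∫ y in c..c', f ((A N : ℝ) + y * Complex.I)) = 0 := by
    intro N
    have := Complex.integral_boundary_rect_eq_zero_of_differentiableOn f ⟨A N, c⟩ ⟨E N, c'⟩ ?_
    · simpa using this
    · intro τ hτ
      rw [Complex.mem_reProdIm] at hτ
      simp only [Set.uIcc_of_le (hAE N)] at hτ
      have := hd τ.re (hτ.1.2.trans_lt (hE0 N)) τ.im hτ.2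
      rw [Complex.re_add_im] at this
      exact this.differentiableWithinAt
  have hleg : ∀ c : ℝ, IntegrableOn (fun s : ℝ => f (s + c * Complex.I)) (Set.Iio 0) →
      Tendsto (fun N => ∫ x in A N..E N, f (x + c * Complex.I)) atTop
        (𝓝 (∫ s in Set.Iio (0 : ℝ), f (s + c * Complex.I))) := by
    intro c hc
    have hU : (⋃ N, Set.Ioc (A N) (E N)) = Set.Iio 0 := by
      ext s
      simp only [Set.mem_iUnion, Set.mem_Ioc, Set.mem_Iio]
      constructor
      · rintro ⟨N, _, h⟩
        exact h.trans_lt (hE0 N)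
      · intro hs
        have h1 := hAlim.eventually_lt_atBot s
        have h2 := hElim.eventually_const_le hs
        obtain ⟨N, h⟩ := (h1.and h2).exists
        exact ⟨N, h⟩
    have := tendsto_setIntegral_of_monotone (μ := volume) (s := fun N => Set.Ioc (A N) (E N))
      (f := fun s : ℝ => f (s + c * Complex.I)) (fun N => measurableSet_Ioc) ?_ (by rwa [hU])
    · rw [hU] at this
      refine this.congr fun N => ?_
      rw [intervalIntegral.integral_of_le (hAE N)]
    · intro N M hNM
      have hNM' : (N : ℝ) ≤ M := by exact_mod_cast hNM
      refine Set.Ioc_subset_Ioc ?_ ?_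
      · simp only [hA]; linarith
      · simp only [hE]
        have : (0 : ℝ) ≤ N := N.cast_nonneg
        have := one_div_le_one_div_of_le (by linarith : (0 : ℝ) < N + 1)
          (by linarith : (N : ℝ) + 1 ≤ M + 1)
        linarith
  have hmeas : ∀ s : ℝ, s < 0 → AEStronglyMeasurable (fun y : ℝ => f (s + y * Complex.I))
      (volume.restrict (Set.uIoc c c')) := by
    intro s hs
    have hcont : ContinuousOn (fun y : ℝ => f (s + y * Complex.I)) (Set.uIcc c c') := by
      intro y hy
      have h1 := (hd s hs y hy).continuousAt
      have h2 : ContinuousAt (fun y : ℝ => (s : ℂ) + y * Complex.I) y := by fun_prop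
      exact (ContinuousAt.comp (f := fun y : ℝ => (s : ℂ) + y * Complex.I) h1
        h2).continuousWithinAt
    exact (hcont.mono Set.uIoc_subset_uIcc).aestronglyMeasurable measurableSet_uIoc
  have hKD : ∀ᵐ y : ℝ, y ∈ Set.uIoc c c' → ∀ s < (0 : ℝ), ‖f (s + y * Complex.I)‖ ≤ K * D y := by
    filter_upwards [hbound] with y hy hyI s hs
    have h1 := hy hyI s hs
    have hexp := Real.exp_pos (κ * s)
    have h2 : 0 ≤ K * D y := by
      have h3 := (norm_nonneg _).trans h1
      rw [mul_right_comm] at h3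
      exact nonneg_of_mul_nonneg_left h3 hexp
    refine h1.trans ?_
    rw [mul_right_comm]
    exact mul_le_of_le_one_right h2 (Real.exp_le_one_iff.2 (by nlinarith))
  have hvert : Tendsto (fun N => ∫ y in c..c', f ((E N : ℝ) + y * Complex.I)) atTop
      (𝓝 (∫ y in c..c', f (y * Complex.I))) := by
    refine intervalIntegral.tendsto_integral_filter_of_dominated_convergence (fun y => K * D y)
      (Eventually.of_forall fun N => hmeas _ (hE0 N)) (Eventually.of_forall fun N => ?_)
      (hD.const_mul K) ?_
    · filter_upwards [hKD] with y hy hyI using hy hyI _ (hE0 N)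
    · filter_upwards [hlim] with y hy hyI
      have h1 : Tendsto (fun N => ((E N : ℝ) : ℂ) + y * Complex.I) atTop
          (𝓝 (0 + y * Complex.I)) := by
        refine Tendsto.add_const _ ?_
        have := (Complex.continuous_ofReal.tendsto 0).comp hElim
        simpa [Function.comp_def] using this
      rw [zero_add] at h1
      exact (hy hyI).tendsto.comp h1
  have hfar : Tendsto (fun N => ∫ y in c..c', f ((A N : ℝ) + y * Complex.I)) atTop (𝓝 0) := by
    have := intervalIntegral.tendsto_integral_filter_of_dominated_convergence
      (μ := volume) (a := c) (b := c') (l := atTop)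
      (F := fun N (y : ℝ) => f ((A N : ℝ) + y * Complex.I)) (f := fun _ => 0) (fun y => K * D y)
      (Eventually.of_forall fun N => hmeas _ (hA0 N)) (Eventually.of_forall fun N => ?_)
      (hD.const_mul K) ?_
    · simpa using this
    · filter_upwards [hKD] with y hy hyI using hy hyI _ (hA0 N)
    · filter_upwards [hbound] with y hy hyI
      have h1 : Tendsto (fun N => K * Real.exp (κ * A N) * D y) atTop (𝓝 0) := by
        have : Tendsto (fun N => Real.exp (κ * A N)) atTop (𝓝 0) :=
          Real.tendsto_exp_atBot.comp (hAlim.const_mul_atBot hκ)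
        simpa using (this.const_mul K).mul_const (D y)
      exact squeeze_zero_norm (fun N => hy hyI _ (hA0 N)) h1
  have := (((hleg c hc).sub (hleg c' hc')).add (hvert.const_mul Complex.I)).sub
    (hfar.const_mul Complex.I)
  simp only [hrect, mul_zero, sub_zero] at this
  exact (tendsto_nhds_unique this tendsto_const_nhds)

/-- Points near which `green · x` is holomorphic. -/
def Regular (τ : ℂ) (x : ℝ) : Prop :=
  0 < τ.re ∨ ∀ m : ℤ, x - τ.im ≠ 2 * m ∧ x + τ.im ≠ 2 * m

lemma Spacelike.regular {τ : ℂ} {x : ℝ} (h : Spacelike τ.im x) : Regular τ x := by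
  refine .inr fun m => ?_
  have := h (-m)
  push_cast at this
  constructor
  · intro h1
    rw [show x + 2 * -(m : ℝ) = τ.im by linarith] at this
    exact lt_irrefl _ this
  · intro h1
    rw [show x + 2 * -(m : ℝ) = -τ.im by linarith, abs_neg] at this
    exact lt_irrefl _ this

lemma Regular.differentiableAt {τ : ℂ} {x : ℝ} (h : Regular τ x) :
    DifferentiableAt ℂ (fun τ => green τ x) τ := by
  have hpi := Real.pi_pos
  have key : ∀ y : ℝ, (0 < τ.re ∨ ∀ m : ℤ, y - τ.im ≠ 2 * m) →
      1 - Complex.exp (-Real.pi * τ + Real.pi * Complex.I * y) ∈ Complex.slitPlane := by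
    intro y hy
    rcases hy with hy | hy
    · apply one_sub_exp_mem_slitPlane_of_re
      simp
      positivity
    · apply one_sub_exp_mem_slitPlane_of_im
      intro m hm
      apply hy m
      have : (-(Real.pi : ℂ) * τ + Real.pi * Complex.I * y).im = Real.pi * (y - τ.im) := by
        simp; ring
      rw [this, mul_comm 2, mul_assoc] at hm
      exact mul_left_cancel₀ hpi.ne' hm
  have k1 := key x (h.imp_right fun h m => (h m).1)
  have k2 := key (-x) (h.imp_right fun h m hm => (h (-m)).2 (by push_cast; linarith))
  have e2 : -(Real.pi : ℂ) * τ + Real.pi * Complex.I * ((-x : ℝ) : ℂ)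
      = -Real.pi * τ - Real.pi * Complex.I * x := by push_cast; ring
  rw [e2] at k2
  unfold green
  have d1 : DifferentiableAt ℂ (fun τ : ℂ => 1 - Complex.exp (-Real.pi * τ
      + Real.pi * Complex.I * x)) τ := by fun_prop
  have d2 : DifferentiableAt ℂ (fun τ : ℂ => 1 - Complex.exp (-Real.pi * τ
      - Real.pi * Complex.I * x)) τ := by fun_prop
  have d3 : DifferentiableAt ℂ (fun τ : ℂ => -(Real.pi * τ / 2)) τ := by fun_prop
  exact (d3.sub ((d1.clog k1).const_mul _)).sub ((d2.clog k2).const_mul _)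

/-- The weight as a function of the complex time `τ` of the screening point `l₀` at position `x`,
which is visited before the insertions and before the screening points `u`. -/
noncomputable def legWeight {k w : ℕ} (b : ℝ) (α : Fin k → ℂ) (v : Fin k → ℝ × ℝ) (l₀ : Fin w)
    (A : Fin k → Fin w → ℂ) (P : Fin w → Fin w → ℂ) (u : Fin w → Visit) (x : ℝ) (τ : ℂ) : ℂ :=
  pairWeight b α
    (fun j l => if l = l₀ then green (Complex.I * (v j).1 - τ) ((v j).2 - x) else A j l)
    (fun l l' => if l = l₀ then green ((u l').time - τ) ((u l').space - x)
      else if l' = l₀ then green ((u l).time - τ) ((u l).space - x) else P l l')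

section legWeight

variable {k w : ℕ} {b : ℝ} {α : Fin k → ℂ} {v : Fin k → ℝ × ℝ} {l₀ : Fin w}
  {A : Fin k → Fin w → ℂ} {P : Fin w → Fin w → ℂ} {u : Fin w → Visit} {x : ℝ}

lemma differentiableAt_legWeight {τ : ℂ}
    (h1 : ∀ j, Regular (Complex.I * (v j).1 - τ) ((v j).2 - x))
    (h2 : ∀ l, l ≠ l₀ → Regular ((u l).time - τ) ((u l).space - x)) :
    DifferentiableAt ℂ (legWeight b α v l₀ A P u x) τ := by
  have hg : ∀ {a : ℂ} {y : ℝ}, Regular (a - τ) y →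
      DifferentiableAt ℂ (fun τ => green (a - τ) y) τ := by
    intro a y h
    exact DifferentiableAt.comp (g := fun τ => green τ y) τ h.differentiableAt (by fun_prop)
  unfold legWeight pairWeight
  refine DifferentiableAt.cexp (DifferentiableAt.sub ?_ ?_)
  · refine DifferentiableAt.const_mul (DifferentiableAt.fun_sum fun j _ =>
      DifferentiableAt.fun_sum fun l _ => DifferentiableAt.const_mul ?_ _) _
    by_cases h : l = l₀
    · simp only [if_pos h]
      exact hg (h1 j)
    · simp only [if_neg h]
      exact differentiableAt_const _
  · refine DifferentiableAt.const_mul (DifferentiableAt.fun_sum fun l _ =>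
      DifferentiableAt.fun_sum fun l' hl' => ?_) _
    have hlt := Finset.mem_Ioi.1 hl'
    by_cases h : l = l₀
    · simp only [if_pos h]
      exact hg (h2 l' (by rintro rfl; exact absurd h hlt.ne))
    · simp only [if_neg h]
      by_cases h' : l' = l₀
      · simp only [if_pos h']
        exact hg (h2 l h)
      · simp only [if_neg h']
        exact differentiableAt_const _

/-- The neutrality bound with R = -s for the moving point and R = 0 for the others. Energies among
the frozen points, whatever their size, go into K, which is independent of s and y. -/
lemma norm_legWeight_le (H : Screened b α v w) (B : ℝ) :
    ∃ K, 0 ≤ K ∧ ∀ s < (0 : ℝ), ∀ y, |y| ≤ B →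
      ‖legWeight b α v l₀ A P u x (s + y * Complex.I)‖ ≤ K * Real.exp (2 * Real.pi * b ^ 2 * s) *
        singular (fun j => min (2 * b * (α j).re) 0) v s y x := by
  have hpi := Real.pi_pos
  set cE : Fin k → Fin w → ℝ := fun j l => if l = l₀ then
    (2 * (max (2 * b * (α j).re) 0 * Real.log 2)
      + 4 * b * |(α j).im| * (Real.pi * (|(v j).1| + B) / 2 + Real.pi))
    else (-4 * b * (α j * A j l)).re with hcE
  set q : Fin w → ℝ := fun l => 2 * Real.pi * b ^ 2 * (u l).time.re
    + 4 * b ^ 2 * Real.log (1 + Real.exp (-(Real.pi * (u l).time.re))) with hq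
  set d : Fin w → Fin w → ℝ := fun l l' => if l = l₀ then q l' else if l' = l₀ then q l else
    (-4 * (b : ℂ) ^ 2 * P l l').re with hd
  refine ⟨Real.exp ((∑ j, ∑ l, cE j l) + ∑ l, ∑ l' ∈ Finset.Ioi l, d l l'), (Real.exp_pos _).le,
    fun s hs y hy => ?_⟩
  set R : Fin w → ℝ := fun l => if l = l₀ then -s else 0 with hR
  set S : Fin k → Fin w → ℝ := fun j l => if l = l₀ then min (2 * b * (α j).re) 0 *
    (Real.log (gap s ((v j).2 - (v j).1 + (y - x))) +
      Real.log (gap s ((v j).2 + (v j).1 + (-y - x)))) else 0 with hS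
  have hgreen : ∀ l, (-4 * (b : ℂ) ^ 2 * green ((u l).time - (s + y * Complex.I))
      ((u l).space - x)).re ≤ 2 * Real.pi * b ^ 2 * (-s) + q l := by
    intro l
    refine (internal_energy_le b _ _).trans ?_
    have hre : ((u l).time - (s + y * Complex.I)).re = (u l).time.re - s := by simp
    rw [hre]
    have h1 : Real.exp (-(Real.pi * ((u l).time.re - s))) ≤
        Real.exp (-(Real.pi * (u l).time.re)) := Real.exp_le_exp.2 (by nlinarith)
    have h2 : Real.log (1 + Real.exp (-(Real.pi * ((u l).time.re - s)))) ≤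
        Real.log (1 + Real.exp (-(Real.pi * (u l).time.re))) := by
      have := Real.exp_pos (-(Real.pi * ((u l).time.re - s)))
      exact Real.log_le_log (by linarith) (by linarith)
    have h3 := mul_le_mul_of_nonneg_left h2 (by positivity : 0 ≤ 4 * b ^ 2)
    simp only [hq]
    linarith
  have := norm_pairWeight_le (b := b) H.sum_re (R := R) (c := cE) (S := S) (d := d)
    (A := fun j l => if l = l₀ then green (Complex.I * (v j).1 - (s + y * Complex.I)) ((v j).2 - x)
      else A j l)
    (P := fun l l' => if l = l₀ then green ((u l').time - (s + y * Complex.I)) ((u l').space - x)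
      else if l' = l₀ then green ((u l).time - (s + y * Complex.I)) ((u l).space - x) else P l l')
    (fun j l => ?_) (fun l l' hll => ?_)
  · refine this.trans (le_of_eq ?_)
    rw [mul_assoc (Real.exp _)]
    congr 1
    rw [Finset.prod_eq_single l₀]
    · simp only [hR, hS, if_true]
      congr 1
      · congr 1; ring
      · unfold singular gapPow
        rw [← Finset.prod_mul_distrib]
        refine Finset.prod_congr rfl fun j _ => ?_
        rw [← Real.exp_add, ← mul_add]
    · intro l _ hl
      simp [hR, hS, hl]
    · intro h
      exact absurd (Finset.mem_univ _) h
  · by_cases hl : l = l₀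
    · simp only [hR, hS, hcE, if_pos hl]
      have hre : (Complex.I * (v j).1 - (s + y * Complex.I)).re = -s := by simp
      have him : (Complex.I * (v j).1 - (s + y * Complex.I)).im = (v j).1 - y := by simp
      have := external_energy_le H.pos (α j) (τ := Complex.I * (v j).1 - (s + y * Complex.I))
        (B := |(v j).1| + B) (by rw [hre]; linarith)
        (by rw [him]; exact (abs_sub _ _).trans (by gcongr)) ((v j).2 - x)
      rw [hre, him, gap_neg_left, gap_neg_left,
        show (v j).2 - x - ((v j).1 - y) = (v j).2 - (v j).1 + (y - x) by ring,
        show (v j).2 - x + ((v j).1 - y) = (v j).2 + (v j).1 + (-y - x) by ring] at this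
      exact this
    · simp only [hR, hS, hcE, if_neg hl]
      linarith
  · by_cases hl : l = l₀
    · have hl' : l' ≠ l₀ := by rintro rfl; exact absurd hl hll.ne
      simp only [hR, hd, if_pos hl, if_neg hl', add_zero]
      exact hgreen l'
    · by_cases hl' : l' = l₀
      · simp only [hR, hd, if_neg hl, if_pos hl', zero_add]
        exact hgreen l
      · simp only [hR, hd, if_neg hl, if_neg hl']
        linarith

/-- The boundary values on Re = 0 dominate the singular factor inside the half strip, with one
constant for all r. This is the integrable majorant needed for Cauchy's theorem. -/
lemma singular_le_zero {β : Fin k → ℝ} (hβ : ∀ j, β j ≤ 0) (x : ℝ) :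
    ∃ C, 0 ≤ C ∧ ∀ᵐ y : ℝ, ∀ r, singular β v r y x ≤ C * singular β v 0 y x := by
  refine ⟨(∏ j, Real.exp (-(β j * Real.log 2))) * ∏ j, Real.exp (-(β j * Real.log 2)),
    by positivity, ?_⟩
  have h1 : ∀ᵐ y : ℝ, ∀ j, 0 < gap 0 ((v j).2 - (v j).1 + (y - x)) := by
    rw [ae_all_iff]
    intro j
    simp_rw [gap_zero_pos_iff, ae_all_iff]
    intro m
    filter_upwards [Measure.ae_ne volume (2 * m - ((v j).2 - (v j).1) + x)] with y hy h
    exact hy (by linarith)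
  have h2 : ∀ᵐ y : ℝ, ∀ j, 0 < gap 0 ((v j).2 + (v j).1 + (-y - x)) := by
    rw [ae_all_iff]
    intro j
    simp_rw [gap_zero_pos_iff, ae_all_iff]
    intro m
    filter_upwards [Measure.ae_ne volume ((v j).2 + (v j).1 - x - 2 * m)] with y hy h
    exact hy (by linarith)
  filter_upwards [h1, h2] with y hy1 hy2 r
  unfold singular
  rw [mul_mul_mul_comm]
  refine mul_le_mul ?_ ?_ (Finset.prod_nonneg fun _ _ => (gapPow_pos _ _ _).le)
    (mul_nonneg (Finset.prod_nonneg fun _ _ => (Real.exp_pos _).le)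
      (Finset.prod_nonneg fun _ _ => (gapPow_pos _ _ _).le))
  · rw [← Finset.prod_mul_distrib (s := Finset.univ) (f := fun j => Real.exp _)]
    exact Finset.prod_le_prod (fun _ _ => (gapPow_pos _ _ _).le)
      fun j _ => gapPow_le_zero (hβ j) (hy1 j)
  · rw [← Finset.prod_mul_distrib (s := Finset.univ) (f := fun j => Real.exp _)]
    exact Finset.prod_le_prod (fun _ _ => (gapPow_pos _ _ _).le)
      fun j _ => gapPow_le_zero (hβ j) (hy2 j)

/-- The positions `x` at which the leg at height `c` converges absolutely. -/
def LegIntegrable (b : ℝ) (α : Fin k → ℂ) (v : Fin k → ℝ × ℝ) (c x : ℝ) : Prop :=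
  Integrable fun s : ℝ => Real.exp (-(2 * Real.pi * b ^ 2 * |s|)) *
    singular (fun j => min (2 * b * (α j).re) 0) v s c x

/-- The positions `x` at which vertical segments between the heights `c` and `c'` converge
absolutely. -/
def SegmentIntegrable (b : ℝ) (α : Fin k → ℂ) (v : Fin k → ℝ × ℝ) (c c' x : ℝ) : Prop :=
  IntervalIntegrable (fun y => singular (fun j => min (2 * b * (α j).re) 0) v 0 y x) volume c c'

lemma Screened.neg_one_lt (H : Screened b α v w) (j : Fin k) : -1 < min (2 * b * (α j).re) 0 := by
  have hb := H.pos
  refine lt_min ?_ (by norm_num)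
  have := mul_lt_mul_of_pos_left (H.re_gt j) (by positivity : 0 < 2 * b)
  rwa [mul_neg, mul_one_div_cancel (by positivity)] at this

lemma Screened.ae_legIntegrable (H : Screened b α v w) (c : ℝ) :
    ∀ᵐ x ∂((volume : Measure ℝ).restrict (Set.Icc (-1) 1)), LegIntegrable b α v c x := by
  have hκ : 0 < 2 * Real.pi * b ^ 2 := by
    have := Real.pi_pos; have := H.pos; positivity
  exact (integrable_singular_leg (fun j => min_le_right _ _) H.neg_one_lt H.nonLightCone hκ
    c).prod_left_ae

lemma Screened.ae_segmentIntegrable (H : Screened b α v w) (c c' : ℝ) :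
    ∀ᵐ x ∂((volume : Measure ℝ).restrict (Set.Icc (-1) 1)), SegmentIntegrable b α v c c' x := by
  have h := integrable_singular_segment (fun j => min_le_right _ _) H.neg_one_lt H.nonLightCone 0
    one_ne_zero (min c c' - 1) (max c c' + 1)
  rw [IntegrableOn, strip, ← Measure.prod_restrict, Measure.restrict_univ] at h
  filter_upwards [h.prod_left_ae] with x hx
  simp only [zero_add, one_mul] at hx
  have hsub : Set.uIcc c c' ⊆ Set.Ioo (min c c' - 1) (max c c' + 1) := by
    intro y hy
    rw [Set.uIcc, Set.mem_Icc] at hy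
    constructor
    · have := hy.1
      change min c c' ≤ y at this
      linarith
    · have := hy.2
      change y ≤ max c c' at this
      linarith
  have hx' : IntegrableOn (fun y => singular (fun j => min (2 * b * (α j).re) 0) v 0 y x)
      (Set.Ioo (min c c' - 1) (max c c' + 1)) := hx
  exact (hx'.mono_set hsub).intervalIntegrable

/-- The contour of one screening point may be deformed on the left leg as long as the remaining
points are visited later or stay spacelike. -/
theorem integral_legWeight (H : Screened b α v w) {c c' : ℝ}
    (hu : ∀ l, l ≠ l₀ → 0 ≤ (u l).time.re ∨
      ∀ y ∈ Set.uIcc c c', Spacelike ((u l).time.im - y) ((u l).space - x))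
    (hc : LegIntegrable b α v c x) (hc' : LegIntegrable b α v c' x)
    (hcc : SegmentIntegrable b α v c c' x) :
    IntegrableOn (fun s : ℝ => legWeight b α v l₀ A P u x (s + c * Complex.I)) (Set.Iio 0) ∧
    IntegrableOn (fun s : ℝ => legWeight b α v l₀ A P u x (s + c' * Complex.I)) (Set.Iio 0) ∧
    (∫ s in Set.Iio (0 : ℝ), legWeight b α v l₀ A P u x (s + c * Complex.I))
      - (∫ s in Set.Iio (0 : ℝ), legWeight b α v l₀ A P u x (s + c' * Complex.I))
      + Complex.I * ∫ y in c..c', legWeight b α v l₀ A P u x (y * Complex.I) = 0 := by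
  have hκ : 0 < 2 * Real.pi * b ^ 2 := by
    have := Real.pi_pos; have := H.pos; positivity
  set f := legWeight b α v l₀ A P u x with hf
  have hB : ∀ y ∈ Set.uIcc c c', |y| ≤ max |c| |c'| := by
    intro y hy
    rw [Set.mem_uIcc] at hy
    rw [abs_le]
    have a1 := neg_abs_le c
    have a2 := le_abs_self c
    have a3 := neg_abs_le c'
    have a4 := le_abs_self c'
    have a5 := le_max_left |c| |c'|
    have a6 := le_max_right |c| |c'|
    rcases hy with ⟨h1, h2⟩ | ⟨h1, h2⟩ <;> constructor <;> linarith
  obtain ⟨K, hK0, hK⟩ := norm_legWeight_le (l₀ := l₀) (A := A) (P := P) (u := u) (x := x) H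
    (max |c| |c'|)
  have hd : ∀ s < (0 : ℝ), ∀ y ∈ Set.uIcc c c', DifferentiableAt ℂ f (s + y * Complex.I) := by
    intro s hs y hy
    refine differentiableAt_legWeight (fun j => .inl ?_) (fun l hl => ?_)
    · simp [hs]
    · rcases hu l hl with h | h
      · left
        simp
        linarith
      · apply Spacelike.regular
        have : ((u l).time - (s + y * Complex.I)).im = (u l).time.im - y := by simp
        rw [this]
        exact h y hy
  have hI : ∀ y ∈ Set.uIcc c c', LegIntegrable b α v y x →
      IntegrableOn (fun s : ℝ => f (s + y * Complex.I)) (Set.Iio 0) := by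
    intro y hy hyI
    have hm : AEStronglyMeasurable (fun s : ℝ => f (s + y * Complex.I))
        (volume.restrict (Set.Iio 0)) := by
      refine ContinuousOn.aestronglyMeasurable (fun s hs => ?_) measurableSet_Iio
      have h1 := (hd s hs y hy).continuousAt
      have h2 : ContinuousAt (fun s : ℝ => (s : ℂ) + y * Complex.I) s := by fun_prop
      exact (ContinuousAt.comp (f := fun s : ℝ => (s : ℂ) + y * Complex.I) h1
        h2).continuousWithinAt
    refine ((hyI.const_mul K).integrableOn).mono' hm ?_
    rw [ae_restrict_iff' measurableSet_Iio]
    refine Filter.Eventually.of_forall fun s hs => ?_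
    refine (hK s hs y (hB y hy)).trans (le_of_eq ?_)
    rw [abs_of_neg hs, mul_assoc]
    congr 3
    ring
  have i1 := hI c Set.left_mem_uIcc hc
  have i2 := hI c' Set.right_mem_uIcc hc'
  refine ⟨i1, i2, ?_⟩
  obtain ⟨C, hC0, hC⟩ := singular_le_zero (v := v) (β := fun j => min (2 * b * (α j).re) 0)
    (fun j => min_le_right _ _) x
  refine integral_leg_sub_eq (K := K * C) hκ hd ?_ hcc i1 i2 ?_
  · filter_upwards [hC] with y hy hyI s hs
    refine (hK s hs y (hB y (Set.uIoc_subset_uIcc hyI))).trans ?_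
    have := mul_le_mul_of_nonneg_left (hy s)
      (mul_nonneg hK0 (Real.exp_pos (2 * Real.pi * b ^ 2 * s)).le)
    refine this.trans (le_of_eq (by ring))
  -- For fixed positions only countably many heights on the line Re = 0 meet a light cone; at all
  -- others the weight is holomorphic nearby.
  · have reg : ∀ (a : ℂ) (x' : ℝ), ∀ᵐ y : ℝ, Regular (a - y * Complex.I) x' := by
      intro a x'
      have h1 : ∀ᵐ y : ℝ, ∀ m : ℤ, y ≠ 2 * m - x' + a.im ∧ y ≠ x' + a.im - 2 * m := by
        rw [ae_all_iff]
        intro m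
        filter_upwards [Measure.ae_ne volume (2 * (m : ℝ) - x' + a.im),
          Measure.ae_ne volume (x' + a.im - 2 * (m : ℝ))] with y h1 h2 using ⟨h1, h2⟩
      filter_upwards [h1] with y hy
      refine .inr fun m => ?_
      have him : (a - y * Complex.I).im = a.im - y := by simp
      rw [him]
      exact ⟨fun h => (hy m).1 (by linarith), fun h => (hy m).2 (by linarith)⟩
    filter_upwards [ae_all_iff.2 fun j => reg (Complex.I * (v j).1) ((v j).2 - x),
      ae_all_iff.2 fun l => reg (u l).time ((u l).space - x)] with y h1 h2 _
    exact (differentiableAt_legWeight h1 fun l _ => h2 l).continuousAt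

end legWeight

/-! ### Sliding the left leg with several screening points -/

/-- Fubini with the contour parameter of l₀ innermost. The exceptional positions G excludes may
depend on the position x of that point only, which suits the conditions for Cauchy's theorem. -/
lemma integral_eq_zero_of_lines {w : ℕ} (l₀ : Fin w) {f : (Fin w → ℝ × ℝ) → ℂ}
    (hf : Integrable f (screeningMeasure w)) {G : ℝ → Prop}
    (hG : ∀ᵐ x ∂(volume : Measure ℝ).restrict (Set.Icc (-1) 1), G x)
    (h : ∀ z x, G x → Integrable (fun s : ℝ => f (Function.update z l₀ (s, x))) →
      ∫ s : ℝ, f (Function.update z l₀ (s, x)) = 0) :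
    ∫ z, f z ∂screeningMeasure w = 0 := by
  obtain ⟨n, rfl⟩ : ∃ n, w = n + 1 := ⟨w - 1, by have := l₀.pos; omega⟩
  have hmp := (measurePreserving_piFinSuccAbove (fun _ : Fin (n + 1) => strip) l₀).symm
  set e := (MeasurableEquiv.piFinSuccAbove (fun _ : Fin (n + 1) => ℝ × ℝ) l₀).symm with he
  have hupd : ∀ (s x : ℝ) (y : Fin n → ℝ × ℝ),
      e ((s, x), y) = Function.update (e ((0, x), y)) l₀ (s, x) := by
    intro s x y
    simp only [he, MeasurableEquiv.piFinSuccAbove_symm_apply, Fin.insertNthEquiv, Equiv.coe_fn_mk]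
    funext i
    rcases eq_or_ne i l₀ with rfl | hi
    · simp
    · obtain ⟨j, rfl⟩ := Fin.exists_succAbove_eq hi
      simp
  have hint : Integrable (fun p => f (e p)) (strip.prod (Measure.pi fun _ : Fin n => strip)) :=
    hmp.integrable_comp_of_integrable hf
  have h1 : ∫ z, f z ∂screeningMeasure (n + 1)
      = ∫ p, f (e p) ∂(strip.prod (Measure.pi fun _ : Fin n => strip)) :=
    (hmp.integral_comp e.measurableEmbedding f).symm
  rw [h1, integral_prod_symm _ hint]
  refine integral_eq_zero_of_ae ?_
  filter_upwards [hint.prod_left_ae] with y hy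
  have hy' : Integrable (fun p : ℝ × ℝ => f (e (p, y))) strip := hy
  change ∫ p, f (e (p, y)) ∂strip = 0
  rw [integral_prod_symm _ hy']
  refine integral_eq_zero_of_ae ?_
  filter_upwards [hy'.prod_left_ae, hG] with x hx hGx
  have e1 : (fun s : ℝ => f (e ((s, x), y)))
      = fun s => f (Function.update (e ((0, x), y)) l₀ (s, x)) := by
    funext s
    rw [hupd]
  rw [e1] at hx
  change ∫ s : ℝ, f (e ((s, x), y)) = 0
  rw [e1]
  exact h _ _ hGx hx

/-- The height of a contour whose left leg slides along the first segment, from the vertex `h 1`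
at `θ = 0` to the height `c` at `θ = 1`. -/
noncomputable def legHeight (m : ℕ) (h : ℕ → ℝ) (c θ s : ℝ) : ℝ :=
  if s ≤ 1 then c + max s (1 - θ) * (h 1 - c) else path m h s

/-- The speed of the contour with height `legHeight m h c θ`. -/
noncomputable def legSpeed (m : ℕ) (h : ℕ → ℝ) (c θ s : ℝ) : ℂ :=
  if s < 0 then 1 else if s ≤ 1 then (if s ≤ 1 - θ then 0 else Complex.I * (h 1 - c : ℝ))
  else dens m h s

lemma measurable_legHeight (m : ℕ) (h : ℕ → ℝ) (c θ : ℝ) : Measurable (legHeight m h c θ) :=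
  Measurable.ite measurableSet_Iic (by fun_prop) (continuous_path m h).measurable

lemma measurable_legSpeed (m : ℕ) (h : ℕ → ℝ) (c θ : ℝ) : Measurable (legSpeed m h c θ) :=
  Measurable.ite measurableSet_Iio measurable_const (Measurable.ite measurableSet_Iic
    (Measurable.ite measurableSet_Iic measurable_const measurable_const) (measurable_dens m h))

lemma admissible_leg {m : ℕ} (hm : 1 ≤ m) (h : ℕ → ℝ) (c : ℝ) {θ : ℝ} (h0 : 0 ≤ θ) (h1 : θ ≤ 1) :
    Admissible m (legHeight m h c θ) (legSpeed m h c θ) where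
  measurable_height := measurable_legHeight m h c θ
  measurable_speed := measurable_legSpeed m h c θ
  bounded := by
    obtain ⟨B, hB⟩ := exists_abs_path_le m h
    refine ⟨max B (|c| + |h 1 - c|), fun s => ?_⟩
    unfold legHeight
    split_ifs with hs
    · refine le_max_of_le_right ((abs_add_le _ _).trans ?_)
      refine add_le_add_right ?_ _
      rw [abs_mul]
      refine mul_le_of_le_one_left (abs_nonneg _) ?_
      rw [abs_of_nonneg (le_max_of_le_right (by linarith))]
      exact max_le hs (by linarith)
    · exact le_max_of_le_left (hB s)
  left := ⟨c + (1 - θ) * (h 1 - c), fun s hs => by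
    rw [legHeight, if_pos (by linarith), max_eq_right (by linarith), legSpeed, if_pos hs]
    simp⟩
  right := ⟨h m, fun s hs => by
    have hm' : (1 : ℝ) ≤ m := by exact_mod_cast hm
    rw [legHeight, if_neg (by linarith), path_of_ge hs.le, legSpeed, if_neg (by linarith),
      if_neg (by linarith), dens_of_gt hs]
    simp⟩
  middle j hj := by
    rcases Nat.eq_zero_or_pos j with rfl | hj0
    · refine ⟨c, h 1 - c, fun s a1 a2 => ?_⟩
      push_cast at a1 a2
      rw [legHeight, if_pos (by linarith), legSpeed, if_neg (by linarith), if_pos (by linarith)]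
      by_cases hs : s ≤ 1 - θ
      · exact .inl (if_pos hs)
      · right
        rw [if_neg hs]
        rw [max_eq_left (by linarith), norm_mul, Complex.norm_I, one_mul, Complex.norm_real,
          Real.norm_eq_abs]
        exact ⟨by ring, le_rfl⟩
    · obtain ⟨p, q, hpq⟩ := (admissible_path m h).middle j hj
      refine ⟨p, q, fun s a1 a2 => ?_⟩
      have : (1 : ℝ) ≤ j := by exact_mod_cast hj0
      rw [legSpeed, if_neg (by linarith), if_neg (by linarith), legHeight, if_neg (by linarith)]
      exact hpq s a1 a2

section legDeformation

variable {k w : ℕ} {b : ℝ} {α : Fin k → ℂ} {v : Fin k → ℝ × ℝ} {e : Fin k → ℕ} {m : ℕ}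
  {h : ℕ → ℝ} {c : ℝ}

/-- If the point precedes all insertions, and precedes or is spacelike to all other screening
points, it may be treated as the earliest. Then no time ordering obstructs holomorphy in its time.
-/
lemma weight_update_eq_legWeight {u : Fin w → Visit} {l₀ : Fin w} {y : Visit}
    (h1 : ∀ j, y.param < e j) (h2 : ∀ l, l ≠ l₀ → y.param < (u l).param ∨
      Spacelike ((u l).time.im - y.time.im) ((u l).space - y.space)) :
    weight b α (mark e v) (Function.update u l₀ y) =
      legWeight b α v l₀ (fun j l => orderedGreen (mark e v j) (u l))
        (fun l l' => orderedGreen (u l) (u l')) u y.space y.time := by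
  refine pairWeight_congr (fun j l => ?_) (fun l l' hll => ?_)
  · by_cases hl : l = l₀
    · subst hl
      rw [Function.update_self, if_pos rfl, orderedGreen_of_ge (by exact (h1 j).le)]
      rfl
    · rw [Function.update_of_ne hl, if_neg hl]
  · by_cases hl : l = l₀
    · subst hl
      rw [Function.update_self, Function.update_of_ne hll.ne', if_pos rfl]
      rcases h2 l' hll.ne' with h | h
      · exact orderedGreen_of_lt h
      · exact orderedGreen_of_spacelike h.sub_comm
    · by_cases hl' : l' = l₀
      · subst hl'
        rw [Function.update_self, Function.update_of_ne hl, if_neg hl, if_pos rfl]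
        rcases h2 l hl with h | h
        · exact orderedGreen_of_ge h.le
        · exact orderedGreen_of_spacelike' h
      · rw [Function.update_of_ne hl, Function.update_of_ne hl', if_neg hl, if_neg hl']

lemma pathIntegrand_update (η : ℝ → ℝ → ℝ) (ρ : ℝ → ℝ → ℂ) (T : Fin w → ℝ) (l₀ : Fin w) (θ : ℝ)
    (z : Fin w → ℝ × ℝ) (p : ℝ × ℝ) :
    pathIntegrand b α v e m (fun l => η (Function.update T l₀ θ l))
      (fun l => ρ (Function.update T l₀ θ l)) (Function.update z l₀ p)
    = weight b α (mark e v) (Function.update (fun l => visit m (η (T l)) (z l)) l₀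
        (visit m (η θ) p)) * (ρ θ p.1 * ∏ l ∈ Finset.univ.erase l₀, ρ (T l) (z l).1) := by
  unfold pathIntegrand
  congr 1
  · congr 1
    funext l
    by_cases hl : l = l₀
    · subst hl; simp
    · simp [hl]
  · rw [← Finset.mul_prod_erase _ _ (Finset.mem_univ l₀)]
    simp only [Function.update_self]
    congr 1
    refine Finset.prod_congr rfl fun l hl => ?_
    have := Finset.ne_of_mem_erase hl
    simp [this]

/-- Configurations whose screening points are pairwise at spatial distance at least `δ`. -/
def separated (w : ℕ) (δ : ℝ) : Set (Fin w → ℝ × ℝ) :=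
  {z | ∀ l l', l ≠ l' → ∀ n : ℤ, δ ≤ |(z l).2 - (z l').2 + 2 * n|}

lemma measurableSet_separated (w : ℕ) (δ : ℝ) : MeasurableSet (separated w δ) := by
  have : separated w δ = ⋂ l, ⋂ l', ⋂ (_ : l ≠ l'), ⋂ n : ℤ,
      {z : Fin w → ℝ × ℝ | δ ≤ |(z l).2 - (z l').2 + 2 * (n : ℝ)|} := by
    ext z; simp [separated]
  rw [this]
  have hs : ∀ l : Fin w, Measurable fun z : Fin w → ℝ × ℝ => (z l).2 := fun l =>
    measurable_snd.comp (measurable_pi_apply l)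
  refine MeasurableSet.iInter fun l => MeasurableSet.iInter fun l' => MeasurableSet.iInter fun _ =>
    MeasurableSet.iInter fun n => measurableSet_le measurable_const ?_
  exact ((((hs l).sub (hs l')).add measurable_const)).abs

lemma legHeight_of_le {θ s : ℝ} (h0 : 0 ≤ θ) (hs : s ≤ 1 - θ) :
    legHeight m h c θ s = c + (1 - θ) * (h 1 - c) := by
  rw [legHeight, if_pos (hs.trans (sub_le_self 1 h0)), max_eq_right hs]

lemma legHeight_of_mem {θ s : ℝ} (hs : 1 - θ ≤ s) (h1 : s ≤ 1) :
    legHeight m h c θ s = c + s * (h 1 - c) := by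
  rw [legHeight, if_pos h1, max_eq_left hs]

lemma leg_congr {θ θ' s : ℝ} (h1 : 1 - θ < s) (h2 : 1 - θ' < s) :
    legHeight m h c θ s = legHeight m h c θ' s ∧ legSpeed m h c θ s = legSpeed m h c θ' s := by
  unfold legHeight legSpeed
  rw [max_eq_left h1.le, max_eq_left h2.le, if_neg (not_le.2 h1), if_neg (not_le.2 h2)]
  exact ⟨rfl, rfl⟩

/-- Cauchy's theorem for l₀ alone, with the others frozen on legs at intermediate stages. Heights in
the swept band differ by less than δ and positions by at least δ, so points in the band are
spacelike to each other. -/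
theorem setIntegral_separated_update (H : Screened b α v w) (hm : 1 ≤ m) (he : ∀ j, e j ≤ m)
    (he1 : ∀ j, 1 ≤ e j) {θ θ' δ : ℝ} (h0 : 0 ≤ θ) (hθ : θ ≤ θ') (h1 : θ' ≤ 1)
    (hδ : (θ' - θ) * |h 1 - c| < δ) {T : Fin w → ℝ} (hT : ∀ l, T l ∈ Set.Icc θ θ') (l₀ : Fin w) :
    ∫ z in separated w δ, pathIntegrand b α v e m
      (fun l => legHeight m h c (Function.update T l₀ θ' l))
      (fun l => legSpeed m h c (Function.update T l₀ θ' l)) z ∂screeningMeasure w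
    = ∫ z in separated w δ, pathIntegrand b α v e m
      (fun l => legHeight m h c (Function.update T l₀ θ l))
      (fun l => legSpeed m h c (Function.update T l₀ θ l)) z ∂screeningMeasure w := by
  have hint : ∀ t, t ∈ Set.Icc θ θ' → Integrable (pathIntegrand b α v e m
      (fun l => legHeight m h c (Function.update T l₀ t l))
      (fun l => legSpeed m h c (Function.update T l₀ t l))) (screeningMeasure w) := by
    intro t ht
    have hTt : ∀ l, Function.update T l₀ t l ∈ Set.Icc θ θ' := by
      intro l
      by_cases hl : l = l₀
      · subst hl; simpa using ht
      · simpa [hl] using hT l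
    exact H.integrable he fun l => admissible_leg hm h c (h0.trans (hTt l).1) ((hTt l).2.trans h1)
  have hi' := hint θ' ⟨hθ, le_rfl⟩
  have hi := hint θ ⟨le_rfl, hθ⟩
  set F' := pathIntegrand b α v e m (fun l => legHeight m h c (Function.update T l₀ θ' l))
      (fun l => legSpeed m h c (Function.update T l₀ θ' l)) with hF'
  set F := pathIntegrand b α v e m (fun l => legHeight m h c (Function.update T l₀ θ l))
      (fun l => legSpeed m h c (Function.update T l₀ θ l)) with hF
  rw [← sub_eq_zero, ← integral_sub hi'.integrableOn hi.integrableOn,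
    ← integral_indicator (measurableSet_separated w δ)]
  set L : ℝ → ℝ := fun t => c + (1 - t) * (h 1 - c) with hL
  refine integral_eq_zero_of_lines l₀ (G := fun x => LegIntegrable b α v (L θ') x ∧
      LegIntegrable b α v (L θ) x ∧ SegmentIntegrable b α v (L θ') (L θ) x)
    ((hi'.sub hi).indicator (measurableSet_separated w δ)) ?_ ?_
  · filter_upwards [H.ae_legIntegrable (L θ'), H.ae_legIntegrable (L θ),
      H.ae_segmentIntegrable (L θ') (L θ)] with x a1 a2 a3 using ⟨a1, a2, a3⟩
  rintro z x ⟨g1, g2, g3⟩ hline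
  -- Separation involves positions only, so it holds on the whole line of integration or nowhere on
  -- it.
  by_cases hz : Function.update z l₀ (0, x) ∈ separated w δ
  swap
  · have : ∀ s : ℝ, Function.update z l₀ (s, x) ∉ separated w δ := by
      intro s hs
      apply hz
      intro l l' hll n
      have := hs l l' hll n
      have e1 : ∀ l, (Function.update z l₀ (s, x) l).2 = (Function.update z l₀ (0, x) l).2 := by
        intro l
        by_cases hl : l = l₀
        · subst hl; simp
        · simp [hl]
      rwa [e1, e1] at this
    simp [Set.indicator_of_notMem (this _)]
  have hzs : ∀ s : ℝ, Function.update z l₀ (s, x) ∈ separated w δ := by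
    intro s l l' hll n
    have := hz l l' hll n
    have e1 : ∀ l, (Function.update z l₀ (0, x) l).2 = (Function.update z l₀ (s, x) l).2 := by
      intro l
      by_cases hl : l = l₀
      · subst hl; simp
      · simp [hl]
    rwa [e1, e1] at this
  have hsep : ∀ l, l ≠ l₀ → ∀ n : ℤ, δ ≤ |(z l).2 - x + 2 * n| := by
    intro l hl n
    have := hz l l₀ hl n
    simpa [hl] using this
  simp only [Set.indicator_of_mem (hzs _)] at hline ⊢
  set u : Fin w → Visit := fun l => visit m (legHeight m h c (T l)) (z l) with hu
  set Q : ℂ := ∏ l ∈ Finset.univ.erase l₀, legSpeed m h c (T l) (z l).1 with hQ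
  set W : ℂ → ℂ := legWeight b α v l₀ (fun j l => orderedGreen (mark e v j) (u l))
        (fun l l' => orderedGreen (u l) (u l')) u x with hW
  have hval : ∀ t s, pathIntegrand b α v e m
      (fun l => legHeight m h c (Function.update T l₀ t l))
      (fun l => legSpeed m h c (Function.update T l₀ t l)) (Function.update z l₀ (s, x))
      = weight b α (mark e v) (Function.update u l₀ (visit m (legHeight m h c t) (s, x)))
        * (legSpeed m h c t s * Q) := fun t s =>
    pathIntegrand_update (legHeight m h c) (legSpeed m h c) T l₀ t z (s, x)
  have hband : ∀ t ∈ Set.Icc (1 - θ') (1 - θ), ∀ t' ∈ Set.Icc (1 - θ') (1 - θ), ∀ l, l ≠ l₀ →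
      Spacelike (c + t * (h 1 - c) - (c + t' * (h 1 - c))) ((z l).2 - x) := by
    intro t ht t' ht' l hl n
    refine lt_of_lt_of_le ?_ (hsep l hl n)
    rw [show c + t * (h 1 - c) - (c + t' * (h 1 - c)) = (t - t') * (h 1 - c) by ring, abs_mul]
    refine lt_of_le_of_lt (mul_le_mul_of_nonneg_right ?_ (abs_nonneg _)) hδ
    rw [abs_le]
    constructor <;> linarith [ht.1, ht.2, ht'.1, ht'.2]
  -- Every other point either has passed the swept part of the first segment or has its height in
  -- the swept band.
  have hother : ∀ l, 1 - θ ≤ (z l).1 ∨ ∃ t ∈ Set.Icc (1 - θ') (1 - θ),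
      (u l).time.im = c + t * (h 1 - c) := by
    intro l
    rcases le_or_gt (1 - θ) (z l).1 with hs | hs
    · exact .inl hs
    · refine .inr ⟨max (z l).1 (1 - T l), ⟨?_, max_le hs.le (by linarith [(hT l).1])⟩, ?_⟩
      · exact le_max_of_le_right (by linarith [(hT l).2])
      · have : (u l).time.im = legHeight m h c (T l) (z l).1 := by simp [hu, visit]
        rw [this, legHeight, if_pos (by linarith)]
  have hWeq : ∀ t ∈ Set.Icc (1 - θ') (1 - θ), ∀ θ₀ s, s < 1 - θ →
      legHeight m h c θ₀ s = c + t * (h 1 - c) →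
      weight b α (mark e v) (Function.update u l₀ (visit m (legHeight m h c θ₀) (s, x)))
        = W (rpart m s + Complex.I * (c + t * (h 1 - c) : ℝ)) := by
    intro t ht θ₀ s hs hts
    rw [weight_update_eq_legWeight (fun j => ?_) (fun l hl => ?_)]
    · simp only [visit, hts, hW]
    · have : (1 : ℝ) ≤ e j := by exact_mod_cast he1 j
      simp only [visit]
      linarith
    · rcases hother l with h2 | ⟨t', ht', h2⟩
      · left
        simp only [visit, hu]
        linarith
      · right
        have : (visit m (legHeight m h c θ₀) (s, x)).time.im = c + t * (h 1 - c) := by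
          simp [visit, hts]
        rw [this, h2]
        exact hband t' ht' t ht l hl
  obtain ⟨j1, j2, j3⟩ := integral_legWeight (l₀ := l₀)
    (A := fun j l => orderedGreen (mark e v j) (u l))
    (P := fun l l' => orderedGreen (u l) (u l')) (u := u) (x := x) H (c := L θ') (c' := L θ)
    (fun l hl => by
      rcases hother l with h2 | ⟨t', ht', h2⟩
      · left
        have : (u l).time.re = rpart m (z l).1 := by simp [hu, visit]
        rw [this]
        exact rpart_nonneg (by linarith)
      · right
        intro y hy
        obtain ⟨t, ht, rfl⟩ : ∃ t ∈ Set.Icc (1 - θ') (1 - θ), c + t * (h 1 - c) = y := by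
          have hc : ContinuousOn (fun t : ℝ => c + t * (h 1 - c)) (Set.uIcc (1 - θ') (1 - θ)) := by
            fun_prop
          obtain ⟨t, ht, hty⟩ := intermediate_value_uIcc hc hy
          rw [Set.uIcc_of_le (by linarith)] at ht
          exact ⟨t, ht, hty⟩
        rw [h2]
        exact hband t' ht' t ht l hl) g1 g2 g3
  rw [← hW] at j1 j2 j3
  -- The two integrands differ by D1 on the horizontal leg and by D2 on the piece of segment that
  -- the contour at stage θ skips by resting; together they form the boundary of the half strip.
  set D1 : ℝ → ℂ := (Set.Iio (0 : ℝ)).indicator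
    (fun s => (W (s + L θ' * Complex.I) - W (s + L θ * Complex.I)) * Q) with hD1
  set D2 : ℝ → ℂ := (Set.Ioo (1 - θ') (1 - θ)).indicator
    (fun s => (Complex.I * (h 1 - c : ℝ)) * W ((c + s * (h 1 - c) : ℝ) * Complex.I) * Q) with hD2
  have hD1i : Integrable D1 := by
    rw [hD1, integrable_indicator_iff measurableSet_Iio]
    exact (j1.sub j2).mul_const Q
  have hae : (fun s => (F' - F) (Function.update z l₀ (s, x)) - D1 s) =ᵐ[volume] D2 := by
    filter_upwards [Measure.ae_ne volume (0 : ℝ), Measure.ae_ne volume (1 - θ'),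
      Measure.ae_ne volume (1 - θ)] with s s0 s1 s2
    rw [Pi.sub_apply, hF, hF', hval, hval]
    rcases lt_or_gt_of_ne s0 with hs0 | hs0
    · rw [hWeq (1 - θ') ⟨le_rfl, by linarith⟩ θ' s (by linarith)
          (legHeight_of_le (by linarith) (by linarith)),
        hWeq (1 - θ) ⟨by linarith, le_rfl⟩ θ s (by linarith)
          (legHeight_of_le (by linarith) (by linarith)), hD1, hD2,
        Set.indicator_of_mem (by exact hs0), Set.indicator_of_notMem (fun h' => by linarith [h'.1]),
        legSpeed, if_pos hs0, legSpeed, if_pos hs0, rpart_of_le_zero hs0.le,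
        mul_comm Complex.I, mul_comm Complex.I]
      simp only [hL]
      ring
    · rw [hD1, Set.indicator_of_notMem (by simpa using hs0.le), sub_zero, hD2]
      rcases lt_or_gt_of_ne s1 with hs1 | hs1
      · rw [Set.indicator_of_notMem (fun h' => by linarith [h'.1]), legSpeed, if_neg (by linarith),
          if_pos (by linarith), if_pos hs1.le, legSpeed, if_neg (by linarith),
          if_pos (by linarith), if_pos (by linarith)]
        ring
      · rcases lt_or_gt_of_ne s2 with hs2 | hs2
        · have hm' : (1 : ℝ) ≤ m := by exact_mod_cast hm
          rw [Set.indicator_of_mem (by exact ⟨hs1, hs2⟩), hWeq s ⟨hs1.le, hs2.le⟩ θ' s hs2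
            (legHeight_of_mem hs1.le (by linarith)), legSpeed, if_neg (by linarith),
            if_pos (by linarith), if_neg (by linarith), legSpeed, if_neg (by linarith),
            if_pos (by linarith), if_pos hs2.le, rpart_of_mem hs0.le (by linarith),
            Complex.ofReal_zero, zero_add, mul_comm Complex.I ((c + s * (h 1 - c) : ℝ) : ℂ)]
          ring
        · obtain ⟨k1, k2⟩ := leg_congr (m := m) (h := h) (c := c) hs1 hs2
          rw [Set.indicator_of_notMem (fun h' => by linarith [h'.2]), k2,
            show visit m (legHeight m h c θ') (s, x) = visit m (legHeight m h c θ) (s, x) by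
              simp only [visit, k1], sub_self]
  have hsum : ∫ s, (F' - F) (Function.update z l₀ (s, x)) = (∫ s, D1 s) + ∫ s, D2 s := by
    rw [← integral_congr_ae hae, integral_sub (by exact hline) hD1i, add_sub_cancel]
  have e1 : ∫ s, D1 s = ((∫ s in Set.Iio (0 : ℝ), W (s + L θ' * Complex.I))
      - ∫ s in Set.Iio (0 : ℝ), W (s + L θ * Complex.I)) * Q := by
    rw [hD1, integral_indicator measurableSet_Iio, integral_mul_const, integral_sub j1 j2]
  have e2 : ∫ s, D2 s = Complex.I * (∫ y in (L θ')..(L θ), W (y * Complex.I)) * Q := by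
    rw [hD2, integral_indicator measurableSet_Ioo, integral_mul_const,
      ← integral_Ioc_eq_integral_Ioo, ← intervalIntegral.integral_of_le (by linarith),
      intervalIntegral.integral_const_mul, mul_assoc Complex.I]
    congr 2
    have := intervalIntegral.smul_integral_comp_mul_add (a := 1 - θ') (b := 1 - θ)
      (fun y : ℝ => W (y * Complex.I)) (h 1 - c) c
    simp only [Complex.real_smul] at this
    rw [show (h 1 - c) * (1 - θ') + c = L θ' by simp only [hL]; ring,
      show (h 1 - c) * (1 - θ) + c = L θ by simp only [hL]; ring] at this
    rw [← this]
    congr 2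
    funext y
    congr 3
    ring
  change ∫ s, (F' - F) (Function.update z l₀ (s, x)) = 0
  rw [hsum, e1, e2, ← add_mul, j3, zero_mul]

/-- The screening points move to the new contour one at a time; S collects those that have moved. -/
theorem setIntegral_separated_leg (H : Screened b α v w) (hm : 1 ≤ m) (he : ∀ j, e j ≤ m)
    (he1 : ∀ j, 1 ≤ e j) {θ θ' δ : ℝ} (h0 : 0 ≤ θ) (hθ : θ ≤ θ') (h1 : θ' ≤ 1)
    (hδ : (θ' - θ) * |h 1 - c| < δ) :
    ∫ z in separated w δ, pathIntegrand b α v e m (fun _ => legHeight m h c θ')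
      (fun _ => legSpeed m h c θ') z ∂screeningMeasure w
    = ∫ z in separated w δ, pathIntegrand b α v e m (fun _ => legHeight m h c θ)
      (fun _ => legSpeed m h c θ) z ∂screeningMeasure w := by
  have key : ∀ S : Finset (Fin w),
      ∫ z in separated w δ, pathIntegrand b α v e m
        (fun l => legHeight m h c (if l ∈ S then θ' else θ))
        (fun l => legSpeed m h c (if l ∈ S then θ' else θ)) z ∂screeningMeasure w
      = ∫ z in separated w δ, pathIntegrand b α v e m (fun _ => legHeight m h c θ)
        (fun _ => legSpeed m h c θ) z ∂screeningMeasure w := by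
    intro S
    induction S using Finset.induction_on with
    | empty => simp
    | insert l₀ S hl₀ ih =>
      have hT : ∀ l : Fin w, (if l ∈ S then θ' else θ) ∈ Set.Icc θ θ' := by
        intro l
        split_ifs
        · exact ⟨hθ, le_rfl⟩
        · exact ⟨le_rfl, hθ⟩
      have := setIntegral_separated_update H hm he he1 h0 hθ h1 hδ hT l₀
      have e1 : ∀ l, Function.update (fun l => if l ∈ S then θ' else θ) l₀ θ' l
          = if l ∈ insert l₀ S then θ' else θ := by
        intro l
        by_cases hl : l = l₀
        · subst hl; simp
        · simp [hl]
      have e2 : ∀ l, Function.update (fun l => if l ∈ S then θ' else θ) l₀ θ l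
          = if l ∈ S then θ' else θ := by
        intro l
        by_cases hl : l = l₀
        · subst hl; simp [hl₀]
        · simp [hl]
      simp only [e1, e2] at this
      rw [this, ih]
  simpa using key Finset.univ

lemma ae_ne_add_two_mul {w : ℕ} {l l' : Fin w} (hl : l ≠ l') (n : ℤ) :
    ∀ᵐ z ∂screeningMeasure w, (z l).2 - (z l').2 + 2 * (n : ℝ) ≠ 0 := by
  obtain ⟨k, rfl⟩ : ∃ k, w = k + 1 := ⟨w - 1, by have := l.pos; omega⟩
  have hs : ∀ l : Fin (k + 1), Measurable fun z : Fin (k + 1) → ℝ × ℝ => (z l).2 := fun l =>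
    measurable_snd.comp (measurable_pi_apply l)
  have hS : MeasurableSet {z : Fin (k + 1) → ℝ × ℝ | (z l).2 - (z l').2 + 2 * n = 0} :=
    measurableSet_eq_fun (((hs l).sub (hs l')).add measurable_const) measurable_const
  rw [ae_iff]
  simp only [ne_eq, not_not]
  have hmp := (measurePreserving_piFinSuccAbove (fun _ : Fin (k + 1) => strip) l).symm
  obtain ⟨i, rfl⟩ := Fin.exists_succAbove_eq hl.symm
  change Measure.pi (fun _ => strip) _ = 0
  rw [← hmp.measure_preimage hS.nullMeasurableSet,
    Measure.prod_apply_symm (hmp.measurable hS)]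
  refine (lintegral_congr fun y => ?_).trans lintegral_zero
  have hnull : ∀ᵐ p ∂strip, p.2 ≠ (y i).2 - 2 * n :=
    (Measure.quasiMeasurePreserving_snd (μ := (volume : Measure ℝ))
      (ν := volume.restrict (Set.Icc (-1) 1))).ae (p := fun x => x ≠ (y i).2 - 2 * n)
      (ae_restrict_of_ae (Measure.ae_ne volume _))
  rw [ae_iff] at hnull
  refine measure_mono_null (fun p hp => ?_) hnull
  simp only [Set.mem_preimage, MeasurableEquiv.piFinSuccAbove_symm_apply, Set.mem_ofPred_eq] at hp
  simp only [Fin.insertNthEquiv, Equiv.coe_fn_mk, Fin.insertNth_apply_same,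
    Fin.insertNth_apply_succAbove] at hp
  simp only [Set.mem_ofPred_eq, not_not, ne_eq]
  linarith

/-- Almost surely no two positions agree modulo 2. The distance of y to the lattice is attained at
`round` of y/2, so it is positive, and there are finitely many pairs. -/
lemma ae_exists_separated (w : ℕ) :
    ∀ᵐ z ∂screeningMeasure w, z ∈ ⋃ N : ℕ, separated w (1 / ((N : ℝ) + 1)) := by
  have h1 : ∀ᵐ z ∂screeningMeasure w, ∀ p : Fin w × Fin w × ℤ, p.1 ≠ p.2.1 →
      (z p.1).2 - (z p.2.1).2 + 2 * (p.2.2 : ℝ) ≠ 0 := by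
    rw [ae_all_iff]
    rintro ⟨l, l', n⟩
    by_cases hl : l = l'
    · exact Filter.Eventually.of_forall fun _ h => absurd hl h
    · filter_upwards [ae_ne_add_two_mul hl n] with z hz _ using hz
  filter_upwards [h1] with z hz
  have h2 : ∀ p : Fin w × Fin w, ∃ δ > 0, p.1 ≠ p.2 →
      ∀ n : ℤ, δ ≤ |(z p.1).2 - (z p.2).2 + 2 * n| := by
    rintro ⟨l, l'⟩
    by_cases hl : l = l'
    · exact ⟨1, one_pos, fun h => absurd hl h⟩
    set y := (z l).2 - (z l').2 with hy
    refine ⟨2 * |y / 2 - round (y / 2)|, ?_, fun _ n => ?_⟩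
    · have := hz ⟨l, l', -round (y / 2)⟩ hl
      have h3 : y / 2 - round (y / 2) ≠ 0 := by
        intro h4
        apply this
        push_cast
        linarith
      positivity
    · have := round_le (y / 2) (-n)
      have e1 : |y + 2 * n| = 2 * |y / 2 - ((-n : ℤ) : ℝ)| := by
        rw [← abs_two (α := ℝ), ← abs_mul, abs_two]
        congr 1
        push_cast
        ring
      rw [e1]
      linarith
  choose δ hδ hδz using h2
  obtain ⟨δ₀, hδ₀, hδ₀'⟩ : ∃ δ₀ > 0, ∀ p, δ₀ ≤ δ p := by
    rcases isEmpty_or_nonempty (Fin w × Fin w) with hE | hE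
    · exact ⟨1, one_pos, fun p => hE.elim p⟩
    · obtain ⟨p, hp⟩ := Finite.exists_min δ
      exact ⟨δ p, hδ p, hp⟩
  obtain ⟨N, hN⟩ := exists_nat_one_div_lt hδ₀
  exact Set.mem_iUnion.2 ⟨N, fun l l' hll n =>
    hN.le.trans ((hδ₀' (l, l')).trans (hδz (l, l') hll n))⟩

open Filter Topology in
/-- The integral does not change when the left leg slides along the first segment. -/
theorem integral_leg (H : Screened b α v w) (hm : 1 ≤ m) (he : ∀ j, e j ≤ m)
    (he1 : ∀ j, 1 ≤ e j) :
    ∫ z, pathIntegrand b α v e m (fun _ => legHeight m h c 1)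
      (fun _ => legSpeed m h c 1) z ∂screeningMeasure w
    = ∫ z, pathIntegrand b α v e m (fun _ => legHeight m h c 0)
      (fun _ => legSpeed m h c 0) z ∂screeningMeasure w := by
  have hlim : ∀ θ : ℝ, 0 ≤ θ → θ ≤ 1 → Tendsto (fun N : ℕ => ∫ z in separated w (1 / ((N : ℝ) + 1)),
      pathIntegrand b α v e m (fun _ => legHeight m h c θ) (fun _ => legSpeed m h c θ) z
        ∂screeningMeasure w) atTop
      (𝓝 (∫ z, pathIntegrand b α v e m (fun _ => legHeight m h c θ)
        (fun _ => legSpeed m h c θ) z ∂screeningMeasure w)) := by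
    intro θ h0 h1
    have := tendsto_setIntegral_of_monotone (μ := screeningMeasure w)
      (s := fun N : ℕ => separated w (1 / ((N : ℝ) + 1)))
      (f := pathIntegrand b α v e m (fun _ => legHeight m h c θ) (fun _ => legSpeed m h c θ))
      (fun N => measurableSet_separated w _) (fun N M hNM z hz l l' hll n =>
        le_trans (one_div_le_one_div_of_le (by positivity)
          (by have : (N : ℝ) ≤ M := by exact_mod_cast hNM
              linarith)) (hz l l' hll n))
      (H.integrable he fun _ => admissible_leg hm h c h0 h1).integrableOn
    rwa [Measure.restrict_eq_self_of_ae_mem (ae_exists_separated w)] at this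
  refine tendsto_nhds_unique (hlim 1 zero_le_one le_rfl) ((hlim 0 le_rfl zero_le_one).congr ?_)
  intro N
  set δ : ℝ := 1 / ((N : ℝ) + 1) with hδ
  have hδ0 : 0 < δ := by positivity
  -- K equal steps make each change of height smaller than δ; the number of steps may grow as δ
  -- tends to 0.
  obtain ⟨K, hK⟩ := exists_nat_gt (|h 1 - c| / δ)
  have hK0 : (0 : ℝ) < K := lt_of_le_of_lt (by positivity) hK
  rw [div_lt_iff₀ hδ0] at hK
  have hstep : ∀ i : ℕ, i ≤ K → ∫ z in separated w δ, pathIntegrand b α v e m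
      (fun _ => legHeight m h c (i / K)) (fun _ => legSpeed m h c (i / K)) z ∂screeningMeasure w
      = ∫ z in separated w δ, pathIntegrand b α v e m (fun _ => legHeight m h c 0)
        (fun _ => legSpeed m h c 0) z ∂screeningMeasure w := by
    intro i
    induction i with
    | zero => simp
    | succ i ih =>
      intro hi
      rw [← ih (by omega)]
      have hi' : ((i + 1 : ℕ) : ℝ) ≤ K := by exact_mod_cast hi
      have hdiff : ((i + 1 : ℕ) : ℝ) / K - i / K = 1 / K := by push_cast; ring
      refine setIntegral_separated_leg H hm he he1 (by positivity) (by linarith [one_div_pos.2 hK0])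
        ((div_le_one hK0).2 hi') ?_
      rw [hdiff, one_div_mul_eq_div, div_lt_iff₀ hK0]
      linarith
  have := hstep K le_rfl
  rw [div_self hK0.ne'] at this
  exact this.symm

/-- The height of the left leg is irrelevant as long as no insertion sits at its end. -/
theorem pathIntegral_update_zero (H : Screened b α v w) (hm : 1 ≤ m) (he : ∀ j, e j ≤ m)
    (he1 : ∀ j, 1 ≤ e j) {h' : ℕ → ℝ} (hh : ∀ j, j ≠ 0 → h' j = h j) :
    pathIntegral b α v w e m h' = pathIntegral b α v w e m h := by
  -- Slide the leg all the way to the vertex h 1. There the contour rests on the first segment and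
  -- no longer depends on h' 0.
  have key : ∀ h' : ℕ → ℝ, (∀ j, j ≠ 0 → h' j = h j) → pathIntegral b α v w e m h' =
      ∫ z, pathIntegrand b α v e m (fun _ => legHeight m h (h 1) 0)
        (fun _ => legSpeed m h (h 1) 0) z ∂screeningMeasure w := by
    intro h' hh
    have e1 : pathIntegral b α v w e m h' = ∫ z, pathIntegrand b α v e m
        (fun _ => legHeight m h (h' 0) 1) (fun _ => legSpeed m h (h' 0) 1) z
          ∂screeningMeasure w := by
      refine integral_congr_ae (pathIntegrand_ae_congr fun _ => ?_)
      filter_upwards [ae_ne_natCast] with s hs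
      unfold legHeight legSpeed
      rcases param_cases m hs with h0 | h0 | ⟨j, hj, h0, h1⟩
      · rw [path_of_le_zero h0.le, dens_of_lt_zero h0, if_pos (by linarith), if_pos h0,
          max_eq_right (by linarith)]
        simp
      · have hm' : (1 : ℝ) ≤ m := by exact_mod_cast hm
        rw [path_of_ge h0.le, path_of_ge h0.le, dens_of_gt h0, dens_of_gt h0,
          if_neg (by linarith), if_neg (by linarith), if_neg (by linarith), hh m (by omega)]
        exact ⟨rfl, rfl⟩
      · rw [path_of_mem hj h0.le h1.le, path_of_mem hj h0.le h1.le, dens_of_mem hj h0 h1,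
          dens_of_mem hj h0 h1, hh (j + 1) (by omega)]
        rcases Nat.eq_zero_or_pos j with rfl | hj0
        · push_cast at h0 h1
          rw [if_pos (by linarith), if_neg (by linarith), if_pos (by linarith),
            if_neg (by linarith), max_eq_left (by linarith)]
          push_cast
          exact ⟨by ring, rfl⟩
        · have : (1 : ℝ) ≤ j := by exact_mod_cast hj0
          rw [if_neg (by linarith), if_neg (by linarith), if_neg (by linarith), hh j (by omega)]
          exact ⟨rfl, rfl⟩
    rw [e1, integral_leg H hm he he1]
    refine integral_congr_ae (pathIntegrand_ae_congr fun _ => ?_)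
    filter_upwards [ae_ne_natCast] with s hs
    unfold legHeight legSpeed
    rcases le_or_gt s 1 with h1 | h1
    · rw [if_pos h1, if_pos h1, max_eq_right (by linarith)]
      refine ⟨by ring, ?_⟩
      rw [if_pos h1, if_pos h1, sub_zero, if_pos h1, if_pos h1]
    · rw [if_neg (not_le.2 h1), if_neg (not_le.2 h1), if_neg (not_le.2 h1), if_neg (not_le.2 h1)]
      exact ⟨rfl, rfl⟩
  rw [key h' hh, key h fun _ _ => rfl]

end legDeformation

/-! ### Deletion of vertices without insertion -/

section insertions

variable {k w : ℕ} {b : ℝ} {α : Fin k → ℂ} {v : Fin k → ℝ × ℝ} {e : Fin k → ℕ} {m : ℕ}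

/-- Duplicate the first vertex and move the marks to the second copy. The first copy then carries no
insertion, and its height may be changed freely. -/
lemma pathIntegral_front (H : Screened b α v w) (he : ∀ j, e j ≤ m) {h h' : ℕ → ℝ}
    (hh : ∀ j, h' (j + 1) = h j) :
    pathIntegral b α v w (fun j => e j + 1) (m + 1) h' = pathIntegral b α v w e m h := by
  rw [← pathIntegral_insert (e' := fun j => e j + 1) (Nat.zero_le m) le_rfl zero_le_one (.inl rfl) h
    (fun j => by rcases Nat.eq_zero_or_pos (e j) with h0 | h0 <;> simp [h0])]
  refine pathIntegral_update_zero H (by omega) (fun j => by simpa using he j) (fun j => by omega) ?_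
  rintro (_ | _ | j) hj
  · exact absurd rfl hj
  · rw [hh, insertVertex_self]; ring
  · rw [hh, insertVertex_of_gt (by omega)]

/-- The mirror image of `pathIntegral_front` under reversal. -/
lemma pathIntegral_back (H : Screened b α v w) (he : ∀ j, e j ≤ m) {h h' : ℕ → ℝ}
    (hh : ∀ j ≤ m, h' j = h j) :
    pathIntegral b α v w e (m + 1) h' = pathIntegral b α v w e m h := by
  rw [← pathIntegral_reverse he, ← pathIntegral_reverse (fun j => (he j).trans (Nat.le_succ m))]
  have e1 : (fun j => m + 1 - e j) = fun j => (m - e j) + 1 := by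
    funext j
    have := he j
    omega
  rw [e1]
  refine pathIntegral_front H.neg (fun j => Nat.sub_le _ _) fun j => ?_
  rw [reverseHeights, reverseHeights, Nat.succ_sub_succ, hh _ (Nat.sub_le _ _)]

/-- A vertex without insertion may be deleted from the contour. -/
theorem pathIntegral_delete (H : Screened b α v w) (hm : 1 ≤ m) (he : ∀ j, e j ≤ m + 1) {q : ℕ}
    (hq : q ≤ m + 1) (heq : ∀ j, e j ≠ q) (h : ℕ → ℝ) :
    pathIntegral b α v w e (m + 1) h
      = pathIntegral b α v w (fun j => if e j < q then e j else e j - 1) m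
        (fun j => if j < q then h j else h (j + 1)) := by
  rcases Nat.eq_zero_or_pos q with rfl | hq0
  · have e1 : e = fun j => (if e j < 0 then e j else e j - 1) + 1 := by
      funext j
      have := heq j
      simp only [Nat.not_lt_zero, if_false]
      omega
    conv_lhs => rw [e1]
    refine pathIntegral_front H (fun j => ?_) fun j => by simp
    have := he j
    simp only [Nat.not_lt_zero, if_false]
    omega
  · rcases hq.lt_or_eq with hq | rfl
    · obtain ⟨q, rfl⟩ : ∃ q', q = q' + 1 := ⟨q - 1, by omega⟩
      rw [← pathIntegral_insertVertex H (fun j => ?_) (show q < m by omega) (h (q + 1))]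
      · refine pathIntegral_congr ?_ fun j _ => ?_
        · funext j
          have := heq j
          unfold shiftMark
          dsimp only
          split_ifs <;> omega
        · rcases lt_trichotomy j (q + 1) with hj | rfl | hj
          · rw [insertVertex_of_le (by omega), if_pos hj]
          · rw [insertVertex_self]
          · obtain ⟨i, rfl⟩ : ∃ i, j = i + 1 := ⟨j - 1, by omega⟩
            rw [insertVertex_of_gt (by omega), if_neg (by omega)]
      · have := he j
        have := heq j
        split_ifs <;> omega
    · have e1 : (fun j => if e j < m + 1 then e j else e j - 1) = e := by
        funext j
        have := he j
        have := heq j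
        split_ifs <;> omega
      rw [e1]
      refine pathIntegral_back H (fun j => ?_) fun j hj => ?_
      · have := he j
        have := heq j
        omega
      · rw [if_pos (by omega)]

end insertions

/-! ### Relabelling and exchange of neighbouring insertions -/

lemma pathIntegral_comp_equiv {k w : ℕ} (b : ℝ) (α : Fin k → ℂ) (v : Fin k → ℝ × ℝ)
    (e : Fin k → ℕ) (m : ℕ) (h : ℕ → ℝ) (σ : Equiv.Perm (Fin k)) :
    pathIntegral b (α ∘ σ) (v ∘ σ) w (e ∘ σ) m h = pathIntegral b α v w e m h := by
  unfold pathIntegral pathIntegrand weight pairWeight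
  congr 1
  funext z
  congr 4
  exact Equiv.sum_comp σ fun j => ∑ l, α j * orderedGreen (mark e v j)
    (visit m (path m h) (z l))

lemma sum_Ioi_add_self {k : ℕ} {f : Fin k → Fin k → ℂ} (hf : ∀ j j', j ≠ j' → f j j' = f j' j) :
    (∑ j, ∑ j' ∈ Finset.Ioi j, f j j') + ∑ j, ∑ j' ∈ Finset.Ioi j, f j j'
      = ∑ j, ∑ j', if j = j' then 0 else f j j' := by
  have h1 : ∑ j, ∑ j' ∈ Finset.Ioi j, f j j' = ∑ j, ∑ j', if j < j' then f j j' else 0 := by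
    refine Finset.sum_congr rfl fun j _ => ?_
    rw [← Finset.sum_filter]
    exact Finset.sum_congr (by ext; simp) fun _ _ => rfl
  have h2 : ∑ j, ∑ j' ∈ Finset.Ioi j, f j j' = ∑ j, ∑ j', if j' < j then f j j' else 0 := by
    rw [h1, Finset.sum_comm]
    refine Finset.sum_congr rfl fun j _ => Finset.sum_congr rfl fun j' _ => ?_
    split_ifs with h
    · exact hf _ _ h.ne
    · rfl
  conv_lhs => enter [2]; rw [h2]
  rw [h1, ← Finset.sum_add_distrib]
  refine Finset.sum_congr rfl fun j _ => ?_
  rw [← Finset.sum_add_distrib]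
  refine Finset.sum_congr rfl fun j' _ => ?_
  rcases lt_trichotomy j j' with h | h | h
  · simp [h, h.ne, h.not_gt]
  · simp [h]
  · simp [h, h.ne', h.not_gt]

/-- A permutation does not respect j < j', so the sum is doubled to one over all ordered pairs of
distinct labels, where reindexing is free. -/
lemma sum_Ioi_comp_equiv {k : ℕ} {f g : Fin k → Fin k → ℂ}
    (hf : ∀ j j', j ≠ j' → f j j' = f j' j) (hg : ∀ j j', j ≠ j' → g j j' = g j' j)
    (σ : Equiv.Perm (Fin k)) (hfg : ∀ j j', j ≠ j' → f (σ j) (σ j') = g j j') :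
    ∑ j, ∑ j' ∈ Finset.Ioi j, f j j' = ∑ j, ∑ j' ∈ Finset.Ioi j, g j j' := by
  have key : (∑ j, ∑ j', if j = j' then 0 else f j j') = ∑ j, ∑ j', if j = j' then 0 else g j j' := by
    rw [← Equiv.sum_comp σ]
    refine Finset.sum_congr rfl fun j _ => ?_
    rw [← Equiv.sum_comp σ]
    refine Finset.sum_congr rfl fun j' _ => ?_
    by_cases h : j = j'
    · simp [h]
    · rw [if_neg h, if_neg (by simpa using h), hfg j j' h]
  rw [← sum_Ioi_add_self hf, ← sum_Ioi_add_self hg, ← two_mul, ← two_mul] at key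
  exact mul_left_cancel₀ two_ne_zero key

section exchange

variable {n w : ℕ} {b : ℝ} {α : Fin (n + 1) → ℂ} {v : Fin (n + 1) → ℝ × ℝ} {p : Fin n}

lemma swap_val (p : Fin n) (j : Fin (n + 1)) :
    ((Equiv.swap p.castSucc p.succ j : Fin (n + 1)) : ℕ) =
      if (j : ℕ) = p then (p : ℕ) + 1 else if (j : ℕ) = p + 1 then (p : ℕ) else j := by
  by_cases h1 : j = p.castSucc
  · subst h1; simp
  · by_cases h2 : j = p.succ
    · subst h2; simp
    · have h3 : (j : ℕ) ≠ p := fun h => h1 (Fin.ext (by simpa using h))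
      have h4 : (j : ℕ) ≠ p + 1 := fun h => h2 (Fin.ext (by simpa using h))
      rw [Equiv.swap_apply_of_ne_of_ne h1 h2, if_neg h3, if_neg h4]

lemma heights_of_lt (v : Fin (n + 1) → ℝ × ℝ) (j : Fin (n + 1)) : heights v j = (v j).1 := by
  rw [heights, dif_pos j.2]

lemma heights_comp (v : Fin (n + 1) → ℝ × ℝ) (σ : Equiv.Perm (Fin (n + 1))) (j : Fin (n + 1)) :
    heights (v ∘ σ) j = heights v (σ j) := by
  rw [heights_of_lt, heights_of_lt]; rfl

/-- Both sides equal the integral over the zigzag through t_p, t_{p+1}, t_p, with v_p at its first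
or second passage. -/
theorem pathIntegral_swap (H : Screened b α v w)
    (hp : Spacelike ((v p.castSucc).1 - (v p.succ).1) ((v p.castSucc).2 - (v p.succ).2)) :
    pathIntegral b α v w (fun j => (j : ℕ)) n (heights v)
      = pathIntegral b (α ∘ Equiv.swap p.castSucc p.succ) (v ∘ Equiv.swap p.castSucc p.succ) w
        (fun j => (j : ℕ)) n (heights (v ∘ Equiv.swap p.castSucc p.succ)) := by
  set σ := Equiv.swap p.castSucc p.succ with hσ
  have hpn : (p : ℕ) < n := p.2
  -- The zigzag: vertex p + 2 repeats the height of vertex p and later vertices are shifted by one.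
  -- eA marks v_p at p and leaves p + 2 free; eB marks it at p + 2 and leaves p free.
  set h : ℕ → ℝ := fun j => if j ≤ p + 1 then heights v j else
    if j = p + 2 then heights v p else heights v (j - 1) with hh
  set eA : Fin (n + 1) → ℕ := fun j => if (j : ℕ) ≤ p + 1 then j else j + 1 with heA
  set eB : Fin (n + 1) → ℕ := fun j => if (j : ℕ) = p then p + 2 else
    if (j : ℕ) ≤ p + 1 then j else j + 1 with heB
  have hA : pathIntegral b α v w eA (n + 1) h
      = pathIntegral b α v w (fun j => (j : ℕ)) n (heights v) := by
    rw [pathIntegral_delete H (by omega) (fun j => ?_) (q := p + 2) (by omega) (fun j => ?_)]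
    · refine pathIntegral_congr ?_ fun j hj => ?_
      · funext j
        simp only [heA]
        split_ifs <;> omega
      · simp only [hh]
        split_ifs <;> first | rfl | omega
    · simp only [heA]
      have := j.2
      split_ifs <;> omega
    · simp only [heA]
      split_ifs <;> omega
  have hB : pathIntegral b α v w eB (n + 1) h
      = pathIntegral b α v w (fun j => (σ j : ℕ)) n (heights (v ∘ σ)) := by
    rw [pathIntegral_delete H (by omega) (fun j => ?_) (q := p) (by omega) (fun j => ?_)]
    · refine pathIntegral_congr ?_ fun j hj => ?_
      · funext j
        rw [hσ, swap_val]
        simp only [heB]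
        split_ifs <;> omega
      · have e1 : heights (v ∘ σ) j = heights v (σ ⟨j, by omega⟩) := heights_comp v σ ⟨j, by omega⟩
        rw [e1, hσ, swap_val]
        simp only [hh]
        split_ifs <;> first | omega | rfl | (congr 1; omega)
    · simp only [heB]
      have := j.2
      split_ifs <;> omega
    · simp only [heB]
      split_ifs <;> omega
  have hAB : pathIntegral b α v w eA (n + 1) h = pathIntegral b α v w eB (n + 1) h := by
    have g1 : heights v p = (v p.castSucc).1 := heights_of_lt v p.castSucc
    have g2 : heights v (p + 1) = (v p.succ).1 := heights_of_lt v p.succ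
    refine pathIntegral_move_across H (fun j => ?_) (fun j => ?_) (q := p) (by omega)
      (i := p.castSucc) (i' := p.succ) ?_ ?_ ?_ ?_ ?_ (fun j hj => ?_) (fun j hj => ?_) hp
    · simp only [heA]
      have := j.2
      split_ifs <;> omega
    · simp only [heB]
      have := j.2
      split_ifs <;> omega
    · simp [hh, g1]
    · simp [hh, g2]
    · simp [hh, g1]
    · simp [heA]
    · simp [heB]
    · have : (j : ℕ) ≠ p := fun h => hj (Fin.ext (by simpa using h))
      simp only [heA, heB, if_neg this]
    · have : (j : ℕ) ≠ p + 1 := fun h => hj (Fin.ext (by simpa using h))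
      simp only [heA]
      split_ifs <;> omega
  -- After the deletion of vertex p the insertions keep their old labels but are visited in swapped
  -- order. Relabelling by σ, an involution, restores the standard marks.
  rw [← hA, hAB, hB, ← pathIntegral_comp_equiv b α v (fun j => (σ j : ℕ)) n _ σ]
  refine pathIntegral_congr ?_ fun _ _ => rfl
  funext j
  simp [hσ]

/-- The exchange of neighbouring labels alters the order of a single pair, and that pair is
spacelike. -/
lemma sum_external_swap (α : Fin (n + 1) → ℂ) (v : Fin (n + 1) → ℝ × ℝ) (p : Fin n)
    (hp : Spacelike ((v p.castSucc).1 - (v p.succ).1) ((v p.castSucc).2 - (v p.succ).2)) :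
    ∑ j, ∑ j' ∈ Finset.Ioi j, α j * α j' * orderedGreen (externalVisit v j) (externalVisit v j')
      = ∑ j, ∑ j' ∈ Finset.Ioi j, (α ∘ Equiv.swap p.castSucc p.succ) j
          * (α ∘ Equiv.swap p.castSucc p.succ) j'
          * orderedGreen (externalVisit (v ∘ Equiv.swap p.castSucc p.succ) j)
            (externalVisit (v ∘ Equiv.swap p.castSucc p.succ) j') := by
  have symm : ∀ (α : Fin (n + 1) → ℂ) (v : Fin (n + 1) → ℝ × ℝ) (j j' : Fin (n + 1)), j ≠ j' →
      α j * α j' * orderedGreen (externalVisit v j) (externalVisit v j')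
        = α j' * α j * orderedGreen (externalVisit v j') (externalVisit v j) := by
    intro α v j j' hj
    rw [orderedGreen_comm_of_param_ne, mul_comm (α j)]
    simpa [externalVisit, Fin.val_inj] using hj
  refine sum_Ioi_comp_equiv (symm _ _) (symm _ _) (Equiv.swap p.castSucc p.succ) ?_
  intro j j' hj
  simp only [Function.comp_apply]
  congr 1
  refine orderedGreen_congr rfl rfl rfl rfl ?_
  have him : ∀ j, (externalVisit v j).time.im = (v j).1 := by intro j; simp [externalVisit]
  rw [him, him]
  simp only [externalVisit, Nat.cast_le, swap_val]
  by_cases h1 : j = p.castSucc ∧ j' = p.succ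
  · right; right
    simpa [h1.1, h1.2] using hp.sub_comm
  by_cases h2 : j = p.succ ∧ j' = p.castSucc
  · right; right
    simpa [h2.1, h2.2] using hp
  left
  have e1 : ∀ j, j = p.castSucc ↔ (j : ℕ) = p := fun j => by simp [Fin.ext_iff]
  have e2 : ∀ j, j = p.succ ↔ (j : ℕ) = p + 1 := fun j => by simp [Fin.ext_iff]
  have hj' : (j : ℕ) ≠ j' := fun h => hj (Fin.ext h)
  rw [e1, e2] at h1 h2
  split_ifs <;> omega

lemma NonLightCone.comp_equiv {k : ℕ} {v : Fin k → ℝ × ℝ} (hv : NonLightCone v)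
    (σ : Equiv.Perm (Fin k)) : NonLightCone (v ∘ σ) := by
  intro j j' hj m
  have hne : σ j ≠ σ j' := fun h => hj.ne (σ.injective h)
  rcases lt_or_gt_of_ne hne with h | h
  · exact hv _ _ h m
  · obtain ⟨h1, h2⟩ := hv _ _ h (-m)
    push_cast at h1 h2
    simp only [Function.comp_apply]
    exact ⟨fun h => h1 (by linarith), fun h => h2 (by linarith)⟩

lemma Screened.comp {k : ℕ} {b : ℝ} {α : Fin k → ℂ} {v : Fin k → ℝ × ℝ} (H : Screened b α v w)
    (σ : Equiv.Perm (Fin k)) : Screened b (α ∘ σ) (v ∘ σ) w where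
  pos := H.pos
  re_gt j := H.re_gt (σ j)
  sum_re := (Equiv.sum_comp σ fun j => (α j).re).trans H.sum_re
  nonLightCone := H.nonLightCone.comp_equiv σ

lemma screened_of_nonneg (hb : 0 < b) (hα : ∀ j, -(1 / (2 * b)) < (α j).re) (hv : NonLightCone v)
    {w : ℤ} (hw : -(1 / (b : ℂ)) * ∑ j, α j = (w : ℂ)) (h0 : 0 ≤ w) :
    Screened b α v w.toNat where
  pos := hb
  re_gt := hα
  nonLightCone := hv
  sum_re := by
    have h1 : ∑ j, α j = ((-(b * w) : ℝ) : ℂ) := by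
      push_cast
      rw [← hw]
      have : (b : ℂ) ≠ 0 := by exact_mod_cast hb.ne'
      field_simp
    have h2 := congrArg Complex.re h1
    rw [Complex.re_sum, Complex.ofReal_re] at h2
    rw [h2]
    have : ((w.toNat : ℤ) : ℝ) = w := by rw [Int.toNat_of_nonneg h0]
    rw [← this, Int.cast_natCast]

lemma Screened.integrable_screeningIntegrand (H : Screened b α v w) :
    Integrable (screeningIntegrand b α v w) (screeningMeasure w) :=
  (H.integrable_path (fun j => Nat.lt_succ_iff.1 j.2) _).congr
    (screeningIntegrand_ae_eq b α v w).symm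

end exchange

end TimelikeLiouville

theorem theorem2p3 {n : ℕ} (b μ : ℝ) (hb : 0 < b) (hμ : 0 < μ)
    (α : Fin (n + 1) → ℂ) (v : Fin (n + 1) → ℝ × ℝ)
    (hα : ∀ j, -(1 / (2 * b)) < (α j).re)
    (w : ℤ) (hw : -(1 / (b : ℂ)) * ∑ j, α j = (w : ℂ))
    (hv : ∀ j, v j ∈ TimelikeLiouville.cylinder)
    (hlc : TimelikeLiouville.NonLightCone v)
    (p : Fin n)
    (hp : TimelikeLiouville.SpacelikeSeparated (v p.castSucc) (v p.succ)) :
    (0 ≤ w →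
      MeasureTheory.Integrable
        (TimelikeLiouville.screeningIntegrand b α v w.toNat)
        (TimelikeLiouville.screeningMeasure w.toNat) ∧
      MeasureTheory.Integrable
        (TimelikeLiouville.screeningIntegrand b (α ∘ Equiv.swap p.castSucc p.succ)
          (v ∘ Equiv.swap p.castSucc p.succ) w.toNat)
        (TimelikeLiouville.screeningMeasure w.toNat)) ∧
    TimelikeLiouville.lorentzianCorrelator b μ w α v =
      TimelikeLiouville.lorentzianCorrelator b μ w
        (α ∘ Equiv.swap p.castSucc p.succ) (v ∘ Equiv.swap p.castSucc p.succ) := by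
  have H : 0 ≤ w → TimelikeLiouville.Screened b α v w.toNat := fun h0 =>
    TimelikeLiouville.screened_of_nonneg hb hα hlc hw h0
  refine ⟨fun h0 => ⟨(H h0).integrable_screeningIntegrand,
    ((H h0).comp _).integrable_screeningIntegrand⟩, ?_⟩
  unfold TimelikeLiouville.lorentzianCorrelator
  split_ifs with h
  · rfl
  · rw [TimelikeLiouville.sum_external_swap α v p hp.spacelike,
      MeasureTheory.integral_congr_ae (TimelikeLiouville.screeningIntegrand_ae_eq b α v w.toNat),
      MeasureTheory.integral_congr_ae (TimelikeLiouville.screeningIntegrand_ae_eq b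
        (α ∘ Equiv.swap p.castSucc p.succ) (v ∘ Equiv.swap p.castSucc p.succ) w.toNat)]
    congr 1
    exact TimelikeLiouville.pathIntegral_swap (H (not_lt.1 h)) hp.spacelike
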